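/- Let $A\to M$ be a smooth real vector bundle of finite rank over a smooth (finite-dimensional, Hausdorff, second countable) manifold. Let $\mathcal F$ be the bigraded Poisson algebra of functions on $T^*[2]A[1]$, polynomial in the momenta, with its canonical even Poisson bracket $\{\ ,\ \}$ (the big bracket, normalized by $\{x^i,p_j\}=\delta^i_j$, $\{\xi^a,\theta_b\}=\delta^a_b$, where $x^i,\xi^a,p_i,\theta_a$ have bidegrees $(0,0),(0,1),(1,1),(1,0)$). Elements of bidegree $(p+1,q+1)$ are said to have shifted bidegree $(p,q)$; sections of $\wedge^\bullet A$ and of $\wedge^\bullet A^*$ are regarded as elements of $\mathcal F$. A Lie algebroid structure on $A$ is an element $\mu$ of shifted bidegree $(0,1)$ with $\{\mu,\mu\}=0$; its bracket is $[X,Y]_\mu=\{\{X,\mu\},Y\}$, its anchor $\rho$ is given by $\rho(X)f=\{\{X,\mu\},f\}$, and $d_\mu=\{\mu,\cdot\,\}$. Let $\mu$ be a Lie algebroid structure on $A$, let $\pi\in\Gamma(\wedge^2A)$ be a bivector and $\omega\in\Gamma(\wedge^2A^*)$ a $2$-form. Put $\pi^\sharp\alpha=i_\alpha\pi$, $\omega^\flat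 X=-i_X\omega$, $N=\pi^\sharp\circ\omega^\flat$, $\gamma_\pi=\{\pi,\mu\}$, $\widetilde\mu=\{\gamma_\pi,\omega\}=\{\{\pi,\mu\},\omega\}$, $[X,Y]^\mu_N=[NX,Y]_\mu+[X,NY]_\mu-N[X,Y]_\mu$, $i_{X\wedge Y}=i_X\circ i_Y$, $[\pi,\pi]_\mu=\{\{\pi,\mu\},\pi\}$ and $[\omega,\omega]_\pi=\{\{\omega,\gamma_\pi\},\omega\}$. Then: (1) $\widetilde\mu$ has shifted bidegree $(0,1)$, and for all $X,Y\in\Gamma A$ and $f\in C^\infty(M)$, $$\{\{X,\widetilde\mu\},Y\}=[X,Y]^\mu_N-\pi^\sharp(i_{X\wedge Y}d_\mu\omega),\qquad \{\{X,\widetilde\mu\},f\}=\rho(NX)f .$$ (2) $\widetilde\mu$ is a Lie algebroid structure on $A$ (that is, $\{\widetilde\mu,\widetilde\mu\}=0$) if and only if the bracket $(X,Y)\mapsto[X,Y]^\mu_N-\pi^\sharp(i_{X\wedge Y}d_\mu\omega)$ on $\Gamma A$ is a Lie algebroid bracket with anchor $\rho\circ N$ (that is, $\rho\circ N$ is a vector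 bundle map $A\to TM$, the bracket is a real Lie algebra bracket, and $[X,fY]=f[X,Y]+(\rho(NX)f)\,Y$). (3) If $\{\gamma_\pi,\gamma_\pi\}=0$, then $\widetilde\mu$ is a Lie algebroid structure on $A$ if and only if $\{[\omega,\omega]_\pi,\gamma_\pi\}=0$. (4) If $\pi$ is Poisson, i.e. $[\pi,\pi]_\mu=0$, and $\omega$ is a complementary $2$-form for $\pi$, i.e. $[\omega,\omega]_\pi=0$, then $\widetilde\mu$ is a Lie algebroid structure on $A$; hence the bracket in (1) is a Lie algebroid bracket with anchor $\rho\circ N$. -/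

import Mathlib

open scoped Manifold ContDiff Topology

namespace BigBracket

set_option linter.unusedSectionVars false

noncomputable section

/-! ## Linear algebra in one fibre -/

section Fibre

variable {V : Type*} [AddCommGroup V] [Module ℝ V]

/-- The exterior algebra `⋀ V^*`. -/
abbrev Ext (V : Type*) [AddCommGroup V] [Module ℝ V] : Type _ :=
  ExteriorAlgebra ℝ (Module.Dual ℝ V)

/-- The parity automorphism of `⋀ V^*`: it is `(-1)^n` on `⋀^n V^*`. -/
def parity : Ext V →ₐ[ℝ] Ext V := CliffordAlgebra.involute

/-- The interior product `i_v : ⋀ V^* → ⋀ V^*`, the antiderivation of degree `-1` with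
`i_v α = α v` for `α ∈ V^*`. -/
def intProd : V →ₗ[ℝ] Module.End ℝ (Ext V) :=
  (CliffordAlgebra.contractLeft (Q := (0 : QuadraticForm ℝ (Module.Dual ℝ V)))).comp
    (Module.Dual.eval ℝ V)

theorem intProd_inner (v : V) : intProd v * intProd v = 0 := by
  refine LinearMap.ext fun a => ?_
  exact CliffordAlgebra.contractLeft_contractLeft (Q := (0 : QuadraticForm ℝ (Module.Dual ℝ V))) _ a

/-- The interior product `i_P : ⋀ V^* → ⋀ V^*` by a multivector `P ∈ ⋀ V`, with
`i_{P ∧ Q} = i_P ∘ i_Q`. -/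
def innerMulti : ExteriorAlgebra ℝ V →ₐ[ℝ] Module.End ℝ (Ext V) :=
  ExteriorAlgebra.lift ℝ ⟨intProd, intProd_inner⟩

/-- For `P ∈ ⋀^2 V` and `α ∈ V^*`, the vector `P^♯ α = i_α P`;
thus `(v ∧ w)^♯ α = α(v) w - α(w) v`. -/
def sharpAt (P : ExteriorAlgebra ℝ V) (α : Module.Dual ℝ V) : V :=
  ExteriorAlgebra.ιInv
    (CliffordAlgebra.contractLeft (Q := (0 : QuadraticForm ℝ V)) α P)

theorem intProd_ι_mul (v : V) (α : Module.Dual ℝ V) (b : Ext V) :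
    intProd v (ExteriorAlgebra.ι ℝ α * b) = α v • b - ExteriorAlgebra.ι ℝ α * intProd v b :=
  CliffordAlgebra.contractLeft_ι_mul (Q := (0 : QuadraticForm ℝ (Module.Dual ℝ V))) _ α b

theorem intProd_algebraMap (v : V) (r : ℝ) : intProd v (algebraMap ℝ (Ext V) r) = 0 :=
  CliffordAlgebra.contractLeft_algebraMap (0 : QuadraticForm ℝ (Module.Dual ℝ V)) _ r

theorem parity_ι (α : Module.Dual ℝ V) :
    parity (ExteriorAlgebra.ι ℝ α) = -ExteriorAlgebra.ι ℝ α :=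
  CliffordAlgebra.involute_ι _

theorem intProd_mul (v : V) (a b : Ext V) :
    intProd v (a * b) = intProd v a * b + parity a * intProd v b := by
  induction a using CliffordAlgebra.left_induction with
  | algebraMap r =>
    have h1 := intProd_algebraMap v r
    have h2 : parity (algebraMap ℝ (Ext V) r) = algebraMap ℝ (Ext V) r := AlgHom.commutes _ _
    erw [h1, h2]
    rw [zero_mul, zero_add]
    exact CliffordAlgebra.contractLeft_algebraMap_mul
      (Q := (0 : QuadraticForm ℝ (Module.Dual ℝ V))) _ r b
  | add x y hx hy => simp only [add_mul, map_add, hx, hy]; abel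
  | ι_mul x α hx =>
    have h1 := intProd_ι_mul v α (x * b)
    have h2 := intProd_ι_mul v α x
    have h3 := parity_ι α
    change intProd v (ExteriorAlgebra.ι ℝ α * x * b) =
      intProd v (ExteriorAlgebra.ι ℝ α * x) * b + parity (ExteriorAlgebra.ι ℝ α * x) * intProd v b
    rw [mul_assoc, h1, h2, hx, map_mul, h3]
    simp only [sub_mul, mul_add, neg_mul, smul_mul_assoc, mul_assoc]
    abel

theorem intProd_parity (v : V) (a : Ext V) : intProd v (parity a) = -parity (intProd v a) := by
  induction a using CliffordAlgebra.left_induction with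
  | algebraMap r =>
    have h1 := intProd_algebraMap v r
    have h2 : parity (algebraMap ℝ (Ext V) r) = algebraMap ℝ (Ext V) r := AlgHom.commutes _ _
    erw [h2, h1]
    simp
  | add x y hx hy => simp only [map_add, hx, hy]; abel
  | ι_mul x α hx =>
    change intProd v (parity (ExteriorAlgebra.ι ℝ α * x)) =
      -parity (intProd v (ExteriorAlgebra.ι ℝ α * x))
    rw [map_mul, parity_ι, neg_mul, map_neg, intProd_ι_mul, intProd_ι_mul, hx, map_sub, map_mul,
      parity_ι, map_smul]
    simp

theorem innerMulti_ι_mul_ι (v w : V) (a : Ext V) :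
    innerMulti (ExteriorAlgebra.ι ℝ v * ExteriorAlgebra.ι ℝ w) a = intProd v (intProd w a) := by
  rw [innerMulti, map_mul, ExteriorAlgebra.lift_ι_apply, ExteriorAlgebra.lift_ι_apply]
  rfl

theorem algebraMapInv_ι_mul (α : Module.Dual ℝ V) (x : Ext V) :
    ExteriorAlgebra.algebraMapInv (ExteriorAlgebra.ι ℝ α * x) = 0 := by
  rw [map_mul, ExteriorAlgebra.algebraMapInv, ExteriorAlgebra.lift_ι_apply]
  simp

theorem ιInv_ι_mul (v : V) (x : ExteriorAlgebra ℝ V) :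
    ExteriorAlgebra.ιInv (ExteriorAlgebra.ι ℝ v * x) =
      ExteriorAlgebra.algebraMapInv x • v := by
  let _ : Module ℝᵐᵒᵖ V := Module.compHom _ ((RingHom.id ℝ).fromOpposite mul_comm)
  have : IsCentralScalar ℝ V := ⟨fun r m => rfl⟩
  have h : ∀ y : ExteriorAlgebra ℝ V,
      ExteriorAlgebra.ιInv y = (ExteriorAlgebra.toTrivSqZeroExt y).snd := fun _ => rfl
  have h2 : (ExteriorAlgebra.toTrivSqZeroExt x).fst = ExteriorAlgebra.algebraMapInv x := by
    have : (TrivSqZeroExt.fstHom ℝ ℝ V).comp ExteriorAlgebra.toTrivSqZeroExt =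
        ExteriorAlgebra.algebraMapInv := by
      apply ExteriorAlgebra.hom_ext
      ext β
      simp [ExteriorAlgebra.algebraMapInv]
    exact DFunLike.congr_fun this x
  rw [h, map_mul, ExteriorAlgebra.toTrivSqZeroExt_ι]
  simp [h2]

theorem ιInv_algebraMap (r : ℝ) :
    ExteriorAlgebra.ιInv (algebraMap ℝ (ExteriorAlgebra ℝ V) r) = 0 := by
  let _ : Module ℝᵐᵒᵖ V := Module.compHom _ ((RingHom.id ℝ).fromOpposite mul_comm)
  have : IsCentralScalar ℝ V := ⟨fun r m => rfl⟩
  have h : ∀ y : ExteriorAlgebra ℝ V,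
      ExteriorAlgebra.ιInv y = (ExteriorAlgebra.toTrivSqZeroExt y).snd := fun _ => rfl
  rw [h, AlgHom.commutes]
  rfl

theorem algebraMapInv_intProd (v : V) (a : Ext V) :
    ExteriorAlgebra.algebraMapInv (intProd v a) = ExteriorAlgebra.ιInv a v := by
  induction a using CliffordAlgebra.left_induction with
  | algebraMap r =>
    have h1 := intProd_algebraMap v r
    have h2 : ExteriorAlgebra.ιInv (algebraMap ℝ (Ext V) r) = 0 := ιInv_algebraMap r
    erw [h1, h2]
    simp
  | add x y hx hy => simp only [map_add, hx, hy, LinearMap.add_apply]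
  | ι_mul x α hx =>
    change ExteriorAlgebra.algebraMapInv (intProd v (ExteriorAlgebra.ι ℝ α * x)) =
      ExteriorAlgebra.ιInv (ExteriorAlgebra.ι ℝ α * x) v
    rw [intProd_ι_mul, map_sub, algebraMapInv_ι_mul, ιInv_ι_mul, map_smul]
    simp [mul_comm]

theorem sharpAt_add (P Q : ExteriorAlgebra ℝ V) (α : Module.Dual ℝ V) :
    sharpAt (P + Q) α = sharpAt P α + sharpAt Q α := by
  unfold sharpAt
  rw [map_add, map_add]

theorem sharpAt_zero (α : Module.Dual ℝ V) : sharpAt (0 : ExteriorAlgebra ℝ V) α = 0 := by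
  unfold sharpAt
  rw [map_zero, map_zero]

theorem sharpAt_ι_mul_ι (v w : V) (α : Module.Dual ℝ V) :
    sharpAt (ExteriorAlgebra.ι ℝ v * ExteriorAlgebra.ι ℝ w) α = α v • w - α w • v := by
  have h : CliffordAlgebra.contractLeft (Q := (0 : QuadraticForm ℝ V)) α
      (ExteriorAlgebra.ι ℝ v * ExteriorAlgebra.ι ℝ w) =
      α v • ExteriorAlgebra.ι ℝ w - α w • ExteriorAlgebra.ι ℝ v := by
    refine (CliffordAlgebra.contractLeft_ι_mul (Q := (0 : QuadraticForm ℝ V)) α v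
      (ExteriorAlgebra.ι ℝ w)).trans ?_
    have h2 := CliffordAlgebra.contractLeft_ι (d := α) (0 : QuadraticForm ℝ V) w
    erw [h2]
    congr 1
    rw [Algebra.smul_def]
    exact (Algebra.commutes _ _).symm
  unfold sharpAt
  rw [h, map_sub, map_smul, map_smul, ExteriorAlgebra.ι_leftInverse, ExteriorAlgebra.ι_leftInverse]

end Fibre

/-! ## Sections, forms and bivectors of a smooth vector bundle `A → M` -/

section Bundle

variable (E : Type*) [NormedAddCommGroup E] [NormedSpace ℝ E]
  {M : Type*} [TopologicalSpace M] [ChartedSpace E M]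
  (F : Type*) [NormedAddCommGroup F] [NormedSpace ℝ F]
  (A : M → Type*) [TopologicalSpace (Bundle.TotalSpace F A)]
  [∀ x, AddCommGroup (A x)] [∀ x, Module ℝ (A x)] [∀ x, TopologicalSpace (A x)]
  [FiberBundle F A] [VectorBundle ℝ F A]

/-- `C^∞(M)`. -/
abbrev Fn (E : Type*) [NormedAddCommGroup E] [NormedSpace ℝ E]
    (M : Type*) [TopologicalSpace M] [ChartedSpace E M] : Type _ :=
  C^∞⟮𝓘(ℝ, E), M; ℝ⟯

/-- `Γ A`, the smooth sections of `A`. -/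
abbrev Sec : Type _ := Cₛ^∞⟮𝓘(ℝ, E); F, A⟯

variable {E F A} in
/-- The section `g X`, for `g ∈ C^∞(M)` and `X ∈ Γ A`. -/
def fnSmul (g : Fn E M) (X : Sec E F A) : Sec E F A :=
  ⟨fun x => g x • X x, g.contMDiff.smul_section X.contMDiff⟩

variable {A} in
/-- A field `x ↦ s x ∈ ⋀ A_x^*` is smooth if, for all smooth sections `X₁, …, X_r` of `A`, the
degree-zero component of `i_{X_r} ⋯ i_{X_1} s` is a smooth function
(for `s` of degree `r` this is the function `s(X₁, …, X_r)`). -/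
def IsSmoothForm (s : ∀ x, Ext (A x)) : Prop :=
  ∀ L : List (Sec E F A), ContMDiff 𝓘(ℝ, E) 𝓘(ℝ, ℝ) ∞ fun x =>
    ExteriorAlgebra.algebraMapInv (L.foldl (fun a X => intProd (X x) a) (s x))

section SmoothLemmas

variable {E F A}

theorem foldl_intProd_add {x : M} (L : List (Sec E F A)) (a b : Ext (A x)) :
    L.foldl (fun a X => intProd (X x) a) (a + b) =
      L.foldl (fun a X => intProd (X x) a) a + L.foldl (fun a X => intProd (X x) a) b := by
  induction L generalizing a b with
  | nil => rfl
  | cons X L ih => rw [List.foldl_cons, map_add, ih]; rfl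

theorem foldl_intProd_smul {x : M} (L : List (Sec E F A)) (c : ℝ) (a : Ext (A x)) :
    L.foldl (fun a X => intProd (X x) a) (c • a) =
      c • L.foldl (fun a X => intProd (X x) a) a := by
  induction L generalizing a with
  | nil => rfl
  | cons X L ih => rw [List.foldl_cons, map_smul, ih]; rfl

theorem IsSmoothForm.add {s t : ∀ x, Ext (A x)} (hs : IsSmoothForm E F s)
    (ht : IsSmoothForm E F t) : IsSmoothForm E F (s + t) := fun L => by
  simp only [Pi.add_apply, foldl_intProd_add, map_add]
  exact (hs L).add (ht L)

theorem IsSmoothForm.const_smul {s : ∀ x, Ext (A x)} (c : ℝ) (hs : IsSmoothForm E F s) :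
    IsSmoothForm E F (c • s) := fun L => by
  simp only [Pi.smul_apply, foldl_intProd_smul, map_smul]
  exact (contMDiff_const (c := c)).mul (hs L)

theorem IsSmoothForm.zero : IsSmoothForm E F (0 : ∀ x, Ext (A x)) := fun L => by
  have h : ∀ x, L.foldl (fun a X => intProd (X x) a) (0 : Ext (A x)) = 0 := fun x => by
    have := foldl_intProd_smul (x := x) L 0 0
    rwa [zero_smul, zero_smul] at this
  simp only [Pi.zero_apply, h, map_zero]
  exact contMDiff_const

theorem IsSmoothForm.intProd {s : ∀ x, Ext (A x)} (X : Sec E F A) (hs : IsSmoothForm E F s) :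
    IsSmoothForm E F (fun x => intProd (X x) (s x)) := fun L => hs (X :: L)

theorem IsSmoothForm.parityField {s : ∀ x, Ext (A x)} (hs : IsSmoothForm E F s) :
    IsSmoothForm E F (fun x => parity (s x)) := fun L => by
  induction L generalizing s with
  | nil =>
    have h : ∀ x, ExteriorAlgebra.algebraMapInv (parity (s x)) =
        ExteriorAlgebra.algebraMapInv (s x) := fun x => by
      have : (ExteriorAlgebra.algebraMapInv (R := ℝ) (M := Module.Dual ℝ (A x))).comp
          parity = ExteriorAlgebra.algebraMapInv := by
        ext α
        simp [parity_ι, ExteriorAlgebra.algebraMapInv]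
      exact DFunLike.congr_fun this (s x)
    simp only [List.foldl_nil, h]
    exact hs []
  | cons X L ih =>
    have := (IsSmoothForm.intProd X hs).const_smul (-1)
    have := ih this
    simp only [Pi.smul_apply, neg_smul, one_smul, map_neg] at this
    simpa only [List.foldl_cons, intProd_parity] using this

theorem IsSmoothForm.mul {s t : ∀ x, Ext (A x)} (hs : IsSmoothForm E F s)
    (ht : IsSmoothForm E F t) : IsSmoothForm E F (s * t) := fun L => by
  induction L generalizing s t with
  | nil =>
    simp only [List.foldl_nil, Pi.mul_apply, map_mul]
    exact (hs []).mul (ht [])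
  | cons X L ih =>
    simp only [List.foldl_cons, Pi.mul_apply, intProd_mul, foldl_intProd_add, map_add]
    exact (ih (hs.intProd X) ht).add (ih hs.parityField (ht.intProd X))

theorem IsSmoothForm.ofFn {g : M → ℝ} (hg : ContMDiff 𝓘(ℝ, E) 𝓘(ℝ, ℝ) ∞ g) :
    IsSmoothForm E F (fun x => algebraMap ℝ (Ext (A x)) (g x)) := fun L => by
  cases L with
  | nil =>
    simp only [List.foldl_nil]
    have h : ∀ x, ExteriorAlgebra.algebraMapInv (algebraMap ℝ (Ext (A x)) (g x)) = g x :=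
      fun x => ExteriorAlgebra.algebraMap_leftInverse _ _
    simpa only [h] using hg
  | cons X L =>
    simp only [List.foldl_cons, intProd_algebraMap]
    exact IsSmoothForm.zero (E := E) (F := F) (A := A) L

end SmoothLemmas

/-- `Γ(⋀ A^*)`, the algebra of (inhomogeneous) forms on `A`, that is, of functions on `A[1]`. -/
def Form : Subalgebra ℝ (∀ x, Ext (A x)) where
  carrier := {s | IsSmoothForm E F s}
  mul_mem' := IsSmoothForm.mul
  add_mem' := IsSmoothForm.add
  algebraMap_mem' r := IsSmoothForm.ofFn (g := fun _ => r) contMDiff_const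

variable {E F A}

/-- The form `f` is homogeneous of degree `n`. -/
def IsDeg (n : ℕ) (f : Form E F A) : Prop :=
  ∀ x, f.1 x ∈ (⋀[ℝ]^n (Module.Dual ℝ (A x)))

/-- A function regarded as a form of degree `0`. -/
def fnForm (g : Fn E M) : Form E F A :=
  ⟨fun x => algebraMap ℝ (Ext (A x)) (g x), IsSmoothForm.ofFn g.contMDiff⟩

/-- The component of degree `0` of a form. -/
def formFn (f : Form E F A) : Fn E M :=
  ⟨fun x => ExteriorAlgebra.algebraMapInv (f.1 x), f.2 []⟩

/-- The interior product `i_X f`. -/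
def innerForm (X : Sec E F A) (f : Form E F A) : Form E F A :=
  ⟨fun x => intProd (X x) (f.1 x), IsSmoothForm.intProd X f.2⟩

/-- `f ↦ (-1)^n f` on forms of degree `n`. -/
def parityForm (f : Form E F A) : Form E F A :=
  ⟨fun x => parity (f.1 x), IsSmoothForm.parityField f.2⟩

/-- The component of even degree of a form. -/
def evenPart (f : Form E F A) : Form E F A := (2⁻¹ : ℝ) • (f + parityForm f)

/-- The component of odd degree of a form. -/
def oddPart (f : Form E F A) : Form E F A := (2⁻¹ : ℝ) • (f - parityForm f)

variable (E F A) in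
/-- A bivector on `A`, that is, a smooth section of `⋀^2 A`: near each point it is a finite sum
of products `X ∧ Y` of smooth sections `X`, `Y` of `A`. -/
structure Bivector where
  /-- The value at a point. -/
  val : ∀ x, ExteriorAlgebra ℝ (A x)
  smooth : ∀ x, ∃ L : List (Sec E F A × Sec E F A), ∀ᶠ y in 𝓝 x,
    val y = (L.map fun p => ExteriorAlgebra.ι ℝ (p.1 y) * ExteriorAlgebra.ι ℝ (p.2 y)).sum

variable (E F A) in
/-- A `2`-form on `A`, that is, a smooth section of `⋀^2 A^*`. -/
def TwoForm : Type _ := {f : Form E F A // IsDeg 2 f}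

/-- The interior product `i_π f` by a bivector, with `i_{X ∧ Y} = i_X ∘ i_Y`. -/
def Bivector.innerForm (π : Bivector E F A) (f : Form E F A) : Form E F A :=
  ⟨fun x => innerMulti (π.val x) (f.1 x), fun K x => by
    obtain ⟨L, hL⟩ := π.smooth x
    have key : ∀ L : List (Sec E F A × Sec E F A), IsSmoothForm E F fun y =>
        innerMulti ((L.map fun p =>
          ExteriorAlgebra.ι ℝ (p.1 y) * ExteriorAlgebra.ι ℝ (p.2 y)).sum) (f.1 y) := by
      intro L
      induction L with
      | nil =>
        simp only [List.map_nil, List.sum_nil, map_zero, LinearMap.zero_apply]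
        exact IsSmoothForm.zero
      | cons p L ih =>
        simp only [List.map_cons, List.sum_cons, map_add, LinearMap.add_apply,
          innerMulti_ι_mul_ι]
        exact ((f.2.intProd p.2).intProd p.1).add ih
    refine (key L K x).congr_of_eventuallyEq ?_
    filter_upwards [hL] with y hy
    rw [hy]⟩

/-- `π^♯ α = i_α π` for a `1`-form `α` (only the component of degree `1` of the form `α` enters). -/
def Bivector.sharp (π : Bivector E F A) (α : Form E F A) : Sec E F A :=
  ⟨fun x => sharpAt (π.val x) (ExteriorAlgebra.ιInv (α.1 x)), fun x => by
    obtain ⟨L, hL⟩ := π.smooth x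
    have pair : ∀ X : Sec E F A, ContMDiff 𝓘(ℝ, E) 𝓘(ℝ, ℝ) ∞ fun y =>
        (ExteriorAlgebra.ιInv (α.1 y)) (X y) := by
      intro X
      have h : ∀ y (a : Ext (A y)), ExteriorAlgebra.algebraMapInv (intProd (X y) a) =
          (ExteriorAlgebra.ιInv a) (X y) := by
        intro y a
        exact algebraMapInv_intProd (X y) a
      have := α.2 [X]
      simpa only [List.foldl_cons, List.foldl_nil, h] using this
    have key : ∀ L : List (Sec E F A × Sec E F A),
        ContMDiff 𝓘(ℝ, E) (𝓘(ℝ, E).prod 𝓘(ℝ, F)) ∞ fun y =>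
        Bundle.TotalSpace.mk' F y (sharpAt ((L.map fun p =>
          ExteriorAlgebra.ι ℝ (p.1 y) * ExteriorAlgebra.ι ℝ (p.2 y)).sum)
          (ExteriorAlgebra.ιInv (α.1 y))) := by
      intro L
      induction L with
      | nil =>
        simp only [List.map_nil, List.sum_nil, sharpAt_zero]
        exact (0 : Sec E F A).contMDiff
      | cons p L ih =>
        simp only [List.map_cons, List.sum_cons, sharpAt_add, sharpAt_ι_mul_ι]
        exact (((pair p.1).smul_section p.2.contMDiff).sub_section
          ((pair p.2).smul_section p.1.contMDiff)).add_section ih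
    refine (key L x).congr_of_eventuallyEq ?_
    filter_upwards [hL] with y hy
    rw [hy]⟩

/-- `om^♭ X = - i_X om`. -/
def TwoForm.flat (om : TwoForm E F A) (X : Sec E F A) : Form E F A := -innerForm X om.1

/-! ## Functions on `T^*[2]A[1]` and the big bracket -/

variable (E F A) in
/-- A function `u` on `T^*[2]A[1]`, polynomial in the momenta, is encoded by its fibrewise Taylor
coefficients along the zero section `A[1]`: the value of `u` at a list `[f₁, …, f_k]` of functions
on `A[1]` (elements of `Γ(⋀ A^*)`) is the restriction of `{⋯{{u, f₁}, f₂}⋯, f_k}` to `A[1]`.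
The functions of bidegree `(k, q)` are singled out by `IsBidegree` below. -/
def Symb : Type _ := List (Form E F A) → Form E F A

instance : AddCommGroup (Symb E F A) := Pi.addCommGroup

/-- `u` is a function on `T^*[2]A[1]` of bidegree `(k, q)`, that is, of shifted bidegree
`(k - 1, q - 1)`. With coordinates `(x^i, ξ^a)` on `A[1]` and momenta `(p_i, θ_a)`, the
bidegrees of `x^i, ξ^a, p_i, θ_a` are `(0,0), (0,1), (1,1), (1,0)`, so `k` is the degree in the
momenta, and `u` is the same as a graded symmetric `k`-derivation
`(f₁, …, f_k) ↦ {⋯{{u, f₁}, f₂}⋯, f_k}` of the graded commutative algebra `Γ(⋀ A^*)` of functions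
on `A[1]`, mapping forms of degrees `n₁, …, n_k` to a form of degree `n₁ + ⋯ + n_k + q - k`. -/
structure IsBidegree (k q : ℕ) (u : Symb E F A) : Prop where
  arity : ∀ L : List (Form E F A), L.length ≠ k → u L = 0
  map_add : ∀ (L : List (Form E F A)) (f g : Form E F A) (L' : List (Form E F A)),
    u (L ++ (f + g) :: L') = u (L ++ f :: L') + u (L ++ g :: L')
  map_smul : ∀ (L : List (Form E F A)) (c : ℝ) (f : Form E F A) (L' : List (Form E F A)),
    u (L ++ (c • f) :: L') = c • u (L ++ f :: L')
  symm : ∀ (L : List (Form E F A)) (m n : ℕ) (f g : Form E F A) (L' : List (Form E F A)),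
    IsDeg m f → IsDeg n g →
      u (L ++ f :: g :: L') = (-1 : ℝ) ^ (m * n) • u (L ++ g :: f :: L')
  leibniz : ∀ (L : List (Form E F A)) (ns : List ℕ) (n : ℕ) (f g : Form E F A),
    List.Forall₂ IsDeg ns L → IsDeg n f →
      u (L ++ [f * g]) =
        u (L ++ [f]) * g + (-1 : ℝ) ^ ((k + q + ns.sum) * n) • (f * u (L ++ [g]))
  degree : ∀ (L : List (Form E F A)) (ns : List ℕ) (m : ℕ),
    List.Forall₂ IsDeg ns L → m + k = ns.sum + q → IsDeg m (u L)
  degree_neg : ∀ (L : List (Form E F A)) (ns : List ℕ),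
    List.Forall₂ IsDeg ns L → ns.sum + q < k → u L = 0

/-- A form on `A` as a function on `T^*[2]A[1]` (the pull-back from `A[1]`). -/
def ofForm (f : Form E F A) : Symb E F A
  | [] => f
  | _ => 0

/-- A section of `A` as a function on `T^*[2]A[1]`, linear in the momenta: `{X, f} = i_X f`. -/
def ofSec (X : Sec E F A) : Symb E F A
  | [f] => innerForm X f
  | _ => 0

/-- A bivector on `A` as a function on `T^*[2]A[1]`, quadratic in the momenta. For `π = X ∧ Y`,
the Leibniz rule `{u ∧ v, f} = u ∧ {v, f} + (-1)^{|v| |f|} {u, f} ∧ v` gives, for `f` of degree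
`n`, `{{π, f}, g} = (-1)^n (i_X f ∧ i_Y g - i_Y f ∧ i_X g)`, and this is the
expression below. -/
def ofBivector (π : Bivector E F A) : Symb E F A
  | [f, g] => π.innerForm (f * g) - π.innerForm f * g - f * π.innerForm g
  | _ => 0

/-- `{u, f}` for a function `f` on `A[1]`. -/
def ins (f : Form E F A) (u : Symb E F A) : Symb E F A := fun L => u (f :: L)

/-- The parity operator on functions on `T^*[2]A[1]`: it is `(-1)^{|u|}` on functions `u` of total
degree `|u|`. -/
def paritySymb (u : Symb E F A) : Symb E F A := fun L => parityForm (u (L.map parityForm))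

/-- The values of the big bracket `{u, v}`. For `u`, `v` and `f` homogeneous, the first clause is
`{u, v}|_{A[1]} = {u, v|_{A[1]}} - (-1)^{|u| |v|} {v, u|_{A[1]}}` on `A[1]`
and the second one is the graded Jacobi identity
`{{u, v}, f} = {u, {v, f}} + (-1)^{|v| |f|} {{u, f}, v}`;
the signs are implemented by decomposing into even and odd components. -/
def bracketAux : List (Form E F A) → Symb E F A → Symb E F A → Form E F A
  | [], u, v =>
    u [v []] - (v [evenPart (u [])] + paritySymb v [oddPart (u [])])
  | f :: L, u, v =>
    bracketAux L u (ins f v) +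
      (bracketAux L (ins (evenPart f) u) v + bracketAux L (ins (oddPart f) u) (paritySymb v))

/-- The big bracket `{u, v}`, the canonical Poisson bracket of `T^*[2]A[1]`. -/
def bracket (u v : Symb E F A) : Symb E F A := fun L => bracketAux L u v

/-! ## Lie algebroids -/

/-- `μ` is a Lie algebroid structure on `A`: an element of shifted bidegree `(0, 1)` with
`{μ, μ} = 0`. -/
def IsLieAlgebroidStructure (μ : Symb E F A) : Prop :=
  IsBidegree 1 2 μ ∧ bracket μ μ = 0

/-- The section of `A` given by a function of bidegree `(1, 0)` on `T^*[2]A[1]`. -/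
def toSec (u : Symb E F A) : Sec E F A :=
  open Classical in if h : ∃ X, ofSec X = u then h.choose else 0

/-- `[X, Y]_μ = {{X, μ}, Y}`. -/
def lieBr (μ : Symb E F A) (X Y : Sec E F A) : Sec E F A :=
  toSec (bracket (bracket (ofSec X) μ) (ofSec Y))

/-- The action `ρ(X) g = {{X, μ}, g}` of the anchor `ρ` of `(A, μ)` on functions. -/
def anchor (μ : Symb E F A) (X : Sec E F A) (g : Fn E M) : Fn E M :=
  formFn (bracket (bracket (ofSec X) μ) (ofForm (fnForm g)) [])

/-- The differential `d_μ f = {μ, f}` of a form. -/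
def diff (μ : Symb E F A) (f : Form E F A) : Form E F A :=
  bracket μ (ofForm f) []

/-- `br` is a Lie algebroid bracket on `Γ A` with anchor `a`: the bracket is a real Lie algebra
bracket, `a` is `C^∞(M)`-linear with values in the derivations of `C^∞(M)` (that is, `a` is given
by a vector bundle map `A → TM`), and `[X, gY] = g[X, Y] + (a(X)g) Y`. (That `a` preserves
brackets is a consequence.) -/
structure IsLieAlgebroidBracket (br : Sec E F A → Sec E F A → Sec E F A)
    (a : Sec E F A → Fn E M → Fn E M) : Prop where
  add_right : ∀ X Y Z, br X (Y + Z) = br X Y + br X Z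
  smul_right : ∀ (c : ℝ) X Y, br X (c • Y) = c • br X Y
  skew : ∀ X Y, br X Y = -br Y X
  jacobi : ∀ X Y Z, br X (br Y Z) = br (br X Y) Z + br Y (br X Z)
  anchor_map_add : ∀ X g h, a X (g + h) = a X g + a X h
  anchor_map_smul : ∀ X (c : ℝ) g, a X (c • g) = c • a X g
  anchor_map_mul : ∀ X g h, a X (g * h) = g * a X h + a X g * h
  anchor_add : ∀ X Y g, a (X + Y) g = a X g + a Y g
  anchor_fnSmul : ∀ h X g, a (fnSmul h X) g = h * a X g
  leibniz : ∀ X g Y, br X (fnSmul g Y) = fnSmul g (br X Y) + fnSmul (a X g) Y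

/-! ## The structure defined by a bivector and a `2`-form -/

/-- `N = π^♯ ∘ om^♭`. -/
def nTensor (π : Bivector E F A) (om : TwoForm E F A) (X : Sec E F A) : Sec E F A :=
  π.sharp (om.flat X)

/-- The deformed bracket `[X, Y]^μ_N = [NX, Y]_μ + [X, NY]_μ - N[X, Y]_μ`. -/
def deformedBr (μ : Symb E F A) (N : Sec E F A → Sec E F A) (X Y : Sec E F A) : Sec E F A :=
  lieBr μ (N X) Y + lieBr μ X (N Y) - N (lieBr μ X Y)

/-- The bracket `[X, Y]^μ_N - π^♯ (i_{X ∧ Y} d_μ om)`, where `N = π^♯ ∘ om^♭` and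
`i_{X ∧ Y} = i_X ∘ i_Y`. -/
def complBr (μ : Symb E F A) (π : Bivector E F A) (om : TwoForm E F A) (X Y : Sec E F A) :
    Sec E F A :=
  deformedBr μ (nTensor π om) X Y - π.sharp (innerForm X (innerForm Y (diff μ om.1)))

/-- `γ_π = {π, μ}`. -/
def gammaOf (μ : Symb E F A) (π : Bivector E F A) : Symb E F A :=
  bracket (ofBivector π) μ

/-- `μ̃ = {{π, μ}, om}`. -/
def muTilde (μ : Symb E F A) (π : Bivector E F A) (om : TwoForm E F A) : Symb E F A :=
  bracket (gammaOf μ π) (ofForm om.1)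

/-- `[u, v]_γ = {{u, γ}, v}`: for `γ = μ` the Schouten bracket of multivectors and, for
`γ = γ_π`, the Koszul bracket of forms. -/
def derivedBr (γ u v : Symb E F A) : Symb E F A := bracket (bracket u γ) v

/-- `π` is a Poisson bivector: `[π, π]_μ = 0`. -/
def IsPoisson (μ : Symb E F A) (π : Bivector E F A) : Prop :=
  derivedBr μ (ofBivector π) (ofBivector π) = 0

/-- `om` is a complementary `2`-form for `π`: `[om, om]_π = 0`. -/
def IsComplementary (μ : Symb E F A) (π : Bivector E F A) (om : TwoForm E F A) : Prop :=
  derivedBr (gammaOf μ π) (ofForm om.1) (ofForm om.1) = 0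

end Bundle

end

end BigBracket

open BigBracket

open scoped Manifold ContDiff Topology

namespace BigBracket

set_option linter.unusedSectionVars false

noncomputable section

/-! ### The graded algebra `⋀ V^*` of a single fibre. -/

section FibreLemmas

variable {V : Type*} [AddCommGroup V] [Module ℝ V]

/-! The theorem is a computation in a graded Lie algebra, once the recursively defined bracket is
known to be one. Total degree is measured by the integer `q - k`, which has the parity of `k + q`:
sections have degree `-1`, bivectors `-2`, `2`-forms `2`, and `μ`, `γ_π`, `μ̃` have degrees `1`,
`-1`, `1`. Graded antisymmetry and the graded Jacobi identity (`bracket_antisymm`, `bracket_jacobi`)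
follow by induction on the list of inserted forms, since inserting a form acts on a bracket as a
graded derivation.

Two rigidity facts supply the geometry. A multiderivation that vanishes on the zero section and
after insertion of any function or `1`-form is zero (`IsHom.eq_zero`, through the number operator in
local frames). Hence there is nothing of negative bidegree, so `{X, Y} = 0` and `{X, π} = 0`, and
every element of bidegree `(1, 0)` is a section (`IsHom.ofSec_toSec`).

For (1), Jacobi gives `μ̃ = {π, d_μ om} + {{π, om}, μ}`, where `{X, {π, om}} = N X`. Bracketing with
`X` and then with `Y` or a function produces each term of the formulas.

For (2), an element `ν` of bidegree `(1, 2)` has a derived bracket which is automatically skew and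
satisfies the Leibniz rule. Twice its Jacobiator is `{{Y, {X, {ν, ν}}}, Z}`. If all of these vanish,
replacing `Z` by `g Z` shows that the derivation `{ν, ν}` kills functions, and then that it kills
`1`-forms, so it is zero.

For (3), `{γ_π, γ_π} = 0` implies `{γ_π, μ̃} = 0`, and one more Jacobi identity gives `{[om, om]_π,
γ_π} = {μ̃, μ̃}`. For (4), `{μ, μ} = 0` implies `{γ_π, μ} = 0`, so that `{γ_π, γ_π} = {[π, π]_μ,
μ}`, and (3) applies. -/

theorem ext_induction {n : ℕ} {p : ℕ → Ext V → Prop} (h0 : ∀ r : ℝ, p 0 (algebraMap ℝ _ r))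
    (hadd : ∀ n a b, a ∈ ⋀[ℝ]^n (Module.Dual ℝ V) → b ∈ ⋀[ℝ]^n (Module.Dual ℝ V) →
      p n a → p n b → p n (a + b))
    (hmul : ∀ n (α : Module.Dual ℝ V) a, a ∈ ⋀[ℝ]^n (Module.Dual ℝ V) → p n a →
      p (n + 1) (ExteriorAlgebra.ι ℝ α * a))
    {a : Ext V} (ha : a ∈ ⋀[ℝ]^n (Module.Dual ℝ V)) : p n a := by
  refine Submodule.pow_induction_on_left' (M := LinearMap.range (ExteriorAlgebra.ι ℝ))
    (C := fun n a _ => p n a) h0 (fun x y i hx hy => hadd i x y hx hy) ?_ ha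
  rintro _ ⟨α, rfl⟩ i x hx h
  exact hmul i α x hx h

theorem ι_mul_mem {n : ℕ} (α : Module.Dual ℝ V) {a : Ext V}
    (ha : a ∈ ⋀[ℝ]^n (Module.Dual ℝ V)) :
    ExteriorAlgebra.ι ℝ α * a ∈ ⋀[ℝ]^(n + 1) (Module.Dual ℝ V) := by
  rw [add_comm]
  refine SetLike.GradedMul.mul_mem (A := fun i : ℕ => ⋀[ℝ]^i (Module.Dual ℝ V)) ?_ ha
  change _ ∈ LinearMap.range (ExteriorAlgebra.ι ℝ) ^ 1
  rw [pow_one]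
  exact ⟨α, rfl⟩

theorem algebraMap_mem_zero (r : ℝ) : algebraMap ℝ (Ext V) r ∈ ⋀[ℝ]^0 (Module.Dual ℝ V) :=
  SetLike.algebraMap_mem_graded (fun i : ℕ => ⋀[ℝ]^i (Module.Dual ℝ V)) r

/-- The two cases are proved together: contracting `α ∧ a` with `a` of degree `0` needs the
vanishing of `i_v a`, while in higher degree it needs the degree of `i_v a`. -/
theorem intProd_mem {n : ℕ} (v : V) {a : Ext V} (ha : a ∈ ⋀[ℝ]^n (Module.Dual ℝ V)) :
    (n = 0 → intProd v a = 0) ∧ ∀ m, n = m + 1 → intProd v a ∈ ⋀[ℝ]^m (Module.Dual ℝ V) := by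
  refine ext_induction (p := fun n a => (n = 0 → intProd v a = 0) ∧
    ∀ m, n = m + 1 → intProd v a ∈ ⋀[ℝ]^m (Module.Dual ℝ V)) ?_ ?_ ?_ ha
  · exact fun r => ⟨fun _ => intProd_algebraMap v r, by simp⟩
  · rintro n a b - - ⟨h1, h2⟩ ⟨h3, h4⟩
    refine ⟨fun h => by rw [map_add, h1 h, h3 h, add_zero], fun m h => ?_⟩
    rw [map_add]
    exact Submodule.add_mem _ (h2 m h) (h4 m h)
  · rintro n α a ha ⟨h1, h2⟩
    refine ⟨by simp, fun m h => ?_⟩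
    obtain rfl : n = m := by omega
    rw [intProd_ι_mul]
    refine Submodule.sub_mem _ (Submodule.smul_mem _ _ ha) ?_
    cases n with
    | zero => rw [h1 rfl, mul_zero]; exact Submodule.zero_mem _
    | succ k => exact ι_mul_mem α (h2 k rfl)

theorem intProd_of_mem_zero (v : V) {a : Ext V} (ha : a ∈ ⋀[ℝ]^0 (Module.Dual ℝ V)) :
    intProd v a = 0 := (intProd_mem v ha).1 rfl

theorem intProd_mem_of_succ {n : ℕ} (v : V) {a : Ext V}
    (ha : a ∈ ⋀[ℝ]^(n + 1) (Module.Dual ℝ V)) : intProd v a ∈ ⋀[ℝ]^n (Module.Dual ℝ V) :=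
  (intProd_mem v ha).2 n rfl

theorem parity_of_mem {n : ℕ} {a : Ext V} (ha : a ∈ ⋀[ℝ]^n (Module.Dual ℝ V)) :
    parity a = (-1 : ℝ) ^ n • a := by
  refine ext_induction (p := fun n a => parity a = (-1 : ℝ) ^ n • a) ?_ ?_ ?_ ha
  · intro r; rw [AlgHom.commutes]; simp
  · intro n a b _ _ h1 h2; rw [map_add, h1, h2, smul_add]
  · intro n α a _ h
    rw [map_mul, parity_ι, h, pow_succ]
    simp

theorem ι_mul_eq (α : Module.Dual ℝ V) (a : Ext V) :
    ExteriorAlgebra.ι ℝ α * a = parity a * ExteriorAlgebra.ι ℝ α := by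
  induction a using CliffordAlgebra.left_induction with
  | algebraMap r =>
    have h2 : parity (algebraMap ℝ (Ext V) r) = algebraMap ℝ (Ext V) r := AlgHom.commutes _ _
    erw [h2]
    exact (Algebra.commutes _ _).symm
  | add x y hx hy => rw [mul_add, hx, hy, map_add, add_mul]
  | ι_mul x β hx =>
    change ExteriorAlgebra.ι ℝ α * (ExteriorAlgebra.ι ℝ β * x) =
      parity (ExteriorAlgebra.ι ℝ β * x) * ExteriorAlgebra.ι ℝ α
    rw [map_mul, parity_ι, mul_assoc, ← hx, ← mul_assoc, ← mul_assoc,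
      eq_neg_of_add_eq_zero_left (ExteriorAlgebra.ι_add_mul_swap α β), neg_mul, neg_mul, neg_mul]

theorem mul_comm_of_mem {m n : ℕ} {a b : Ext V} (ha : a ∈ ⋀[ℝ]^m (Module.Dual ℝ V))
    (hb : b ∈ ⋀[ℝ]^n (Module.Dual ℝ V)) : a * b = (-1 : ℝ) ^ (m * n) • (b * a) := by
  refine ext_induction (p := fun m a => a * b = (-1 : ℝ) ^ (m * n) • (b * a)) ?_ ?_ ?_ ha
  · intro r; simp [Algebra.commutes]
  · intro m a a' _ _ h1 h2; rw [add_mul, h1, h2, mul_add, smul_add]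
  · intro m α a _ h
    rw [mul_assoc, h, mul_smul_comm, ← mul_assoc, ι_mul_eq, parity_of_mem hb, smul_mul_assoc,
      smul_mul_assoc, smul_smul, mul_assoc, ← pow_add]
    ring_nf

theorem eq_algebraMap_of_mem {a : Ext V} (ha : a ∈ ⋀[ℝ]^0 (Module.Dual ℝ V)) :
    a = algebraMap ℝ _ (ExteriorAlgebra.algebraMapInv a) := by
  refine ext_induction (p := fun n a => n = 0 →
    a = algebraMap ℝ (Ext V) (ExteriorAlgebra.algebraMapInv a)) ?_ ?_ ?_ ha rfl
  · intro r _; rw [ExteriorAlgebra.algebraMap_leftInverse]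
  · intro n a b _ _ h1 h2 h; rw [map_add, map_add, ← h1 h, ← h2 h]
  · simp

theorem eq_ι_of_mem {a : Ext V} (ha : a ∈ ⋀[ℝ]^1 (Module.Dual ℝ V)) :
    a = ExteriorAlgebra.ι ℝ (ExteriorAlgebra.ιInv a) := by
  have h : a ∈ LinearMap.range (ExteriorAlgebra.ι ℝ) := by
    rwa [← pow_one (LinearMap.range (ExteriorAlgebra.ι ℝ (M := Module.Dual ℝ V)))]
  obtain ⟨α, rfl⟩ := h
  rw [ExteriorAlgebra.ι_leftInverse]

theorem ι_mem_one (α : Module.Dual ℝ V) :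
    (ExteriorAlgebra.ι ℝ α : Ext V) ∈ ⋀[ℝ]^1 (Module.Dual ℝ V) := by
  simpa only [map_one, mul_one, zero_add] using ι_mul_mem α (algebraMap_mem_zero (V := V) 1)

theorem intProd_ι (v : V) (α : Module.Dual ℝ V) :
    intProd v (ExteriorAlgebra.ι ℝ α) = algebraMap ℝ (Ext V) (α v) := by
  have := intProd_ι_mul v α (algebraMap ℝ (Ext V) 1)
  rw [intProd_algebraMap] at this
  simpa [Algebra.algebraMap_eq_smul_one] using this

/-- The number operator, written in a frame. -/
theorem sum_ι_mul_intProd {I : Type*} [Fintype I] (e : I → V) (ε : I → Module.Dual ℝ V)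
    (h : ∀ v, v = ∑ i, ε i v • e i) {n : ℕ} {a : Ext V} (ha : a ∈ ⋀[ℝ]^n (Module.Dual ℝ V)) :
    ∑ i, ExteriorAlgebra.ι ℝ (ε i) * intProd (e i) a = (n : ℝ) • a := by
  refine ext_induction (p := fun n a =>
    ∑ i, ExteriorAlgebra.ι ℝ (ε i) * intProd (e i) a = (n : ℝ) • a) ?_ ?_ ?_ ha
  · intro r; simp [intProd_algebraMap]
  · intro n a b _ _ h1 h2; simp [mul_add, Finset.sum_add_distrib, h1, h2]
  · intro n α a _ h1
    -- This expansion of `α` accounts for the extra copy of `α ∧ a` that raises the eigenvalue from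
    -- `n` to `n + 1`.
    have h2 : ∑ i, α (e i) • ε i = α := by
      ext v
      conv_rhs => rw [h v]
      simp [mul_comm]
    have h3 : ∑ i, ExteriorAlgebra.ι ℝ (ε i) * (α (e i) • a) = ExteriorAlgebra.ι ℝ α * a := by
      conv_rhs => rw [← h2]
      simp [Finset.sum_mul]
    have h4 : ∀ i, ExteriorAlgebra.ι ℝ (ε i) * (ExteriorAlgebra.ι ℝ α * intProd (e i) a) =
        -(ExteriorAlgebra.ι ℝ α * (ExteriorAlgebra.ι ℝ (ε i) * intProd (e i) a)) := by
      intro i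
      rw [← mul_assoc, ← mul_assoc,
        eq_neg_of_add_eq_zero_left (ExteriorAlgebra.ι_add_mul_swap (ε i) α), neg_mul]
    simp only [intProd_ι_mul, mul_sub, Finset.sum_sub_distrib, h3, h4, Finset.sum_neg_distrib,
      ← Finset.mul_sum, h1]
    rw [mul_smul_comm]
    push_cast
    module

/-- A composite of two antiderivations is a second-order operator: once both contractions on the
same factor are removed, only the cross terms remain. This is the biderivation that a decomposable
bivector defines. -/
theorem innerMulti_mul_sub (v w : V) {m : ℕ} {a : Ext V} (ha : a ∈ ⋀[ℝ]^m (Module.Dual ℝ V))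
    (b : Ext V) :
    innerMulti (ExteriorAlgebra.ι ℝ v * ExteriorAlgebra.ι ℝ w) (a * b) -
      innerMulti (ExteriorAlgebra.ι ℝ v * ExteriorAlgebra.ι ℝ w) a * b -
      a * innerMulti (ExteriorAlgebra.ι ℝ v * ExteriorAlgebra.ι ℝ w) b =
    (-1 : ℝ) ^ m • (intProd v a * intProd w b - intProd w a * intProd v b) := by
  simp only [innerMulti_ι_mul_ι, intProd_mul, map_add]
  have h1 : parity (parity a) = a := by
    rw [parity_of_mem ha, map_smul, parity_of_mem ha, smul_smul, ← pow_add,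
      Even.neg_one_pow ⟨m, rfl⟩, one_smul]
  have h2 : parity (intProd w a) = -((-1 : ℝ) ^ m • intProd w a) := by
    rw [← neg_eq_iff_eq_neg, ← intProd_parity, parity_of_mem ha, map_smul]
  rw [h1, h2, parity_of_mem ha]
  simp only [map_smul, smul_mul_assoc, neg_mul, smul_sub]
  abel

/-- The homogeneous component of degree `n`. -/
def extProj (n : ℕ) : Ext V →ₗ[ℝ] Ext V :=
  GradedAlgebra.proj (fun i : ℕ => ⋀[ℝ]^i (Module.Dual ℝ V)) n

theorem extProj_mem (n : ℕ) (a : Ext V) : extProj n a ∈ ⋀[ℝ]^n (Module.Dual ℝ V) := by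
  rw [extProj, GradedAlgebra.proj_apply]
  exact SetLike.coe_mem _

theorem extProj_of_mem {n m : ℕ} {a : Ext V} (ha : a ∈ ⋀[ℝ]^n (Module.Dual ℝ V)) :
    extProj m a = if n = m then a else 0 := by
  rw [extProj, GradedAlgebra.proj_apply]
  split_ifs with h
  · subst h; exact DirectSum.decompose_of_mem_same _ ha
  · exact DirectSum.decompose_of_mem_ne _ ha h

theorem ext_induction_on {p : Ext V → Prop} (a : Ext V) (h0 : p 0)
    (hadd : ∀ a b, p a → p b → p (a + b))
    (hh : ∀ n a, a ∈ ⋀[ℝ]^n (Module.Dual ℝ V) → p a) : p a :=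
  DirectSum.Decomposition.inductionOn (fun i : ℕ => ⋀[ℝ]^i (Module.Dual ℝ V)) h0
    (fun {i} m => hh i m m.2) hadd a

theorem intProd_extProj_zero (v : V) (a : Ext V) : intProd v (extProj 0 a) = 0 :=
  intProd_of_mem_zero v (extProj_mem 0 a)

theorem intProd_extProj_succ (v : V) (n : ℕ) (a : Ext V) :
    intProd v (extProj (n + 1) a) = extProj n (intProd v a) := by
  induction a using ext_induction_on with
  | h0 => simp
  | hadd a b h1 h2 => simp only [map_add, h1, h2]
  | hh m a ha =>
  rw [extProj_of_mem ha]
  cases m with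
  | zero => rw [intProd_of_mem_zero v ha]; simp
  | succ k =>
    rw [extProj_of_mem (intProd_mem_of_succ v ha)]
    simp only [add_left_inj]
    split_ifs <;> simp

theorem algebraMapInv_of_mem_succ {n : ℕ} {a : Ext V}
    (ha : a ∈ ⋀[ℝ]^(n + 1) (Module.Dual ℝ V)) : ExteriorAlgebra.algebraMapInv a = 0 := by
  refine ext_induction (p := fun n a => n ≠ 0 → ExteriorAlgebra.algebraMapInv a = 0)
    (by simp) ?_ ?_ ha n.succ_ne_zero
  · intro n a b _ _ h1 h2 h; rw [map_add, h1 h, h2 h, add_zero]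
  · intro n α a _ _ _; exact algebraMapInv_ι_mul α a

theorem algebraMapInv_extProj (n : ℕ) (a : Ext V) :
    ExteriorAlgebra.algebraMapInv (extProj n a) =
      if n = 0 then ExteriorAlgebra.algebraMapInv a else 0 := by
  cases n with
  | succ k => rw [algebraMapInv_of_mem_succ (extProj_mem _ a)]; simp
  | zero =>
    induction a using ext_induction_on with
    | h0 => simp
    | hadd a b h1 h2 => rw [if_pos rfl] at *; rw [map_add, map_add, h1, h2, map_add]
    | hh m a ha =>
    rw [extProj_of_mem ha]
    cases m with
    | zero => simp
    | succ k => rw [algebraMapInv_of_mem_succ ha]; simp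

theorem eq_zero_of_finrank_lt [FiniteDimensional ℝ V] {n : ℕ} (hn : Module.finrank ℝ V < n)
    {a : Ext V} (ha : a ∈ ⋀[ℝ]^n (Module.Dual ℝ V)) : a = 0 := by
  have h : Module.finrank ℝ (⋀[ℝ]^n (Module.Dual ℝ V)) = 0 := by
    rw [exteriorPower.finrank_eq, Subspace.dual_finrank_eq, Nat.choose_eq_zero_of_lt hn]
  have := Module.finrank_zero_iff.mp h
  exact congrArg Subtype.val (Subsingleton.elim (⟨a, ha⟩ : ⋀[ℝ]^n (Module.Dual ℝ V)) 0)

theorem sum_extProj [FiniteDimensional ℝ V] {r : ℕ} (hr : Module.finrank ℝ V < r) (a : Ext V) :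
    ∑ n ∈ Finset.range r, extProj n a = a := by
  induction a using ext_induction_on with
  | h0 => simp
  | hadd a b h1 h2 => simp only [map_add, Finset.sum_add_distrib, h1, h2]
  | hh m a ha =>
  simp only [extProj_of_mem ha, Finset.sum_ite_eq, Finset.mem_range]
  split_ifs with h
  · rfl
  · exact (eq_zero_of_finrank_lt (by omega) ha).symm

end FibreLemmas

/-! ### Homogeneous forms on the bundle. -/

section BundleLemmas

variable {E : Type*} [NormedAddCommGroup E] [NormedSpace ℝ E]
  {M : Type*} [TopologicalSpace M] [ChartedSpace E M]
  {F : Type*} [NormedAddCommGroup F] [NormedSpace ℝ F]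
  {A : M → Type*} [TopologicalSpace (Bundle.TotalSpace F A)]
  [∀ x, AddCommGroup (A x)] [∀ x, Module ℝ (A x)] [∀ x, TopologicalSpace (A x)]
  [FiberBundle F A] [VectorBundle ℝ F A]

theorem form_ext {f g : Form E F A} (h : ∀ x, f.1 x = g.1 x) : f = g := Subtype.ext (funext h)

theorem form_sum_apply {I : Type*} (s : Finset I) (f : I → Form E F A) (x : M) :
    (∑ i ∈ s, f i).1 x = ∑ i ∈ s, (f i).1 x :=
  map_sum ((Pi.evalAddMonoidHom (fun x => Ext (A x)) x).comp
    (Form E F A).toSubmodule.subtype.toAddMonoidHom) f s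

theorem fnForm_mul_apply (g : Fn E M) (f : Form E F A) (x : M) :
    (fnForm g * f).1 x = g x • f.1 x := (Algebra.smul_def (g x) (f.1 x)).symm

theorem fnForm_mul_comm (g : Fn E M) (f : Form E F A) : fnForm g * f = f * fnForm g :=
  form_ext fun x => Algebra.commutes (g x) (f.1 x)

theorem fnForm_mul_fnForm (g h : Fn E M) :
    (fnForm g * fnForm h : Form E F A) = fnForm (g * h) :=
  form_ext fun _ => (map_mul (algebraMap ℝ _) _ _).symm

theorem formFn_fnForm (g : Fn E M) : formFn (fnForm g : Form E F A) = g :=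
  ContMDiffMap.ext fun _ => ExteriorAlgebra.algebraMap_leftInverse _ _

theorem isDeg_fnForm (g : Fn E M) : IsDeg 0 (fnForm g : Form E F A) :=
  fun _ => algebraMap_mem_zero _

theorem IsDeg.fnForm_formFn {f : Form E F A} (hf : IsDeg 0 f) : fnForm (formFn f) = f :=
  form_ext fun x => (eq_algebraMap_of_mem (hf x)).symm

theorem isDeg_zero (n : ℕ) : IsDeg n (0 : Form E F A) := fun _ => Submodule.zero_mem _

theorem IsDeg.add {n : ℕ} {f g : Form E F A} (hf : IsDeg n f) (hg : IsDeg n g) :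
    IsDeg n (f + g) := fun x => Submodule.add_mem _ (hf x) (hg x)

theorem IsDeg.smul {n : ℕ} (c : ℝ) {f : Form E F A} (hf : IsDeg n f) : IsDeg n (c • f) :=
  fun x => Submodule.smul_mem _ c (hf x)

theorem IsDeg.mul {m n : ℕ} {f g : Form E F A} (hf : IsDeg m f) (hg : IsDeg n g) :
    IsDeg (m + n) (f * g) :=
  fun x => SetLike.GradedMul.mul_mem (A := fun i : ℕ => ⋀[ℝ]^i (Module.Dual ℝ (A x)))
    (hf x) (hg x)

theorem IsDeg.innerForm {n : ℕ} {f : Form E F A} (hf : IsDeg (n + 1) f) (X : Sec E F A) :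
    IsDeg n (innerForm X f) := fun x => intProd_mem_of_succ (X x) (hf x)

theorem IsDeg.innerForm_eq_zero {f : Form E F A} (hf : IsDeg 0 f) (X : Sec E F A) :
    BigBracket.innerForm X f = 0 := form_ext fun x => intProd_of_mem_zero (X x) (hf x)

theorem IsDeg.parityForm {n : ℕ} {f : Form E F A} (hf : IsDeg n f) :
    parityForm f = (-1 : ℝ) ^ n • f := form_ext fun x => parity_of_mem (hf x)

theorem innerForm_add (X : Sec E F A) (f g : Form E F A) :
    innerForm X (f + g) = innerForm X f + innerForm X g := form_ext fun _ => map_add _ _ _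

theorem innerForm_smul (X : Sec E F A) (c : ℝ) (f : Form E F A) :
    innerForm X (c • f) = c • innerForm X f := form_ext fun x => map_smul (intProd (X x)) c (f.1 x)

theorem innerForm_mul (X : Sec E F A) {n : ℕ} {f : Form E F A} (hf : IsDeg n f)
    (g : Form E F A) :
    innerForm X (f * g) = innerForm X f * g + (-1 : ℝ) ^ n • (f * innerForm X g) :=
  form_ext fun x => by
    change intProd (X x) (f.1 x * g.1 x) = intProd (X x) (f.1 x) * g.1 x +
      (-1 : ℝ) ^ n • (f.1 x * intProd (X x) (g.1 x))
    rw [intProd_mul, parity_of_mem (hf x), smul_mul_assoc]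

theorem innerForm_fnSmul (g : Fn E M) (X : Sec E F A) (f : Form E F A) :
    innerForm (fnSmul g X) f = fnForm g * innerForm X f := form_ext fun x => by
  rw [fnForm_mul_apply]
  change intProd (g x • X x) (f.1 x) = g x • intProd (X x) (f.1 x)
  rw [map_smul, LinearMap.smul_apply]

/-- The component of degree `n` of a form. -/
def formProj (n : ℕ) (f : Form E F A) : Form E F A :=
  ⟨fun x => extProj n (f.1 x), fun L => by
    obtain ⟨s, hs⟩ := f
    induction L generalizing n s with
    | nil =>
      simp only [List.foldl_nil, algebraMapInv_extProj]
      split_ifs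
      · exact hs []
      · exact contMDiff_const
    | cons X L ih =>
      simp only [List.foldl_cons]
      cases n with
      | zero =>
        simp only [intProd_extProj_zero]
        exact IsSmoothForm.zero L
      | succ k =>
        simp only [intProd_extProj_succ]
        exact ih k _ (IsSmoothForm.intProd X hs)⟩

theorem isDeg_formProj (n : ℕ) (f : Form E F A) : IsDeg n (formProj n f) :=
  fun _ => extProj_mem n _

theorem finrank_fibre [FiniteDimensional ℝ F] (x : M) :
    FiniteDimensional ℝ (A x) ∧ Module.finrank ℝ (A x) = Module.finrank ℝ F := by
  have e := (trivializationAt F A x).linearEquivAt ℝ x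
    (FiberBundle.mem_baseSet_trivializationAt' x)
  exact ⟨Module.Finite.equiv e.symm, e.finrank_eq⟩

theorem sum_formProj [FiniteDimensional ℝ F] (f : Form E F A) :
    ∑ n ∈ Finset.range (Module.finrank ℝ F + 1), formProj n f = f :=
  form_ext fun x => by
    rw [form_sum_apply]
    have := (finrank_fibre (F := F) (A := A) x).1
    exact sum_extProj (by rw [(finrank_fibre (F := F) (A := A) x).2]; omega) _

/-- Components of degree above the rank vanish, so a form is a finite sum of smooth homogeneous
ones. Additive identities may then be checked where signs are defined. -/
theorem form_induction [FiniteDimensional ℝ F] {p : Form E F A → Prop} (f : Form E F A)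
    (hadd : ∀ a b, p a → p b → p (a + b)) (hh : ∀ n a, IsDeg n a → p a) : p f := by
  rw [← sum_formProj f]
  exact Finset.sum_induction _ p hadd (hh 0 0 (isDeg_zero 0))
    fun n _ => hh n _ (isDeg_formProj n f)

/-- A smooth family of linear forms as a form of degree `1`. -/
def oneForm (α : ∀ x, Module.Dual ℝ (A x))
    (hα : ∀ X : Sec E F A, ContMDiff 𝓘(ℝ, E) 𝓘(ℝ, ℝ) ∞ fun x => α x (X x)) : Form E F A :=
  ⟨fun x => ExteriorAlgebra.ι ℝ (α x), fun L => by
    match L with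
    | [] =>
      simp only [List.foldl_nil, ExteriorAlgebra.algebraMapInv, ExteriorAlgebra.lift_ι_apply]
      exact contMDiff_const
    | X :: L =>
      simp only [List.foldl_cons, intProd_ι]
      exact IsSmoothForm.ofFn (F := F) (A := A) (hα X) L⟩

theorem isDeg_oneForm (α : ∀ x, Module.Dual ℝ (A x)) (hα) :
    IsDeg 1 (oneForm (E := E) (F := F) α hα) := fun _ => ι_mem_one _

/-! ### Local frames, cutoffs and gluing. -/

section Local

variable [FiniteDimensional ℝ E] [IsManifold 𝓘(ℝ, E) ∞ M] [T2Space M]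

theorem exists_cutoff (x : M) {U : Set M} (hU : U ∈ 𝓝 x) :
    ∃ χ : Fn E M, (∀ᶠ y in 𝓝 x, χ y = 1) ∧ tsupport χ ⊆ U := by
  obtain ⟨f, -, hf⟩ := (SmoothBumpFunction.nhds_basis_tsupport (I := 𝓘(ℝ, E)) x).mem_iff.1 hU
  exact ⟨⟨f, f.contMDiff⟩, f.eventuallyEq_one, hf⟩

variable [FiniteDimensional ℝ F] [ContMDiffVectorBundle ∞ F A 𝓘(ℝ, E)]

/-- Near each point there are dual frames of `A` and `A^*` which extend to global sections. -/
theorem exists_frame (x : M) : ∃ (n : ℕ) (e : Fin n → Sec E F A)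
    (ε : Fin n → ∀ y, Module.Dual ℝ (A y))
    (_ : ∀ i, ∀ X : Sec E F A, ContMDiff 𝓘(ℝ, E) 𝓘(ℝ, ℝ) ∞ fun y => ε i y (X y)),
    ∀ᶠ y in 𝓝 x, ∀ v : A y, v = ∑ i, ε i y v • e i y := by
  classical
  have : ContMDiffVectorBundle 1 F A 𝓘(ℝ, E) := ContMDiffVectorBundle.of_le (n := ∞) (by simp)
  let t := trivializationAt F A x
  have hx : x ∈ t.baseSet := FiberBundle.mem_baseSet_trivializationAt' x
  have hU : t.baseSet ∈ 𝓝 x := t.open_baseSet.mem_nhds hx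
  let b := Module.finBasis ℝ F
  obtain ⟨χ, h1, hχ⟩ := exists_cutoff (E := E) x hU
  -- Frame and coframe are both multiplied by `χ` to become global; they remain dual where `χ = 1`,
  -- hence near `x`.
  refine ⟨_, fun i => ⟨⇑χ • t.localFrame b i, ?_⟩,
    fun i y => χ y • t.localFrameCoeff 𝓘(ℝ, E) b i y, ?_, ?_⟩
  · exact ContMDiffOn.smul_section_of_tsupport χ.contMDiff.contMDiffOn t.open_baseSet hχ
      (t.contMDiffOn_localFrame_baseSet ∞ b i)
  · intro i X
    refine contMDiff_of_tsupport fun y hy => ?_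
    have hy' : y ∈ t.baseSet := hχ (closure_mono (fun z hz => by
      contrapose! hz
      simp only [Function.mem_support, not_not] at hz ⊢
      simp [hz]) hy)
    exact χ.contMDiff.contMDiffAt.mul
      (contMDiffAt_localFrameCoeff b hy' X.contMDiff.contMDiffAt i)
  · filter_upwards [h1, hU] with y hy hyt v
    -- The expansion is stated for sections, but it is pointwise and needs no smoothness, so the
    -- vector `v` is extended by zero off `y`.
    have := Bundle.Trivialization.eq_sum_localFrameCoeff_smul (I := 𝓘(ℝ, E)) (b := b)
      (s := Function.update 0 y v) hyt
    simp only [Function.update_self] at this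
    conv_lhs => rw [this]
    refine Finset.sum_congr rfl fun i _ => ?_
    change _ = (χ y • t.localFrameCoeff 𝓘(ℝ, E) b i y) v • (χ y • t.localFrame b i y)
    rw [hy, one_smul, one_smul]

theorem innerForm_oneForm (X : Sec E F A) (α : ∀ x, Module.Dual ℝ (A x)) (hα) :
    innerForm X (oneForm (E := E) (F := F) α hα) = fnForm ⟨fun x => α x (X x), hα X⟩ :=
  form_ext fun _ => intProd_ι _ _

/-- Sections are separated by their interior products. -/
theorem sec_ext {X Y : Sec E F A} (h : ∀ f, IsDeg 1 f → innerForm X f = innerForm Y f) :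
    X = Y := by
  ext x
  obtain ⟨n, e, ε, hε, hx⟩ := exists_frame (E := E) (F := F) (A := A) x
  rw [hx.self_of_nhds (X x), hx.self_of_nhds (Y x)]
  refine Finset.sum_congr rfl fun i _ => ?_
  have := h _ (isDeg_oneForm (ε i) (hε i))
  rw [innerForm_oneForm, innerForm_oneForm] at this
  have : ε i x (X x) = ε i x (Y x) :=
    ExteriorAlgebra.algebraMap_inj (Module.Dual ℝ (A x)) _ _ |>.1
      (congrFun (congrArg Subtype.val this) x)
  rw [this]

/-- In a local frame, `(n + 1) f = ∑ ε_i ∧ i_{e_i} f`. -/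
theorem IsDeg.eq_zero_of_innerForm {n : ℕ} {f : Form E F A} (hf : IsDeg (n + 1) f)
    (h : ∀ X, BigBracket.innerForm X f = 0) : f = 0 := form_ext fun x => by
  obtain ⟨k, e, ε, hε, hx⟩ := exists_frame (E := E) (F := F) (A := A) x
  have h1 := sum_ι_mul_intProd (fun i => e i x) (fun i => ε i x) hx.self_of_nhds (hf x)
  have h2 : ∀ i, intProd (e i x) (f.1 x) = 0 := fun i =>
    congrFun (congrArg Subtype.val (h (e i))) x
  simp only [h2, mul_zero, Finset.sum_const_zero] at h1
  exact (smul_eq_zero.1 h1.symm).resolve_left (by positivity)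

/-- A derivation which kills functions and `1`-forms is zero. -/
theorem derivation_eq_zero (D : Form E F A →ₗ[ℝ] Form E F A) (s : ℕ → ℝ) (s0 : s 0 = 1)
    (hD : ∀ n f g, IsDeg n f → D (f * g) = D f * g + s n • (f * D g))
    (h0 : ∀ f, IsDeg 0 f → D f = 0) (h1 : ∀ f, IsDeg 1 f → D f = 0) : D = 0 := by
  have key : ∀ n f, IsDeg n f → D f = 0 := by
    intro n
    induction n with
    | zero => exact h0
    | succ n ih =>
      intro f hf
      refine form_ext fun x => ?_
      obtain ⟨k, e, ε, hε, hx⟩ := exists_frame (E := E) (F := F) (A := A) x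
      obtain ⟨χ, hχ, hs⟩ := exists_cutoff (E := E) x hx
      -- Multiplication by `χ` turns the local number-operator identity into a global one, to which
      -- `D` can be applied. On the right `D` kills `χ` and each `ε_i` by hypothesis, and each
      -- `i_{e_i} f` by induction.
      have h : fnForm χ * ((n + 1 : ℝ) • f) =
          fnForm χ * ∑ i, oneForm (ε i) (hε i) * innerForm (e i) f := form_ext fun y => by
        rw [fnForm_mul_apply, fnForm_mul_apply, form_sum_apply]
        by_cases hy : χ y = 0
        · rw [hy, zero_smul, zero_smul]
        · congr 1
          have := sum_ι_mul_intProd (fun i => e i y) (fun i => ε i y)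
            (hs (subset_tsupport _ hy)) (hf y)
          push_cast at this
          exact this.symm
      have h2 := congrArg D h
      rw [hD 0 _ _ (isDeg_fnForm χ), hD 0 _ _ (isDeg_fnForm χ), h0 _ (isDeg_fnForm χ), map_sum,
        s0, map_smul] at h2
      simp only [hD 1 _ _ (isDeg_oneForm _ _), h1 _ (isDeg_oneForm _ _), ih _ (hf.innerForm _),
        zero_mul, mul_zero, smul_zero, zero_add, Finset.sum_const_zero, one_smul] at h2
      have h3 := congrFun (congrArg Subtype.val h2) x
      rw [fnForm_mul_apply, hχ.self_of_nhds, one_smul] at h3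
      have h4 : ((n : ℝ) + 1) • (D f).1 x = 0 := h3
      exact (smul_eq_zero.1 h4).resolve_left (by positivity)
  ext1 f
  induction f using form_induction with
  | hadd a b ha hb => rw [map_add, ha, hb, map_add]
  | hh n a ha => exact key n a ha

/-- A `C^∞(M)`-linear map from `1`-forms to functions is a section of `A`. -/
theorem exists_sec (D : Form E F A →ₗ[ℝ] Form E F A)
    (hmul : ∀ g f, D (fnForm g * f) = fnForm g * D f)
    (hdeg : ∀ f, IsDeg 1 f → IsDeg 0 (D f)) :
    ∃ X : Sec E F A, ∀ f, IsDeg 1 f → innerForm X f = D f := by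
  have loc : ∀ x, ∃ X : Sec E F A, ∀ᶠ y in 𝓝 x, ∀ f, IsDeg 1 f →
      intProd (X y) (f.1 y) = (D f).1 y := by
    intro x
    obtain ⟨k, e, ε, hε, hx⟩ := exists_frame (E := E) (F := F) (A := A) x
    obtain ⟨χ, hχ, hs⟩ := exists_cutoff (E := E) x hx
    have hsum : ∀ (t : Finset (Fin k)) y,
        (∑ i ∈ t, fnSmul (formFn (D (oneForm (ε i) (hε i)))) (e i)) y =
        ∑ i ∈ t, fnSmul (formFn (D (oneForm (ε i) (hε i)))) (e i) y := fun t y =>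
      map_sum ((Pi.evalAddMonoidHom A y).comp (ContMDiffSection.coeAddHom 𝓘(ℝ, E) F ∞ A)) _ t
    -- In a frame the section must be `∑ D(ε_i) e_i`. The cutoff passes through `D` by linearity
    -- over functions, which makes `D` local.
    refine ⟨∑ i, fnSmul (formFn (D (oneForm (ε i) (hε i)))) (e i), ?_⟩
    filter_upwards [hχ, hx] with y hy hxy f hf
    have h : fnForm χ * f =
        fnForm χ * ∑ i, fnForm (formFn (innerForm (e i) f)) * oneForm (ε i) (hε i) :=
      form_ext fun z => by
        rw [fnForm_mul_apply, fnForm_mul_apply, form_sum_apply]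
        by_cases hz : χ z = 0
        · rw [hz, zero_smul, zero_smul]
        · congr 1
          have h1 := sum_ι_mul_intProd (fun i => e i z) (fun i => ε i z)
            (hs (subset_tsupport _ hz)) (hf z)
          rw [Nat.cast_one, one_smul] at h1
          conv_lhs => rw [← h1]
          refine Finset.sum_congr rfl fun i _ => ?_
          rw [(hf.innerForm (e i)).fnForm_formFn, ← (hf.innerForm (e i)).fnForm_formFn,
            fnForm_mul_comm]
          change _ = ExteriorAlgebra.ι ℝ (ε i z) * (fnForm (formFn (innerForm (e i) f))).1 z
          rw [(hf.innerForm (e i)).fnForm_formFn]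
          rfl
    have h2 := congrFun (congrArg Subtype.val (congrArg D h)) y
    rw [hmul, hmul, fnForm_mul_apply, fnForm_mul_apply, hy, one_smul, one_smul, map_sum,
      form_sum_apply] at h2
    rw [h2, hsum, map_sum, LinearMap.sum_apply]
    refine Finset.sum_congr rfl fun i _ => ?_
    rw [hmul, fnForm_mul_apply]
    change intProd (formFn (D (oneForm (ε i) (hε i))) y • e i y) (f.1 y) = _
    rw [map_smul, LinearMap.smul_apply, ← (hdeg _ (isDeg_oneForm (ε i) (hε i))).fnForm_formFn,
      formFn_fnForm]
    have h4 : intProd (e i y) (f.1 y) = (fnForm (formFn (innerForm (e i) f)) : Form E F A).1 y := by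
      rw [(hf.innerForm (e i)).fnForm_formFn]; rfl
    rw [h4]
    change _ • algebraMap ℝ _ _ = _ • algebraMap ℝ _ _
    rw [Algebra.algebraMap_eq_smul_one, Algebra.algebraMap_eq_smul_one, smul_comm]
  choose Z hZ using loc
  -- Pointwise uniqueness replaces a partition of unity: the diagonal `x ↦ Z x x` agrees near each
  -- `x` with the smooth section `Z x`.
  have uniq : ∀ y (v w : A y), (∀ f : Form E F A, IsDeg 1 f →
      intProd v (f.1 y) = intProd w (f.1 y)) → v = w := by
    intro y v w h
    obtain ⟨k, e, ε, hε, hx⟩ := exists_frame (E := E) (F := F) (A := A) y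
    rw [hx.self_of_nhds v, hx.self_of_nhds w]
    refine Finset.sum_congr rfl fun i _ => ?_
    have h1 := h _ (isDeg_oneForm (ε i) (hε i))
    change intProd v (ExteriorAlgebra.ι ℝ (ε i y)) = intProd w (ExteriorAlgebra.ι ℝ (ε i y)) at h1
    rw [intProd_ι, intProd_ι, ExteriorAlgebra.algebraMap_inj] at h1
    rw [h1]
  refine ⟨⟨fun x => Z x x, fun x => ?_⟩, fun f hf => form_ext fun x => ?_⟩
  · refine (Z x).contMDiff.contMDiffAt.congr_of_eventuallyEq ?_
    filter_upwards [hZ x] with y hy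
    rw [uniq y (Z y y) (Z x y) fun f hf => by rw [(hZ y).self_of_nhds f hf, hy f hf]]
  · exact (hZ x).self_of_nhds f hf

end Local

end BundleLemmas

/-- The sign `(-1)^n`. -/
def sg (n : ℤ) : ℝ := open Classical in if Even n then 1 else -1

theorem sg_of_even {n : ℤ} (h : Even n) : sg n = 1 := if_pos h

theorem sg_of_not_even {n : ℤ} (h : ¬Even n) : sg n = -1 := if_neg h

theorem sg_natCast (n : ℕ) : sg n = (-1 : ℝ) ^ n := by
  unfold sg
  split_ifs with h
  · rw [Even.neg_one_pow (by exact_mod_cast h)]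
  · rw [Odd.neg_one_pow (by rw [← Nat.not_even_iff_odd]; exact_mod_cast h)]

/-! ### Integral degrees and multilinearity of the bracket. -/

section SymbLemmas

variable {E : Type*} [NormedAddCommGroup E] [NormedSpace ℝ E]
  {M : Type*} [TopologicalSpace M] [ChartedSpace E M]
  {F : Type*} [NormedAddCommGroup F] [NormedSpace ℝ F]
  {A : M → Type*} [TopologicalSpace (Bundle.TotalSpace F A)]
  [∀ x, AddCommGroup (A x)] [∀ x, Module ℝ (A x)] [∀ x, TopologicalSpace (A x)]
  [FiberBundle F A] [VectorBundle ℝ F A]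

/-- Homogeneity with an integral degree: in negative degrees only `0` is homogeneous. -/
def HasDeg (m : ℤ) (f : Form E F A) : Prop := f = 0 ∨ ∃ n : ℕ, (n : ℤ) = m ∧ IsDeg n f

theorem HasDeg.zero (m : ℤ) : HasDeg m (0 : Form E F A) := Or.inl rfl

theorem IsDeg.hasDeg {n : ℕ} {f : Form E F A} (h : IsDeg n f) : HasDeg n f :=
  Or.inr ⟨n, rfl, h⟩

theorem HasDeg.isDeg {n : ℕ} {f : Form E F A} (h : HasDeg n f) : IsDeg n f := by
  obtain rfl | ⟨k, hk, h⟩ := h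
  · exact isDeg_zero n
  · obtain rfl : k = n := by exact_mod_cast hk
    exact h

theorem HasDeg.eq_zero {m : ℤ} {f : Form E F A} (h : HasDeg m f) (hm : m < 0) : f = 0 := by
  obtain rfl | ⟨k, hk, h⟩ := h
  · rfl
  · omega

theorem HasDeg.cast {m n : ℤ} {f : Form E F A} (h : HasDeg m f) (e : m = n) : HasDeg n f := e ▸ h

theorem HasDeg.add {m : ℤ} {f g : Form E F A} (hf : HasDeg m f) (hg : HasDeg m g) :
    HasDeg m (f + g) := by
  obtain rfl | ⟨k, hk, hf⟩ := hf
  · rwa [zero_add]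
  · subst hk; exact (hf.add hg.isDeg).hasDeg

theorem HasDeg.smul {m : ℤ} (c : ℝ) {f : Form E F A} (hf : HasDeg m f) : HasDeg m (c • f) := by
  obtain rfl | ⟨k, hk, hf⟩ := hf
  · rw [smul_zero]; exact HasDeg.zero m
  · exact Or.inr ⟨k, hk, hf.smul c⟩

theorem HasDeg.mul {m n : ℤ} {f g : Form E F A} (hf : HasDeg m f) (hg : HasDeg n g) :
    HasDeg (m + n) (f * g) := by
  obtain rfl | ⟨k, hk, hf⟩ := hf
  · rw [zero_mul]; exact HasDeg.zero _
  obtain rfl | ⟨l, hl, hg⟩ := hg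
  · rw [mul_zero]; exact HasDeg.zero _
  exact Or.inr ⟨k + l, by push_cast; rw [hk, hl], hf.mul hg⟩

theorem HasDeg.parityForm {m : ℤ} {f : Form E F A} (hf : HasDeg m f) :
    parityForm f = sg m • f := by
  obtain rfl | ⟨k, rfl, hf⟩ := hf
  · rw [(isDeg_zero 0).parityForm]; simp
  · rw [hf.parityForm, sg_natCast]

theorem HasDeg.evenPart {m : ℤ} {f : Form E F A} (hf : HasDeg m f) :
    evenPart f = if Even m then f else 0 := by
  unfold BigBracket.evenPart
  rw [hf.parityForm]
  split_ifs with h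
  · rw [sg_of_even h]; module
  · rw [sg_of_not_even h]; module

theorem HasDeg.oddPart {m : ℤ} {f : Form E F A} (hf : HasDeg m f) :
    oddPart f = if Even m then 0 else f := by
  unfold BigBracket.oddPart
  rw [hf.parityForm]
  split_ifs with h
  · rw [sg_of_even h]; module
  · rw [sg_of_not_even h]; module

theorem parityForm_add (f g : Form E F A) : parityForm (f + g) = parityForm f + parityForm g :=
  form_ext fun _ => map_add _ _ _

theorem parityForm_smul (c : ℝ) (f : Form E F A) : parityForm (c • f) = c • parityForm f :=
  form_ext fun x => map_smul parity c (f.1 x)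

theorem evenPart_add (f g : Form E F A) : evenPart (f + g) = evenPart f + evenPart g := by
  unfold evenPart; rw [parityForm_add]; module

theorem evenPart_smul (c : ℝ) (f : Form E F A) : evenPart (c • f) = c • evenPart f := by
  unfold evenPart; rw [parityForm_smul]; module

theorem oddPart_add (f g : Form E F A) : oddPart (f + g) = oddPart f + oddPart g := by
  unfold oddPart; rw [parityForm_add]; module

theorem oddPart_smul (c : ℝ) (f : Form E F A) : oddPart (c • f) = c • oddPart f := by
  unfold oddPart; rw [parityForm_smul]; module

instance : Module ℝ (Symb E F A) := Pi.module _ _ _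

theorem symb_add_apply (u v : Symb E F A) (L : List (Form E F A)) : (u + v) L = u L + v L := rfl

theorem symb_smul_apply (c : ℝ) (u : Symb E F A) (L : List (Form E F A)) :
    (c • u) L = c • u L := rfl

/-- `u` is multilinear. -/
structure IsMulti (u : Symb E F A) : Prop where
  map_add : ∀ (L : List (Form E F A)) (f g : Form E F A) (L' : List (Form E F A)),
    u (L ++ (f + g) :: L') = u (L ++ f :: L') + u (L ++ g :: L')
  map_smul : ∀ (L : List (Form E F A)) (c : ℝ) (f : Form E F A) (L' : List (Form E F A)),
    u (L ++ (c • f) :: L') = c • u (L ++ f :: L')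

theorem IsMulti.map_zero {u : Symb E F A} (hu : IsMulti u) (L L' : List (Form E F A)) :
    u (L ++ 0 :: L') = 0 := by
  have := hu.map_smul L 0 0 L'
  rwa [zero_smul, zero_smul] at this

theorem IsMulti.map_eq_zero_of_mem {u : Symb E F A} (hu : IsMulti u) {L : List (Form E F A)}
    (h : 0 ∈ L) : u L = 0 := by
  obtain ⟨s, t, rfl⟩ := List.append_of_mem h
  exact hu.map_zero s t

theorem IsMulti.ins {u : Symb E F A} (hu : IsMulti u) (f : Form E F A) : IsMulti (ins f u) :=
  ⟨fun L => hu.map_add (f :: L), fun L => hu.map_smul (f :: L)⟩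

theorem IsMulti.paritySymb {u : Symb E F A} (hu : IsMulti u) : IsMulti (paritySymb u) := by
  constructor
  · intro L f g L'
    simp only [BigBracket.paritySymb, List.map_append, List.map_cons, parityForm_add, hu.map_add]
  · intro L c f L'
    simp only [BigBracket.paritySymb, List.map_append, List.map_cons, parityForm_smul,
      hu.map_smul]

theorem IsMulti.ins_add {u : Symb E F A} (hu : IsMulti u) (f g : Form E F A) :
    BigBracket.ins (f + g) u = BigBracket.ins f u + BigBracket.ins g u :=
  funext fun L => hu.map_add [] f g L

theorem IsMulti.ins_smul {u : Symb E F A} (hu : IsMulti u) (c : ℝ) (f : Form E F A) :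
    BigBracket.ins (c • f) u = c • BigBracket.ins f u :=
  funext fun L => hu.map_smul [] c f L

theorem IsMulti.ins_zero {u : Symb E F A} (hu : IsMulti u) : BigBracket.ins 0 u = 0 :=
  funext fun L => hu.map_zero [] L

theorem ins_symb_add (f : Form E F A) (u v : Symb E F A) : ins f (u + v) = ins f u + ins f v := rfl

theorem ins_symb_smul (f : Form E F A) (c : ℝ) (u : Symb E F A) :
    ins f (c • u) = c • ins f u := rfl

theorem paritySymb_add (u v : Symb E F A) : paritySymb (u + v) = paritySymb u + paritySymb v :=
  funext fun _ => parityForm_add _ _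

theorem paritySymb_smul (c : ℝ) (u : Symb E F A) : paritySymb (c • u) = c • paritySymb u :=
  funext fun _ => parityForm_smul _ _

theorem IsMulti.single_add {u : Symb E F A} (hu : IsMulti u) (f g : Form E F A) :
    u [f + g] = u [f] + u [g] := hu.map_add [] f g []

theorem IsMulti.single_smul {u : Symb E F A} (hu : IsMulti u) (c : ℝ) (f : Form E F A) :
    u [c • f] = c • u [f] := hu.map_smul [] c f []

theorem IsMulti.single_zero {u : Symb E F A} (hu : IsMulti u) : u [0] = 0 := hu.map_zero [] []

/-- Multilinearity is required of the other argument because the value of `u` on the empty list is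
inserted into `v`. -/
theorem bracketAux_add_left (L : List (Form E F A)) (u u' : Symb E F A) {v : Symb E F A}
    (hv : IsMulti v) : bracketAux L (u + u') v = bracketAux L u v + bracketAux L u' v := by
  induction L generalizing u u' v with
  | nil =>
    simp only [bracketAux, symb_add_apply, evenPart_add, oddPart_add, hv.single_add,
      hv.paritySymb.single_add]
    abel
  | cons f L ih =>
    simp only [bracketAux, ins_symb_add, ih _ _ (hv.ins f), ih _ _ hv, ih _ _ hv.paritySymb]
    abel

theorem bracketAux_smul_left (L : List (Form E F A)) (c : ℝ) (u : Symb E F A) {v : Symb E F A}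
    (hv : IsMulti v) : bracketAux L (c • u) v = c • bracketAux L u v := by
  induction L generalizing u v with
  | nil =>
    simp only [bracketAux, symb_smul_apply, evenPart_smul, oddPart_smul, hv.single_smul,
      hv.paritySymb.single_smul, smul_add, smul_sub]
  | cons f L ih =>
    simp only [bracketAux, ins_symb_smul, ih _ (hv.ins f), ih _ hv, ih _ hv.paritySymb, smul_add]

theorem bracketAux_add_right (L : List (Form E F A)) {u : Symb E F A} (v v' : Symb E F A)
    (hu : IsMulti u) : bracketAux L u (v + v') = bracketAux L u v + bracketAux L u v' := by
  induction L generalizing u v v' with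
  | nil =>
    simp only [bracketAux, symb_add_apply, hu.single_add, paritySymb_add]
    abel
  | cons f L ih =>
    simp only [bracketAux, ins_symb_add, paritySymb_add, ih _ _ hu, ih _ _ (hu.ins _)]
    abel

theorem bracketAux_smul_right (L : List (Form E F A)) (c : ℝ) {u : Symb E F A} (v : Symb E F A)
    (hu : IsMulti u) : bracketAux L u (c • v) = c • bracketAux L u v := by
  induction L generalizing u v with
  | nil =>
    simp only [bracketAux, symb_smul_apply, hu.single_smul, paritySymb_smul, smul_add, smul_sub]
  | cons f L ih =>
    simp only [bracketAux, ins_symb_smul, paritySymb_smul, ih _ hu, ih _ (hu.ins _), smul_add]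

theorem bracket_add_left (u u' : Symb E F A) {v : Symb E F A} (hv : IsMulti v) :
    bracket (u + u') v = bracket u v + bracket u' v :=
  funext fun L => bracketAux_add_left L u u' hv

theorem bracket_smul_left (c : ℝ) (u : Symb E F A) {v : Symb E F A} (hv : IsMulti v) :
    bracket (c • u) v = c • bracket u v := funext fun L => bracketAux_smul_left L c u hv

theorem bracket_add_right {u : Symb E F A} (hu : IsMulti u) (v v' : Symb E F A) :
    bracket u (v + v') = bracket u v + bracket u v' :=
  funext fun L => bracketAux_add_right L v v' hu

theorem bracket_smul_right (c : ℝ) {u : Symb E F A} (hu : IsMulti u) (v : Symb E F A) :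
    bracket u (c • v) = c • bracket u v := funext fun L => bracketAux_smul_right L c v hu

theorem bracket_zero_left {v : Symb E F A} (hv : IsMulti v) : bracket 0 v = 0 := by
  have := bracket_smul_left 0 0 hv
  rwa [zero_smul, zero_smul] at this

theorem bracket_zero_right {u : Symb E F A} (hu : IsMulti u) : bracket u 0 = 0 := by
  have := bracket_smul_right 0 hu 0
  rwa [zero_smul, zero_smul] at this

theorem bracket_neg_left (u : Symb E F A) {v : Symb E F A} (hv : IsMulti v) :
    bracket (-u) v = -bracket u v := by
  rw [← neg_one_smul ℝ u, bracket_smul_left _ _ hv, neg_one_smul]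

theorem bracket_neg_right {u : Symb E F A} (hu : IsMulti u) (v : Symb E F A) :
    bracket u (-v) = -bracket u v := by
  rw [← neg_one_smul ℝ v, bracket_smul_right _ hu, neg_one_smul]

theorem IsMulti.bracket {u v : Symb E F A} (hu : IsMulti u) (hv : IsMulti v) :
    IsMulti (bracket u v) := by
  constructor
  · intro L f g L'
    simp only [BigBracket.bracket]
    induction L generalizing u v with
    | nil =>
      simp only [List.nil_append, bracketAux, hv.ins_add, evenPart_add, oddPart_add, hu.ins_add,
        bracketAux_add_right _ _ _ hu, bracketAux_add_left _ _ _ hv,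
        bracketAux_add_left _ _ _ hv.paritySymb]
      abel
    | cons h L ih =>
      simp only [List.cons_append, bracketAux, ih hu (hv.ins h), ih (hu.ins _) hv,
        ih (hu.ins _) hv.paritySymb]
      abel
  · intro L c f L'
    simp only [BigBracket.bracket]
    induction L generalizing u v with
    | nil =>
      simp only [List.nil_append, bracketAux, hv.ins_smul, evenPart_smul, oddPart_smul,
        hu.ins_smul, bracketAux_smul_right _ _ _ hu, bracketAux_smul_left _ _ _ hv,
        bracketAux_smul_left _ _ _ hv.paritySymb, smul_add]
    | cons h L ih =>
      simp only [List.cons_append, bracketAux, ih hu (hv.ins h), ih (hu.ins _) hv,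
        ih (hu.ins _) hv.paritySymb, smul_add]

theorem IsMulti.add {u v : Symb E F A} (hu : IsMulti u) (hv : IsMulti v) : IsMulti (u + v) := by
  constructor
  · intro L f g L'
    simp only [symb_add_apply, hu.map_add, hv.map_add]; abel
  · intro L c f L'
    simp only [symb_add_apply, hu.map_smul, hv.map_smul, smul_add]

theorem IsMulti.smul (c : ℝ) {u : Symb E F A} (hu : IsMulti u) : IsMulti (c • u) := by
  constructor
  · intro L f g L'
    simp only [symb_smul_apply, hu.map_add, smul_add]
  · intro L a f L'
    simp only [symb_smul_apply, hu.map_smul, smul_comm c a]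

/-- `u` is a graded symmetric multiderivation of degree `d`, that is, a function on
`T^*[2]A[1]` of bidegrees `(k, k + d)`. -/
structure IsHom (d : ℤ) (u : Symb E F A) : Prop extends IsMulti u where
  symm : ∀ (ns : List ℤ) (L : List (Form E F A)) (m n : ℤ) (f g : Form E F A)
    (L' : List (Form E F A)), List.Forall₂ HasDeg ns L → HasDeg m f → HasDeg n g →
      u (L ++ f :: g :: L') = sg (m * n) • u (L ++ g :: f :: L')
  leibniz : ∀ (ns : List ℤ) (L : List (Form E F A)) (m n : ℤ) (f g : Form E F A),
    List.Forall₂ HasDeg ns L → HasDeg m f → HasDeg n g →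
      u (L ++ [f * g]) = u (L ++ [f]) * g + sg ((d + ns.sum) * m) • (f * u (L ++ [g]))
  degree : ∀ (ns : List ℤ) (L : List (Form E F A)), List.Forall₂ HasDeg ns L →
    HasDeg (ns.sum + d) (u L)

theorem IsHom.cast {d d' : ℤ} {u : Symb E F A} (hu : IsHom d u) (h : d = d') : IsHom d' u := h ▸ hu

theorem IsHom.degree_nil {d : ℤ} {u : Symb E F A} (hu : IsHom d u) : HasDeg d (u []) :=
  (hu.degree [] [] .nil).cast (by simp)

theorem IsHom.degree_single {d m : ℤ} {u : Symb E F A} (hu : IsHom d u) {f : Form E F A}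
    (hf : HasDeg m f) : HasDeg (m + d) (u [f]) :=
  (hu.degree [m] [f] (.cons hf .nil)).cast (by simp)

theorem IsHom.ins {d m : ℤ} {u : Symb E F A} (hu : IsHom d u) {f : Form E F A}
    (hf : HasDeg m f) : IsHom (d + m) (ins f u) where
  toIsMulti := hu.toIsMulti.ins f
  symm ns L p n g h L' hL hg hh := hu.symm (m :: ns) (f :: L) p n g h L' (.cons hf hL) hg hh
  leibniz ns L p n g h hL hg hh := by
    have := hu.leibniz (m :: ns) (f :: L) p n g h (.cons hf hL) hg hh
    rw [List.sum_cons, ← add_assoc] at this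
    exact this
  degree ns L hL := (hu.degree (m :: ns) (f :: L) (.cons hf hL)).cast (by
    rw [List.sum_cons]; ring)

theorem IsHom.add {d : ℤ} {u v : Symb E F A} (hu : IsHom d u) (hv : IsHom d v) :
    IsHom d (u + v) where
  toIsMulti := hu.toIsMulti.add hv.toIsMulti
  symm ns L p n g h L' hL hg hh := by
    simp only [symb_add_apply, hu.symm ns L p n g h L' hL hg hh,
      hv.symm ns L p n g h L' hL hg hh, smul_add]
  leibniz ns L p n g h hL hg hh := by
    simp only [symb_add_apply, hu.leibniz ns L p n g h hL hg hh,
      hv.leibniz ns L p n g h hL hg hh, add_mul, mul_add, smul_add]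
    abel
  degree ns L hL := (hu.degree ns L hL).add (hv.degree ns L hL)

theorem IsHom.smul {d : ℤ} (c : ℝ) {u : Symb E F A} (hu : IsHom d u) : IsHom d (c • u) where
  toIsMulti := hu.toIsMulti.smul c
  symm ns L p n g h L' hL hg hh := by
    simp only [symb_smul_apply, hu.symm ns L p n g h L' hL hg hh, smul_comm c]
  leibniz ns L p n g h hL hg hh := by
    simp only [symb_smul_apply, hu.leibniz ns L p n g h hL hg hh, smul_mul_assoc, mul_smul_comm,
      smul_add, smul_comm c]
  degree ns L hL := (hu.degree ns L hL).smul c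

theorem IsHom.neg {d : ℤ} {u : Symb E F A} (hu : IsHom d u) : IsHom d (-u) := by
  rw [← neg_one_smul ℝ u]; exact hu.smul _

/-! ### The big bracket is a graded Lie bracket. -/

section FiniteRank

variable [FiniteDimensional ℝ F]

theorem list_induction {Q : List (Form E F A) → Prop}
    (hadd : ∀ L a b L', Q (L ++ a :: L') → Q (L ++ b :: L') → Q (L ++ (a + b) :: L'))
    (hh : ∀ ns L, List.Forall₂ HasDeg ns L → Q L) (L : List (Form E F A)) : Q L := by
  -- The entries are split into homogeneous components from left to right, the prefix `L` being
  -- already homogeneous.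
  suffices h : ∀ (L' : List (Form E F A)) ns L, List.Forall₂ HasDeg ns L → Q (L ++ L') from
    h L [] [] .nil
  intro L'
  induction L' with
  | nil => intro ns L hL; rw [List.append_nil]; exact hh ns L hL
  | cons f L' ih =>
    induction f using form_induction with
    | hadd a b ha hb => exact fun ns L hL => hadd L a b L' (ha ns L hL) (hb ns L hL)
    | hh n a ha =>
      intro ns L hL
      have := ih (ns ++ [(n : ℤ)]) (L ++ [a]) (List.rel_append hL (.cons ha.hasDeg .nil))
      simpa using this

theorem IsMulti.ext {u v : Symb E F A} (hu : IsMulti u) (hv : IsMulti v)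
    (h : ∀ ns L, List.Forall₂ HasDeg ns L → u L = v L) : u = v :=
  funext fun L => list_induction (Q := fun L => u L = v L)
    (fun L a b L' h1 h2 => by rw [hu.map_add, hv.map_add, h1, h2]) h L

theorem HasDeg.map_parityForm {ns : List ℤ} {L : List (Form E F A)}
    (h : List.Forall₂ HasDeg ns L) {u : Symb E F A} (hu : IsMulti u) :
    u (L.map BigBracket.parityForm) = sg ns.sum • u L := by
  induction h generalizing u with
  | nil => rw [List.sum_nil, sg_of_even Even.zero, one_smul]; rfl
  | @cons m f ns L hf _ ih =>
    have h1 := ih (hu.ins (BigBracket.parityForm f))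
    rw [List.map_cons]
    refine h1.trans ?_
    rw [hf.parityForm, hu.ins_smul, symb_smul_apply, List.sum_cons, smul_smul]
    change _ • u (f :: L) = _ • u (f :: L)
    congr 1
    by_cases h1 : Even m <;> by_cases h2 : Even ns.sum <;> simp [sg, Int.even_add, h1, h2]

/-- Parity on the inputs contributes `(-1)^{∑ ns}` and on the output `(-1)^{∑ ns + d}`, leaving
`(-1)^d`. -/
theorem IsHom.paritySymb {d : ℤ} {u : Symb E F A} (hu : IsHom d u) :
    paritySymb u = sg d • u := by
  refine hu.toIsMulti.paritySymb.ext (hu.toIsMulti.smul _) fun ns L hL => ?_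
  rw [symb_smul_apply, BigBracket.paritySymb, HasDeg.map_parityForm hL hu.toIsMulti,
    parityForm_smul, (hu.degree ns L hL).parityForm, smul_smul]
  congr 1
  by_cases h1 : Even d <;> by_cases h2 : Even ns.sum <;> simp [sg, Int.even_add, h1, h2]

/-- On homogeneous entries only one of the even and odd branches of the recursion survives, and the
recursion becomes the graded rule `{{u, v}, f} = {u, {v, f}} ± {{u, f}, v}` on which all later
inductions run. -/
theorem bracket_ins {d m : ℤ} {u v : Symb E F A} (hu : IsMulti u) (hv : IsHom d v)
    {f : Form E F A} (hf : HasDeg m f) :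
    ins f (bracket u v) = bracket u (ins f v) + sg (d * m) • bracket (ins f u) v := by
  have h : ins f (bracket u v) = bracket u (ins f v) +
      (bracket (ins (evenPart f) u) v + bracket (ins (oddPart f) u) (paritySymb v)) := rfl
  rw [h, hf.evenPart, hf.oddPart, hv.paritySymb]
  congr 1
  by_cases hm : Even m
  · rw [if_pos hm, if_pos hm, hu.ins_zero, bracket_zero_left (hv.toIsMulti.smul _), add_zero,
      sg_of_even (hm.mul_left d), one_smul]
  · rw [if_neg hm, if_neg hm, hu.ins_zero, bracket_zero_left hv.toIsMulti, zero_add,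
      bracket_smul_right _ (hu.ins f)]
    congr 1
    by_cases h1 : Even d <;> simp [sg, Int.even_mul, h1, hm]

theorem bracket_cons {d m : ℤ} {u v : Symb E F A} (hu : IsMulti u) (hv : IsHom d v)
    {f : Form E F A} (hf : HasDeg m f) (L : List (Form E F A)) :
    bracket u v (f :: L) = bracket u (ins f v) L + sg (d * m) • bracket (ins f u) v L :=
  congrFun (bracket_ins hu hv hf) L

theorem bracket_nil {d d' : ℤ} {u v : Symb E F A} (hu : IsHom d u) (hv : IsHom d' v) :
    bracket u v [] = u [v []] - sg (d * d') • v [u []] := by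
  have h : bracket u v [] = u [v []] -
    (v [evenPart (u [])] + paritySymb v [oddPart (u [])]) := rfl
  rw [h, hu.degree_nil.evenPart, hu.degree_nil.oddPart, hv.paritySymb, symb_smul_apply]
  congr 1
  by_cases hm : Even d
  · rw [if_pos hm, if_pos hm, hv.single_zero, smul_zero, add_zero,
      sg_of_even (hm.mul_right d'), one_smul]
  · rw [if_neg hm, if_neg hm, hv.single_zero, zero_add]
    congr 1
    by_cases h1 : Even d' <;> simp [sg, Int.even_mul, h1, hm]

theorem bracket_single {d d' m : ℤ} {u v : Symb E F A} (hu : IsHom d u) (hv : IsHom d' v)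
    {f : Form E F A} (hf : HasDeg m f) :
    bracket u v [f] = u [v [f]] - sg (d * (d' + m)) • v [f, u []] +
      sg (d' * m) • (u [f, v []] - sg ((d + m) * d') • v [u [f]]) := by
  have h := congrFun (bracket_ins hu.toIsMulti hv hf) []
  rw [symb_add_apply, symb_smul_apply, bracket_nil hu (hv.ins hf), bracket_nil (hu.ins hf) hv] at h
  exact h

set_option maxHeartbeats 1000000 in
theorem bracket_leibniz_single {d d' m n : ℤ} {u v : Symb E F A} (hu : IsHom d u)
    (hv : IsHom d' v) {f g : Form E F A} (hf : HasDeg m f) (hg : HasDeg n g) :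
    bracket u v [f * g] =
      bracket u v [f] * g + sg ((d + d') * m) • (f * bracket u v [g]) := by
  have lei : ∀ {d m n : ℤ} {u : Symb E F A} (hu : IsHom d u) {f g : Form E F A}
      (hf : HasDeg m f) (hg : HasDeg n g), u [f * g] = u [f] * g + sg (d * m) • (f * u [g]) := by
    intro d m n u hu f g hf hg
    have := hu.leibniz [] [] m n f g .nil hf hg
    simpa using this
  have swap : ∀ {d m n : ℤ} {u : Symb E F A} (hu : IsHom d u) {f g : Form E F A}
      (hf : HasDeg m f) (hg : HasDeg n g), u [f, g] = sg (m * n) • u [g, f] :=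
    fun hu _ _ hf hg => hu.symm [] [] _ _ _ _ [] .nil hf hg
  have lei2 : ∀ {d m n p : ℤ} {u : Symb E F A} (hu : IsHom d u) {f g h : Form E F A}
      (hf : HasDeg m f) (hg : HasDeg n g) (hh : HasDeg p h),
      u [h, f * g] = u [h, f] * g + sg ((d + p) * m) • (f * u [h, g]) :=
    fun hu _ _ _ hf hg hh => lei (hu.ins hh) hf hg
  rw [bracket_single hu hv (hf.mul hg), bracket_single hu hv hf, bracket_single hu hv hg,
    lei hv hf hg, lei hu hf hg, swap hv (hf.mul hg) hu.degree_nil,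
    swap hu (hf.mul hg) hv.degree_nil, lei2 hu hf hg hv.degree_nil, lei2 hv hf hg hu.degree_nil,
    swap hv hf hu.degree_nil, swap hv hg hu.degree_nil, swap hu hf hv.degree_nil,
    swap hu hg hv.degree_nil, hu.single_add, hv.single_add, hu.single_smul, hv.single_smul,
    lei hu (hv.degree_single hf) hg, lei hv (hu.degree_single hf) hg,
    lei hu hf (hv.degree_single hg), lei hv hf (hu.degree_single hg)]
  simp only [mul_add, add_mul, mul_sub, sub_mul, smul_mul_assoc, mul_smul_comm]
  -- Once the symmetry and Leibniz rules of `u` and `v` are used, ten independent products remain.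
  -- The identity is then a comparison of signs depending on the parities of the four degrees.
  generalize u [v [f]] * g = x₁
  generalize v [f] * u [g] = x₂
  generalize u [f] * v [g] = x₃
  generalize f * u [v [g]] = x₄
  generalize v [u [], f] * g = x₅
  generalize f * v [u [], g] = x₆
  generalize u [v [], f] * g = x₇
  generalize f * u [v [], g] = x₈
  generalize v [u [f]] * g = x₉
  generalize f * v [u [g]] = x₁₀
  by_cases h1 : Even d <;> by_cases h2 : Even d' <;> by_cases h3 : Even m <;>
    by_cases h4 : Even n <;> simp [sg, Int.even_add, Int.even_mul, h1, h2, h3, h4] <;> abel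

/-- Inserting `f` and `g` gives four terms. The two in which `u` or `v` receives both forms are
symmetric by hypothesis, and exchanging `f` and `g` swaps the two mixed ones. Earlier entries are
absorbed into `u` or `v`. -/
theorem bracket_symm {d d' : ℤ} {u v : Symb E F A} (hu : IsHom d u) (hv : IsHom d' v)
    {ns : List ℤ} {L : List (Form E F A)} {m n : ℤ} {f g : Form E F A} (L' : List (Form E F A))
    (hL : List.Forall₂ HasDeg ns L) (hf : HasDeg m f) (hg : HasDeg n g) :
    bracket u v (L ++ f :: g :: L') = sg (m * n) • bracket u v (L ++ g :: f :: L') := by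
  induction hL generalizing u v d d' with
  | nil =>
    have h : ∀ {m n : ℤ} {f g : Form E F A}, HasDeg m f → HasDeg n g →
        ins g (ins f (bracket u v)) = bracket u (ins g (ins f v)) +
          sg ((d' + m) * n) • bracket (ins g u) (ins f v) +
          sg (d' * m) • (bracket (ins f u) (ins g v) +
            sg (d' * n) • bracket (ins g (ins f u)) v) := by
      intro m n f g hf hg
      rw [bracket_ins hu.toIsMulti hv hf, ins_symb_add, ins_symb_smul,
        bracket_ins hu.toIsMulti (hv.ins hf) hg, bracket_ins (hu.ins hf).toIsMulti hv hg]
    have swap : ∀ {d : ℤ} {u : Symb E F A} (_ : IsHom d u),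
        ins g (ins f u) = sg (m * n) • ins f (ins g u) :=
      fun hu => funext fun K => hu.symm [] [] _ _ _ _ K .nil hf hg
    have h1 := h hf hg
    rw [swap hu, swap hv, bracket_smul_left _ _ hv.toIsMulti,
      bracket_smul_right _ hu.toIsMulti] at h1
    have h3 : ins g (ins f (bracket u v)) = sg (m * n) • ins f (ins g (bracket u v)) := by
      rw [h1, h hg hf]
      generalize bracket u (ins f (ins g v)) = x₁
      generalize bracket (ins g u) (ins f v) = x₂
      generalize bracket (ins f u) (ins g v) = x₃
      generalize bracket (ins f (ins g u)) v = x₄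
      by_cases h1 : Even d' <;> by_cases h3 : Even m <;> by_cases h4 : Even n <;>
        simp [sg, Int.even_add, Int.even_mul, h1, h3, h4] <;> abel
    exact congrFun h3 L'
  | @cons p h ns L hh _ ih =>
    rw [List.cons_append, List.cons_append, bracket_cons hu.toIsMulti hv hh,
      bracket_cons hu.toIsMulti hv hh, ih hu (hv.ins hh), ih (hu.ins hh) hv, smul_add, smul_comm]

theorem bracket_leibniz {d d' : ℤ} {u v : Symb E F A} (hu : IsHom d u) (hv : IsHom d' v)
    {ns : List ℤ} {L : List (Form E F A)} {m n : ℤ} {f g : Form E F A}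
    (hL : List.Forall₂ HasDeg ns L) (hf : HasDeg m f) (hg : HasDeg n g) :
    bracket u v (L ++ [f * g]) = bracket u v (L ++ [f]) * g +
      sg ((d + d' + ns.sum) * m) • (f * bracket u v (L ++ [g])) := by
  induction hL generalizing u v d d' with
  | nil => simpa using bracket_leibniz_single hu hv hf hg
  | @cons p h ns L hh _ ih =>
    have e1 : d + (d' + p) + ns.sum = d + d' + (p + ns.sum) := by ring
    have e2 : d + p + d' + ns.sum = d + d' + (p + ns.sum) := by ring
    rw [List.cons_append, List.cons_append, List.cons_append, bracket_cons hu.toIsMulti hv hh,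
      bracket_cons hu.toIsMulti hv hh, bracket_cons hu.toIsMulti hv hh, ih hu (hv.ins hh),
      ih (hu.ins hh) hv, List.sum_cons, e1, e2]
    simp only [smul_add, add_mul, mul_add, smul_mul_assoc, mul_smul_comm]
    module

theorem bracket_degree {d d' : ℤ} {u v : Symb E F A} (hu : IsHom d u) (hv : IsHom d' v)
    {ns : List ℤ} {L : List (Form E F A)} (hL : List.Forall₂ HasDeg ns L) :
    HasDeg (ns.sum + (d + d')) (bracket u v L) := by
  induction hL generalizing u v d d' with
  | nil =>
    rw [bracket_nil hu hv, sub_eq_add_neg, ← neg_smul]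
    exact ((hu.degree_single hv.degree_nil).cast (by simp; ring)).add
      (((hv.degree_single hu.degree_nil).cast (by simp)).smul _)
  | @cons p h ns L hh _ ih =>
    rw [bracket_cons hu.toIsMulti hv hh]
    exact ((ih hu (hv.ins hh)).cast (by rw [List.sum_cons]; ring)).add
      (((ih (hu.ins hh) hv).cast (by rw [List.sum_cons]; ring)).smul _)

theorem IsHom.bracket {d d' : ℤ} {u v : Symb E F A} (hu : IsHom d u) (hv : IsHom d' v) :
    IsHom (d + d') (bracket u v) where
  toIsMulti := hu.toIsMulti.bracket hv.toIsMulti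
  symm _ _ _ _ _ _ L' hL hf hg := bracket_symm hu hv L' hL hf hg
  leibniz _ _ _ _ _ _ hL hf hg := bracket_leibniz hu hv hL hf hg
  degree _ _ hL := bracket_degree hu hv hL

/-- The insertion rule treats `u` and `v` alike up to sign, so the claim reduces to the empty list,
where it is visible from `bracket_nil`. -/
theorem bracket_antisymm {d d' : ℤ} {u v : Symb E F A} (hu : IsHom d u) (hv : IsHom d' v) :
    bracket u v = -(sg (d * d') • bracket v u) := by
  rw [← neg_smul]
  refine (hu.toIsMulti.bracket hv.toIsMulti).ext
    ((hv.toIsMulti.bracket hu.toIsMulti).smul _) fun ns L hL => ?_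
  rw [symb_smul_apply]
  induction hL generalizing u v d d' with
  | nil =>
    rw [bracket_nil hu hv, bracket_nil hv hu]
    by_cases h1 : Even d <;> by_cases h2 : Even d' <;> simp [sg, Int.even_mul, h1, h2] <;> abel
  | @cons p h ns L hh _ ih =>
    rw [bracket_cons hu.toIsMulti hv hh, bracket_cons hv.toIsMulti hu hh, ih hu (hv.ins hh),
      ih (hu.ins hh) hv]
    by_cases h1 : Even d <;> by_cases h2 : Even d' <;> by_cases h3 : Even p <;>
      simp [sg, Int.even_add, Int.even_mul, h1, h2, h3] <;> abel

/-- On the zero section the second-order terms, such as `w` evaluated at `u []` and `v []`, occur in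
pairs that cancel by graded symmetry. The iterated first-order terms match directly. -/
theorem bracket_jacobi_nil {d₁ d₂ d₃ : ℤ} {u v w : Symb E F A} (hu : IsHom d₁ u)
    (hv : IsHom d₂ v) (hw : IsHom d₃ w) :
    bracket u (bracket v w) [] =
      bracket (bracket u v) w [] + sg (d₁ * d₂) • bracket v (bracket u w) [] := by
  have swap : ∀ {d m n : ℤ} {u : Symb E F A} (hu : IsHom d u) {f g : Form E F A}
      (hf : HasDeg m f) (hg : HasDeg n g), u [f, g] = sg (m * n) • u [g, f] :=
    fun hu _ _ hf hg => hu.symm [] [] _ _ _ _ [] .nil hf hg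
  rw [bracket_nil hu (hv.bracket hw), bracket_nil (hu.bracket hv) hw,
    bracket_nil hv (hu.bracket hw), bracket_nil hv hw, bracket_nil hu hv, bracket_nil hu hw,
    bracket_single hv hw hu.degree_nil, bracket_single hu hv hw.degree_nil,
    bracket_single hu hw hv.degree_nil]
  simp only [sub_eq_add_neg, ← neg_smul, hu.single_add, hv.single_add, hw.single_add,
    hu.single_smul, hv.single_smul, hw.single_smul]
  rw [swap hw hu.degree_nil hv.degree_nil, swap hv hu.degree_nil hw.degree_nil,
    swap hu hv.degree_nil hw.degree_nil]
  by_cases h1 : Even d₁ <;> by_cases h2 : Even d₂ <;> by_cases h3 : Even d₃ <;>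
    simp [sg, Int.even_add, Int.even_mul, h1, h2, h3] <;> abel

/-- Inserting `f` in the Jacobiator of `u, v, w` gives a signed sum of three Jacobiators, with `f`
inserted in exactly one of `u`, `v`, `w`. Induction on the list reduces to the empty one. -/
theorem bracket_jacobi {d₁ d₂ d₃ : ℤ} {u v w : Symb E F A} (hu : IsHom d₁ u)
    (hv : IsHom d₂ v) (hw : IsHom d₃ w) :
    bracket u (bracket v w) =
      bracket (bracket u v) w + sg (d₁ * d₂) • bracket v (bracket u w) := by
  refine (hu.bracket (hv.bracket hw)).toIsMulti.ext (((hu.bracket hv).bracket hw).toIsMulti.add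
    ((hv.bracket (hu.bracket hw)).toIsMulti.smul _)) fun ns L hL => ?_
  rw [symb_add_apply, symb_smul_apply]
  induction hL generalizing u v w d₁ d₂ d₃ with
  | nil => exact bracket_jacobi_nil hu hv hw
  | @cons p f ns L hf _ ih =>
    have hu' := hu.ins hf
    have hv' := hv.ins hf
    have hw' := hw.ins hf
    have e1 : ins f (bracket u (bracket v w)) = bracket u (bracket v (ins f w)) +
        sg (d₃ * p) • bracket u (bracket (ins f v) w) +
        sg ((d₂ + d₃) * p) • bracket (ins f u) (bracket v w) := by
      rw [bracket_ins hu.toIsMulti (hv.bracket hw) hf, bracket_ins hv.toIsMulti hw hf,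
        bracket_add_right hu.toIsMulti, bracket_smul_right _ hu.toIsMulti]
    have e2 : ins f (bracket v (bracket u w)) = bracket v (bracket u (ins f w)) +
        sg (d₃ * p) • bracket v (bracket (ins f u) w) +
        sg ((d₁ + d₃) * p) • bracket (ins f v) (bracket u w) := by
      rw [bracket_ins hv.toIsMulti (hu.bracket hw) hf, bracket_ins hu.toIsMulti hw hf,
        bracket_add_right hv.toIsMulti, bracket_smul_right _ hv.toIsMulti]
    have e3 : ins f (bracket (bracket u v) w) = bracket (bracket u v) (ins f w) +
        sg (d₃ * p) • (bracket (bracket u (ins f v)) w +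
        sg (d₂ * p) • bracket (bracket (ins f u) v) w) := by
      rw [bracket_ins (hu.bracket hv).toIsMulti hw hf, bracket_ins hu.toIsMulti hv hf,
        bracket_add_left _ _ hw.toIsMulti, bracket_smul_left _ _ hw.toIsMulti]
    change ins f (bracket u (bracket v w)) L = ins f (bracket (bracket u v) w) L +
      _ • ins f (bracket v (bracket u w)) L
    rw [e1, e2, e3]
    simp only [symb_add_apply, symb_smul_apply]
    rw [ih hu hv hw', ih hu hv' hw, ih hu' hv hw]
    by_cases h1 : Even d₁ <;> by_cases h2 : Even d₂ <;> by_cases h3 : Even d₃ <;>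
      by_cases h4 : Even p <;>
      simp [sg, Int.even_add, Int.even_mul, h1, h2, h3, h4] <;> abel

end FiniteRank

end SymbLemmas

/-! ### The biderivation of a bivector in one fibre. -/

section FibreBivector

variable {V : Type*} [AddCommGroup V] [Module ℝ V]

/-- The failure of `i_P` to be a derivation. -/
def polar (P : ExteriorAlgebra ℝ V) (a b : Ext V) : Ext V :=
  innerMulti P (a * b) - innerMulti P a * b - a * innerMulti P b

theorem polar_zero_left (a b : Ext V) : polar 0 a b = 0 := by simp [polar]

theorem polar_add_left (P Q : ExteriorAlgebra ℝ V) (a b : Ext V) :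
    polar (P + Q) a b = polar P a b + polar Q a b := by
  simp only [polar, map_add, LinearMap.add_apply, add_mul, mul_add]; abel

theorem polar_ι_mul_ι (v w : V) {m : ℕ} {a : Ext V} (ha : a ∈ ⋀[ℝ]^m (Module.Dual ℝ V))
    (b : Ext V) : polar (ExteriorAlgebra.ι ℝ v * ExteriorAlgebra.ι ℝ w) a b =
      (-1 : ℝ) ^ m • (intProd v a * intProd w b - intProd w a * intProd v b) :=
  innerMulti_mul_sub v w ha b

theorem intProd_mul_intProd_comm (v w : V) {m n : ℕ} {a b : Ext V}
    (ha : a ∈ ⋀[ℝ]^m (Module.Dual ℝ V)) (hb : b ∈ ⋀[ℝ]^n (Module.Dual ℝ V)) :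
    intProd v a * intProd w b =
      (-1 : ℝ) ^ (m * n + m + n + 1) • (intProd w b * intProd v a) := by
  cases m with
  | zero => rw [intProd_of_mem_zero v ha]; simp
  | succ m =>
    cases n with
    | zero => rw [intProd_of_mem_zero w hb]; simp
    | succ n =>
      rw [mul_comm_of_mem (intProd_mem_of_succ v ha) (intProd_mem_of_succ w hb)]
      congr 1
      have : (m + 1) * (n + 1) + (m + 1) + (n + 1) + 1 = m * n + 2 * (m + n + 2) := by ring
      rw [this, pow_add _ (m * n), pow_mul _ 2]
      simp

theorem intProd_mul_comm (v : V) {m n : ℕ} {a b : Ext V}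
    (ha : a ∈ ⋀[ℝ]^m (Module.Dual ℝ V)) (hb : b ∈ ⋀[ℝ]^n (Module.Dual ℝ V)) :
    intProd v a * b = (-1 : ℝ) ^ (m * n + n) • (b * intProd v a) := by
  cases m with
  | zero => rw [intProd_of_mem_zero v ha]; simp
  | succ m =>
    rw [mul_comm_of_mem (intProd_mem_of_succ v ha) hb]
    congr 1
    have : (m + 1) * n + n = m * n + 2 * n := by ring
    rw [this, pow_add _ (m * n), pow_mul _ 2]
    simp

end FibreBivector

/-! ### Forms, sections and bivectors as functions on `T^*[2]A[1]`; arity. -/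

section SymbExamples

variable {E : Type*} [NormedAddCommGroup E] [NormedSpace ℝ E]
  {M : Type*} [TopologicalSpace M] [ChartedSpace E M]
  {F : Type*} [NormedAddCommGroup F] [NormedSpace ℝ F]
  {A : M → Type*} [TopologicalSpace (Bundle.TotalSpace F A)]
  [∀ x, AddCommGroup (A x)] [∀ x, Module ℝ (A x)] [∀ x, TopologicalSpace (A x)]
  [FiberBundle F A] [VectorBundle ℝ F A]

/-- Local decomposability, evaluated at the point, reduces fibrewise assertions stable under sums to
the case `v ∧ w`. -/
theorem Bivector.induction (π : Bivector E F A) (x : M) {p : ExteriorAlgebra ℝ (A x) → Prop}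
    (h0 : p 0) (hadd : ∀ P Q, p P → p Q → p (P + Q))
    (hι : ∀ v w, p (ExteriorAlgebra.ι ℝ v * ExteriorAlgebra.ι ℝ w)) : p (π.val x) := by
  obtain ⟨L, hL⟩ := π.smooth x
  rw [hL.self_of_nhds]
  clear hL
  induction L with
  | nil => exact h0
  | cons q L ih => exact hadd _ _ (hι _ _) ih

/-- The values of `ofBivector` as a biderivation. -/
def Bivector.pair (π : Bivector E F A) (f g : Form E F A) : Form E F A :=
  π.innerForm (f * g) - π.innerForm f * g - f * π.innerForm g

theorem Bivector.pair_add_left (π : Bivector E F A) (f f' g : Form E F A) :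
    π.pair (f + f') g = π.pair f g + π.pair f' g := form_ext fun x => by
  change polar _ (f.1 x + f'.1 x) (g.1 x) = polar _ (f.1 x) (g.1 x) + polar _ (f'.1 x) (g.1 x)
  simp only [polar, map_add, add_mul]; abel

theorem Bivector.pair_smul_left (π : Bivector E F A) (c : ℝ) (f g : Form E F A) :
    π.pair (c • f) g = c • π.pair f g := form_ext fun x => by
  change polar _ (c • f.1 x) (g.1 x) = c • polar _ (f.1 x) (g.1 x)
  simp only [polar, map_smul, smul_mul_assoc, smul_sub]

theorem Bivector.pair_add_right (π : Bivector E F A) (f g g' : Form E F A) :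
    π.pair f (g + g') = π.pair f g + π.pair f g' := form_ext fun x => by
  change polar _ (f.1 x) (g.1 x + g'.1 x) = polar _ (f.1 x) (g.1 x) + polar _ (f.1 x) (g'.1 x)
  simp only [polar, map_add, mul_add]; abel

theorem Bivector.pair_smul_right (π : Bivector E F A) (c : ℝ) (f g : Form E F A) :
    π.pair f (c • g) = c • π.pair f g := form_ext fun x => by
  change polar _ (f.1 x) (c • g.1 x) = c • polar _ (f.1 x) (g.1 x)
  simp only [polar, map_smul, mul_smul_comm, smul_sub]

theorem Bivector.pair_zero_left (π : Bivector E F A) (g : Form E F A) : π.pair 0 g = 0 := by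
  have := π.pair_smul_left 0 0 g
  rwa [zero_smul, zero_smul] at this

theorem Bivector.pair_zero_right (π : Bivector E F A) (f : Form E F A) : π.pair f 0 = 0 := by
  have := π.pair_smul_right 0 f 0
  rwa [zero_smul, zero_smul] at this

theorem Bivector.pair_symm (π : Bivector E F A) {m n : ℤ} {f g : Form E F A} (hf : HasDeg m f)
    (hg : HasDeg n g) : π.pair f g = sg (m * n) • π.pair g f := by
  obtain rfl | ⟨m, rfl, hf⟩ := hf
  · rw [π.pair_zero_left, π.pair_zero_right, smul_zero]
  obtain rfl | ⟨n, rfl, hg⟩ := hg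
  · rw [π.pair_zero_left, π.pair_zero_right, smul_zero]
  rw [← Nat.cast_mul, sg_natCast]
  refine form_ext fun x => ?_
  change polar _ (f.1 x) (g.1 x) = (-1 : ℝ) ^ (m * n) • polar _ (g.1 x) (f.1 x)
  refine π.induction x (p := fun P => polar P (f.1 x) (g.1 x) =
    (-1 : ℝ) ^ (m * n) • polar P (g.1 x) (f.1 x)) (by simp only [polar_zero_left, smul_zero])
    (fun P Q hP hQ => by rw [polar_add_left, polar_add_left, hP, hQ, smul_add]) fun v w => ?_
  rw [polar_ι_mul_ι _ _ (hf x), polar_ι_mul_ι _ _ (hg x),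
    intProd_mul_intProd_comm v w (hf x) (hg x), intProd_mul_intProd_comm w v (hf x) (hg x)]
  rcases Nat.even_or_odd m with h1 | h1 <;> rcases Nat.even_or_odd n with h2 | h2 <;>
    simp [pow_add, pow_mul, h1.neg_one_pow, h2.neg_one_pow] <;> abel

theorem Bivector.pair_leibniz (π : Bivector E F A) {k m : ℤ} {h f : Form E F A}
    (hh : HasDeg k h) (hf : HasDeg m f) (g : Form E F A) :
    π.pair h (f * g) = π.pair h f * g + sg (k * m) • (f * π.pair h g) := by
  obtain rfl | ⟨k, rfl, hh⟩ := hh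
  · simp [π.pair_zero_left]
  obtain rfl | ⟨m, rfl, hf⟩ := hf
  · simp [π.pair_zero_right]
  rw [← Nat.cast_mul, sg_natCast]
  refine form_ext fun x => ?_
  change polar _ (h.1 x) (f.1 x * g.1 x) = polar _ (h.1 x) (f.1 x) * g.1 x +
    (-1 : ℝ) ^ (k * m) • (f.1 x * polar _ (h.1 x) (g.1 x))
  refine π.induction x (p := fun P => polar P (h.1 x) (f.1 x * g.1 x) =
    polar P (h.1 x) (f.1 x) * g.1 x + (-1 : ℝ) ^ (k * m) • (f.1 x * polar P (h.1 x) (g.1 x)))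
    (by simp only [polar_zero_left, zero_mul, mul_zero, smul_zero, add_zero])
    (fun P Q hP hQ => by
      simp only [polar_add_left, hP, hQ, smul_add, add_mul, mul_add]; abel) fun v w => ?_
  simp only [polar_ι_mul_ι _ _ (hh x), intProd_mul, parity_of_mem (hf x)]
  have e : ∀ v w, intProd v (h.1 x) * ((-1 : ℝ) ^ m • f.1 x * intProd w (g.1 x)) =
      (-1 : ℝ) ^ (k * m) • (f.1 x * (intProd v (h.1 x) * intProd w (g.1 x))) := by
    intro v w
    rw [smul_mul_assoc, mul_smul_comm, ← mul_assoc, intProd_mul_comm v (hh x) (hf x),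
      smul_mul_assoc, smul_smul, mul_assoc]
    congr 1
    rw [← pow_add, show m + (k * m + m) = k * m + 2 * m by ring, pow_add _ (k * m), pow_mul _ 2]
    simp
  rw [mul_add, mul_add, e, e]
  simp only [smul_mul_assoc, mul_smul_comm, mul_sub, sub_mul, mul_assoc]
  module

theorem Bivector.hasDeg_pair (π : Bivector E F A) {m n : ℤ} {f g : Form E F A} (hf : HasDeg m f)
    (hg : HasDeg n g) : HasDeg (m + n - 2) (π.pair f g) := by
  obtain rfl | ⟨m, rfl, hf⟩ := hf
  · rw [π.pair_zero_left]; exact .zero _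
  obtain rfl | ⟨n, rfl, hg⟩ := hg
  · rw [π.pair_zero_right]; exact .zero _
  -- One reduction to `v ∧ w` serves both purposes below: vanishing when a factor has degree `0`,
  -- and homogeneity otherwise.
  have key : ∀ (p : ∀ x, Ext (A x) → Prop) (_ : ∀ x, p x 0)
      (_ : ∀ x a b, p x a → p x b → p x (a + b))
      (_ : ∀ x v w, p x ((-1 : ℝ) ^ m • (intProd v (f.1 x) * intProd w (g.1 x) -
        intProd w (f.1 x) * intProd v (g.1 x)))) x, p x ((π.pair f g).1 x) := by
    intro p h0 hadd hι x
    exact π.induction x (p := fun P => p x (polar P (f.1 x) (g.1 x)))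
      (by rw [polar_zero_left]; exact h0 x)
      (fun P Q hP hQ => by rw [polar_add_left]; exact hadd x _ _ hP hQ)
      fun v w => by rw [polar_ι_mul_ι _ _ (hf x)]; exact hι x v w
  cases m with
  | zero =>
    left
    refine form_ext (key (fun x a => a = 0) (fun _ => rfl)
      (fun _ a b h1 h2 => by rw [h1, h2, add_zero]) fun x v w => ?_)
    rw [intProd_of_mem_zero _ (hf x), intProd_of_mem_zero _ (hf x)]; simp
  | succ m =>
    cases n with
    | zero =>
      left
      refine form_ext (key (fun x a => a = 0) (fun _ => rfl)
        (fun _ a b h1 h2 => by rw [h1, h2, add_zero]) fun x v w => ?_)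
      rw [intProd_of_mem_zero _ (hg x), intProd_of_mem_zero _ (hg x)]; simp
    | succ n =>
      refine Or.inr ⟨m + n, by push_cast; ring, ?_⟩
      refine key (fun x a => a ∈ ⋀[ℝ]^(m + n) (Module.Dual ℝ (A x)))
        (fun _ => Submodule.zero_mem _) (fun _ _ _ => Submodule.add_mem _) fun x v w =>
        Submodule.smul_mem _ _ (Submodule.sub_mem _ ?_ ?_) <;>
      exact SetLike.GradedMul.mul_mem (A := fun i : ℕ => ⋀[ℝ]^i (Module.Dual ℝ (A x)))
        (intProd_mem_of_succ _ (hf x)) (intProd_mem_of_succ _ (hg x))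

/-- The minus sign is the factor `(-1)^m` of the biderivation at `m = 1`. It accounts for the sign
convention `om^♭ X = -i_X om` in `N`. -/
theorem Bivector.pair_of_isDeg_one (π : Bivector E F A) {α : Form E F A} (hα : IsDeg 1 α)
    (f : Form E F A) : π.pair α f = -BigBracket.innerForm (π.sharp α) f := form_ext fun x => by
  change polar (π.val x) (α.1 x) (f.1 x) =
    -intProd (sharpAt (π.val x) (ExteriorAlgebra.ιInv (α.1 x))) (f.1 x)
  refine π.induction x (p := fun P => polar P (α.1 x) (f.1 x) =
    -intProd (sharpAt P (ExteriorAlgebra.ιInv (α.1 x))) (f.1 x))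
    (by simp [polar_zero_left, sharpAt_zero]) (fun P Q hP hQ => by
      rw [polar_add_left, hP, hQ, sharpAt_add, map_add, LinearMap.add_apply]; abel) fun v w => ?_
  rw [polar_ι_mul_ι _ _ (hα x), sharpAt_ι_mul_ι]
  generalize hβ : ExteriorAlgebra.ιInv (α.1 x) = β
  have h : α.1 x = ExteriorAlgebra.ι ℝ β := by rw [← hβ]; exact eq_ι_of_mem (hα x)
  rw [h, intProd_ι, intProd_ι, ← Algebra.smul_def, ← Algebra.smul_def]
  simp

/-- `u` has degree `k` in the momenta. -/
def HasArity (k : ℤ) (u : Symb E F A) : Prop :=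
  ∀ L : List (Form E F A), (L.length : ℤ) ≠ k → u L = 0

theorem HasArity.ins {k : ℤ} {u : Symb E F A} (hu : HasArity k u) (f : Form E F A) :
    HasArity (k - 1) (ins f u) := fun L hL => hu (f :: L) (by
  rw [List.length_cons]; push_cast; omega)

theorem HasArity.paritySymb {k : ℤ} {u : Symb E F A} (hu : HasArity k u) :
    HasArity k (paritySymb u) := fun L hL => by
  rw [BigBracket.paritySymb, hu _ (by rwa [List.length_map])]
  exact form_ext fun _ => map_zero _

theorem HasArity.add {k : ℤ} {u v : Symb E F A} (hu : HasArity k u) (hv : HasArity k v) :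
    HasArity k (u + v) := fun L hL => by rw [symb_add_apply, hu L hL, hv L hL, add_zero]

theorem HasArity.neg {k : ℤ} {u : Symb E F A} (hu : HasArity k u) :
    HasArity k (-u) := fun L hL => by
  change -u L = 0
  rw [hu L hL, neg_zero]

/-- A bracket removes one momentum. Arities are integers so that two functions of arity `0` are
covered: their bracket has arity `-1`, hence is zero. -/
theorem HasArity.bracket {k l : ℤ} {u v : Symb E F A} (hk : HasArity k u) (hl : HasArity l v)
    (hu : IsMulti u) (hv : IsMulti v) : HasArity (k + l - 1) (bracket u v) := by
  intro L hL
  change bracketAux L u v = 0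
  induction L generalizing u v k l with
  | nil =>
    rw [List.length_nil, Nat.cast_zero] at hL
    -- For `u [v []]` to be nonzero, `v` needs arity `0` and `u` arity `1`. The map `T` stands for
    -- the identity, the even part or the odd part.
    have h1 : ∀ {k l : ℤ} {u v : Symb E F A}, HasArity k u → HasArity l v → IsMulti u →
        0 ≠ k + l - 1 → ∀ T : Form E F A → Form E F A, T 0 = 0 → u [T (v [])] = 0 := by
      intro k l u v hk hl hu hL T hT
      by_cases h : l = 0
      · exact hk _ (by simp; omega)
      · rw [hl [] (by simpa using Ne.symm h), hT, hu.single_zero]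
    have he : evenPart (0 : Form E F A) = 0 := by rw [(HasDeg.zero 0).evenPart, ite_self]
    have ho : oddPart (0 : Form E F A) = 0 := by rw [(HasDeg.zero 0).oddPart, ite_self]
    have h2 : u [v []] = 0 := h1 hk hl hu hL id rfl
    rw [bracketAux, h2, h1 hl hk hv (by omega) _ he,
      h1 hl.paritySymb hk hv.paritySymb (by omega) _ ho]
    simp
  | cons f L ih =>
    rw [List.length_cons] at hL
    push_cast at hL
    rw [bracketAux, ih hk (hl.ins f) hu (hv.ins f) (by omega),
      ih (hk.ins _) hl (hu.ins _) hv (by omega),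
      ih (hk.ins _) hl.paritySymb (hu.ins _) hv.paritySymb (by omega)]
    simp

theorem ofForm_hasArity (f : Form E F A) : HasArity 0 (ofForm f) := fun L hL => by
  cases L with
  | nil => simp at hL
  | cons => rfl

theorem ofSec_hasArity (X : Sec E F A) : HasArity 1 (ofSec X) := fun L hL => by
  match L, hL with
  | [], _ => rfl
  | [_], hL => simp at hL
  | _ :: _ :: _, _ => rfl

theorem ofBivector_hasArity (π : Bivector E F A) : HasArity 2 (ofBivector π) := fun L hL => by
  match L, hL with
  | [], _ => rfl
  | [_], _ => rfl
  | [_, _], hL => simp at hL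
  | _ :: _ :: _ :: _, _ => rfl

theorem ofForm_ne_nil (f : Form E F A) {L : List (Form E F A)} (hL : L ≠ []) : ofForm f L = 0 :=
  ofForm_hasArity f L (by simpa using hL)

theorem ofForm_isHom {m : ℤ} {f : Form E F A} (hf : HasDeg m f) : IsHom m (ofForm f) where
  map_add L g h L' := by simp [ofForm_ne_nil]
  map_smul L c g L' := by simp [ofForm_ne_nil]
  symm ns L p n g h L' _ _ _ := by simp [ofForm_ne_nil]
  leibniz ns L p n g h _ _ _ := by simp [ofForm_ne_nil]
  degree ns L hL := by
    cases hL with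
    | nil => exact hf.cast (by simp)
    | cons => exact .zero _

theorem ofSec_isHom (X : Sec E F A) : IsHom (-1) (ofSec X) where
  map_add L f g L' := by
    match L, L' with
    | [], [] => exact innerForm_add X f g
    | [], _ :: _ => exact (add_zero _).symm
    | [_], _ => exact (add_zero _).symm
    | _ :: _ :: _, _ => exact (add_zero _).symm
  map_smul L c f L' := by
    match L, L' with
    | [], [] => exact innerForm_smul X c f
    | [], _ :: _ => exact (smul_zero _).symm
    | [_], _ => exact (smul_zero _).symm
    | _ :: _ :: _, _ => exact (smul_zero _).symm
  symm ns L m n f g L' _ _ _ := by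
    match L with
    | [] => exact (smul_zero _).symm
    | [_] => exact (smul_zero _).symm
    | _ :: _ :: _ => exact (smul_zero _).symm
  leibniz ns L m n f g hL hf hg := by
    match ns, L, hL with
    | [], [], _ =>
      obtain rfl | ⟨m, rfl, hf⟩ := hf
      · change innerForm X (0 * g) = innerForm X 0 * g + _ • (0 * _)
        rw [zero_mul, (isDeg_zero 0).innerForm_eq_zero]; simp
      · change innerForm X (f * g) = innerForm X f * g + _ • (f * innerForm X g)
        rw [innerForm_mul X hf, ← sg_natCast]
        congr 2
        rw [sg, sg]; simp
    | _, [_], _ => change 0 = 0 * g + _ • (f * 0); simp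
    | _, _ :: _ :: _, _ => change 0 = 0 * g + _ • (f * 0); simp
  degree ns L hL := by
    match ns, L, hL with
    | _, [], _ => exact .zero _
    | [n], [f], .cons hf .nil =>
      change HasDeg _ (innerForm X f)
      obtain rfl | ⟨m, rfl, hf⟩ := hf
      · rw [(isDeg_zero 0).innerForm_eq_zero]; exact .zero _
      · cases m with
        | zero => rw [hf.innerForm_eq_zero]; exact .zero _
        | succ m => exact (hf.innerForm X).hasDeg.cast (by simp)
    | _, _ :: _ :: _, _ => exact .zero _

theorem ofBivector_isHom (π : Bivector E F A) : IsHom (-2) (ofBivector π) where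
  map_add L f g L' := by
    match L, L' with
    | [], [] => exact (add_zero _).symm
    | [], [h] => exact π.pair_add_left f g h
    | [], _ :: _ :: _ => exact (add_zero _).symm
    | [h], [] => exact π.pair_add_right h f g
    | [_], _ :: _ => exact (add_zero _).symm
    | [_, _], _ => exact (add_zero _).symm
    | _ :: _ :: _ :: _, _ => exact (add_zero _).symm
  map_smul L c f L' := by
    match L, L' with
    | [], [] => exact (smul_zero _).symm
    | [], [h] => exact π.pair_smul_left c f h
    | [], _ :: _ :: _ => exact (smul_zero _).symm
    | [h], [] => exact π.pair_smul_right c h f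
    | [_], _ :: _ => exact (smul_zero _).symm
    | [_, _], _ => exact (smul_zero _).symm
    | _ :: _ :: _ :: _, _ => exact (smul_zero _).symm
  symm ns L m n f g L' _ hf hg := by
    match L, L' with
    | [], [] => exact π.pair_symm hf hg
    | [], _ :: _ => exact (smul_zero _).symm
    | [_], _ => exact (smul_zero _).symm
    | [_, _], _ => exact (smul_zero _).symm
    | _ :: _ :: _ :: _, _ => exact (smul_zero _).symm
  leibniz ns L m n f g hL hf hg := by
    match ns, L, hL with
    | _, [], _ => change 0 = 0 * g + _ • (f * 0); simp
    | [k], [h], .cons hh .nil =>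
      refine (π.pair_leibniz hh hf g).trans ?_
      change _ = π.pair h f * g + _ • (f * π.pair h g)
      congr 2
      simp only [sg, List.sum_cons, List.sum_nil, Int.even_mul, Int.even_add]
      simp
    | _, [_, _], _ => change 0 = 0 * g + _ • (f * 0); simp
    | _, _ :: _ :: _ :: _, _ => change 0 = 0 * g + _ • (f * 0); simp
  degree ns L hL := by
    match ns, L, hL with
    | _, [], _ => exact .zero _
    | _, [_], _ => exact .zero _
    | [m, n], [f, g], .cons hf (.cons hg .nil) =>
      exact (π.hasDeg_pair hf hg).cast (by simp; ring)
    | _, _ :: _ :: _ :: _, _ => exact .zero _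

theorem ins_ofBivector (π : Bivector E F A) {α : Form E F A} (hα : IsDeg 1 α) :
    ins α (ofBivector π) = -ofSec (π.sharp α) := funext fun L => by
  match L with
  | [] => exact neg_zero.symm
  | [f] => exact π.pair_of_isDeg_one hα f
  | _ :: _ :: _ => exact neg_zero.symm

/-! ### Bidegrees, and rigidity of multiderivations. -/

section FiniteRank

variable [FiniteDimensional ℝ F]

/-- Inserting anything into a form gives zero, so the recursion only moves the other entries into
`u`. The graded symmetry of `u` brings `f` back to the front. -/
theorem bracket_ofForm {d m : ℤ} {u : Symb E F A} (hu : IsHom d u) {f : Form E F A}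
    (hf : HasDeg m f) : bracket u (ofForm f) = ins f u := by
  refine (hu.bracket (ofForm_isHom hf)).toIsMulti.ext (hu.ins hf).toIsMulti fun ns L hL => ?_
  induction hL generalizing u d with
  | nil =>
    rw [bracket_nil hu (ofForm_isHom hf)]
    change u [f] - _ • 0 = u [f]
    rw [smul_zero, sub_zero]
  | @cons p g ns L hg hL ih =>
    rw [bracket_cons hu.toIsMulti (ofForm_isHom hf) hg, ih (hu.ins hg)]
    have h : ins g (ofForm f) = 0 := rfl
    rw [h, bracket_zero_right hu.toIsMulti]
    change 0 + sg (m * p) • u (g :: f :: L) = u (f :: g :: L)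
    rw [zero_add]
    exact (hu.symm [] [] m p f g L .nil hf hg).symm

theorem IsHom.leibniz_single {d m : ℤ} {u : Symb E F A} (hu : IsHom d u) {f : Form E F A}
    (hf : HasDeg m f) (g : Form E F A) :
    u [f * g] = u [f] * g + sg (d * m) • (f * u [g]) := by
  induction g using form_induction with
  | hadd a b ha hb =>
    simp only [mul_add, hu.single_add, ha, hb, smul_add]; abel
  | hh n a ha => simpa using hu.leibniz [] [] m n f a .nil hf ha.hasDeg

/-- The Leibniz signs agree because `q - k` and `k + q` have the same parity; `degree_neg` holds
because no nonzero form has negative degree. -/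
theorem IsHom.isBidegree {k q : ℕ} {d : ℤ} {u : Symb E F A} (hu : IsHom d u)
    (hk : HasArity k u) (hd : d = q - k) : IsBidegree k q u where
  arity L hL := hk L (by exact_mod_cast hL)
  map_add := hu.map_add
  map_smul := hu.map_smul
  symm L m n f g L' hf hg := by
    refine list_induction (Q := fun L => u (L ++ f :: g :: L') =
      (-1 : ℝ) ^ (m * n) • u (L ++ g :: f :: L')) (fun L a b K h1 h2 => ?_)
      (fun ns L hL => ?_) L
    · simp only [List.append_assoc, List.cons_append] at h1 h2 ⊢
      rw [hu.map_add, hu.map_add, h1, h2, smul_add]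
    · rw [hu.symm ns L m n f g L' hL hf.hasDeg hg.hasDeg, ← Nat.cast_mul, sg_natCast]
  leibniz L ns n f g hL hf := by
    have hL' : List.Forall₂ HasDeg (ns.map (Nat.cast : ℕ → ℤ)) L := by
      rw [List.forall₂_map_left_iff]
      exact hL.imp fun _ _ h => h.hasDeg
    induction g using form_induction with
    | hadd a b ha hb =>
      rw [mul_add, hu.map_add L _ _ [], hu.map_add L _ _ [], ha, hb, mul_add, mul_add, smul_add]
      abel
    | hh p a ha =>
      rw [hu.leibniz _ L n p f a hL' hf.hasDeg ha.hasDeg, ← sg_natCast]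
      congr 2
      have e : (ns.map (Nat.cast : ℕ → ℤ)).sum = (ns.sum : ℕ) := by
        rw [Nat.cast_list_sum]
      rw [e]
      simp only [sg, hd]
      push_cast
      simp only [Int.even_mul, Int.even_add, Int.even_sub]
      congr 1
      simp only [eq_iff_iff]
      tauto
  degree L ns m hL h := by
    have hL' : List.Forall₂ HasDeg (ns.map (Nat.cast : ℕ → ℤ)) L := by
      rw [List.forall₂_map_left_iff]
      exact hL.imp fun _ _ h => h.hasDeg
    refine ((hu.degree _ L hL').cast ?_).isDeg
    rw [← Nat.cast_list_sum, hd]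
    omega
  degree_neg L ns hL h := by
    have hL' : List.Forall₂ HasDeg (ns.map (Nat.cast : ℕ → ℤ)) L := by
      rw [List.forall₂_map_left_iff]
      exact hL.imp fun _ _ h => h.hasDeg
    refine (hu.degree _ L hL').eq_zero ?_
    rw [← Nat.cast_list_sum, hd]
    omega

/-- Zero is homogeneous of every integral degree and so may carry no natural one. In that
alternative multilinearity settles matters. -/
theorem forall₂_hasDeg {ns : List ℤ} {L : List (Form E F A)} (h : List.Forall₂ HasDeg ns L) :
    (0 : Form E F A) ∈ L ∨ ∃ ms : List ℕ, List.Forall₂ IsDeg ms L ∧ (ms.sum : ℤ) = ns.sum := by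
  induction h with
  | nil => exact Or.inr ⟨[], .nil, by simp⟩
  | @cons n f ns L hf _ ih =>
    obtain rfl | ⟨m, rfl, hf⟩ := hf
    · exact Or.inl List.mem_cons_self
    obtain h | ⟨ms, h1, h2⟩ := ih
    · exact Or.inl (List.mem_cons_of_mem _ h)
    · exact Or.inr ⟨m :: ms, .cons hf h1, by
        rw [List.sum_cons, List.sum_cons, ← h2]; push_cast; rfl⟩

theorem IsBidegree.hasArity {k q : ℕ} {u : Symb E F A} (hu : IsBidegree k q u) :
    HasArity k u := fun L hL => hu.arity L (by exact_mod_cast hL)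

theorem IsBidegree.isHom {k q : ℕ} {u : Symb E F A} (hu : IsBidegree k q u) :
    IsHom (q - k) u where
  map_add := hu.map_add
  map_smul := hu.map_smul
  symm ns L m n f g L' hL hf hg := by
    have hm : IsMulti u := ⟨hu.map_add, hu.map_smul⟩
    obtain rfl | ⟨m, rfl, hf⟩ := hf
    · rw [hm.map_eq_zero_of_mem (by simp), hm.map_eq_zero_of_mem (by simp), smul_zero]
    obtain rfl | ⟨n, rfl, hg⟩ := hg
    · rw [hm.map_eq_zero_of_mem (by simp), hm.map_eq_zero_of_mem (by simp), smul_zero]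
    rw [hu.symm L m n f g L' hf hg, ← Nat.cast_mul, sg_natCast]
  leibniz ns L m n f g hL hf hg := by
    have hm : IsMulti u := ⟨hu.map_add, hu.map_smul⟩
    obtain rfl | ⟨m, rfl, hf⟩ := hf
    · rw [zero_mul, hm.map_eq_zero_of_mem (by simp)]; simp
    obtain h | ⟨ms, h1, h2⟩ := forall₂_hasDeg hL
    · rw [hm.map_eq_zero_of_mem (by simp [h]), hm.map_eq_zero_of_mem (by simp [h]),
        hm.map_eq_zero_of_mem (by simp [h])]
      simp
    rw [hu.leibniz L ms m f g h1 hf, ← sg_natCast, ← h2]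
    congr 2
    simp only [sg]
    push_cast
    simp only [Int.even_mul, Int.even_add, Int.even_sub]
    congr 1
    simp only [eq_iff_iff]
    tauto
  degree ns L hL := by
    have hm : IsMulti u := ⟨hu.map_add, hu.map_smul⟩
    obtain h | ⟨ms, h1, h2⟩ := forall₂_hasDeg hL
    · rw [hm.map_eq_zero_of_mem h]; exact .zero _
    by_cases h : ms.sum + q < k
    · rw [hu.degree_neg L ms h1 h]; exact .zero _
    · exact (hu.degree L ms (ms.sum + q - k) h1 (by omega)).hasDeg.cast (by omega)

/-- The Leibniz rule is imposed on the last entry only; graded symmetry carries the first entry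
there at the cost of a nonzero sign. -/
theorem IsHom.cons_eq_zero_iff {d m : ℤ} {u : Symb E F A} (hu : IsHom d u) {f : Form E F A}
    (hf : HasDeg m f) {ns : List ℤ} {L : List (Form E F A)} (hL : List.Forall₂ HasDeg ns L) :
    u (f :: L) = 0 ↔ u (L ++ [f]) = 0 := by
  induction hL generalizing u d with
  | nil => rfl
  | @cons n g ns L hg _ ih =>
    have h := hu.symm [] [] m n f g L .nil hf hg
    have h0 : sg (m * n) ≠ 0 := by unfold sg; split_ifs <;> norm_num
    rw [List.nil_append, List.nil_append] at h
    rw [h, smul_eq_zero, or_iff_right h0]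
    exact ih (hu.ins hg)

variable [FiniteDimensional ℝ E] [IsManifold 𝓘(ℝ, E) ∞ M] [T2Space M]
  [ContMDiffVectorBundle ∞ F A 𝓘(ℝ, E)]

/-- A multiderivation is determined by its values on functions and `1`-forms. -/
theorem IsHom.ins_eq_zero {d : ℤ} {u : Symb E F A} (hu : IsHom d u)
    (h0 : ∀ f, IsDeg 0 f → BigBracket.ins f u = 0) (h1 : ∀ f, IsDeg 1 f → BigBracket.ins f u = 0)
    (f : Form E F A) : BigBracket.ins f u = 0 := by
  induction f using form_induction with
  | hadd a b ha hb => rw [hu.ins_add, ha, hb, add_zero]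
  | hh n a ha =>
    refine (hu.toIsMulti.ins a).ext ((hu.toIsMulti.ins a).smul 0 |> fun h => by
      rwa [zero_smul] at h) fun ns L hL => ?_
    change u (a :: L) = 0
    rw [hu.cons_eq_zero_iff ha.hasDeg hL]
    -- With the other entries fixed and homogeneous, the last slot is a graded derivation, to which
    -- `derivation_eq_zero` applies.
    let D : Form E F A →ₗ[ℝ] Form E F A :=
      { toFun := fun f => u (L ++ [f])
        map_add' := fun f g => hu.map_add L f g []
        map_smul' := fun c f => hu.map_smul L c f [] }
    have : D = 0 := derivation_eq_zero D (fun n => sg ((d + ns.sum) * n)) (by simp [sg])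
      (fun n f g hf => by
        induction g using form_induction with
        | hadd a b ha hb => rw [mul_add, map_add, map_add, ha, hb, mul_add, mul_add, smul_add]; abel
        | hh p a ha => exact hu.leibniz ns L n p f a hL hf.hasDeg ha.hasDeg)
      (fun f hf => (hu.cons_eq_zero_iff hf.hasDeg hL).1 (congrFun (h0 f hf) L))
      (fun f hf => (hu.cons_eq_zero_iff hf.hasDeg hL).1 (congrFun (h1 f hf) L))
    exact DFunLike.congr_fun this a

theorem IsHom.eq_zero {d : ℤ} {u : Symb E F A} (hu : IsHom d u) (hn : u [] = 0)
    (h0 : ∀ f, IsDeg 0 f → BigBracket.ins f u = 0)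
    (h1 : ∀ f, IsDeg 1 f → BigBracket.ins f u = 0) : u = 0 := funext fun L => by
  cases L with
  | nil => exact hn
  | cons f L => exact congrFun (hu.ins_eq_zero h0 h1 f) L

theorem IsHom.eq_zero_of_arity_one {d : ℤ} {u : Symb E F A} (hu : IsHom d u) (hk : HasArity 1 u)
    (h0 : ∀ f, IsDeg 0 f → u [f] = 0) (h1 : ∀ f, IsDeg 1 f → u [f] = 0) : u = 0 := by
  have key : ∀ f, u [f] = 0 → BigBracket.ins f u = 0 := fun f h => funext fun L => by
    cases L with
    | nil => exact h
    | cons g L => exact hk _ (by simp; omega)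
  exact hu.eq_zero (hk _ (by simp)) (fun f hf => key f (h0 f hf)) fun f hf => key f (h1 f hf)

/-- There are no functions of negative bidegree. -/
theorem IsHom.eq_zero_of_neg {d : ℤ} {k : ℕ} {u : Symb E F A} (hu : IsHom d u)
    (hk : HasArity k u) (hd : d + k < 0) : u = 0 := by
  induction k generalizing u d with
  | zero =>
    funext L
    cases L with
    | nil => exact hu.degree_nil.eq_zero (by simpa using hd)
    | cons => exact hk _ (by simp; omega)
  | succ k ih =>
    have hk' : ∀ f, HasArity k (BigBracket.ins f u) := fun f => by
      have := hk.ins f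
      rwa [Nat.cast_succ, add_sub_cancel_right] at this
    push_cast at hd
    -- The sum `d + k` is the second component of the bidegree. Inserting a function lowers it by
    -- one and a `1`-form preserves it, so it stays negative.
    exact hu.eq_zero (hk _ (by simp; omega)) (fun f hf => ih (hu.ins hf.hasDeg) (hk' f)
      (by push_cast; omega)) fun f hf => ih (hu.ins hf.hasDeg) (hk' f) (by push_cast; omega)

theorem ofSec_injective : Function.Injective (ofSec : Sec E F A → Symb E F A) :=
  fun _ _ h => sec_ext fun f _ => congrFun h [f]

/-- For degree reasons `u` kills functions, so it is linear over functions and on `1`-forms is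
contraction with a section `X`. The difference of `u` and `X` kills functions and `1`-forms. This
shows that the default value in `toSec` is not used here. -/
theorem IsHom.ofSec_toSec {u : Symb E F A} (hu : IsHom (-1) u) (hk : HasArity 1 u) :
    ofSec (toSec u) = u := by
  have h : ∃ X, ofSec X = u := by
    have hz : ∀ f, IsDeg 0 f → u [f] = 0 := fun f hf =>
      (hu.degree_single hf.hasDeg).eq_zero (by simp)
    let D : Form E F A →ₗ[ℝ] Form E F A :=
      { toFun := fun f => u [f], map_add' := hu.single_add, map_smul' := hu.single_smul }
    obtain ⟨X, hX⟩ := exists_sec D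
      (fun g f => by
        change u [fnForm g * f] = fnForm g * u [f]
        rw [hu.leibniz_single (isDeg_fnForm g).hasDeg, hz _ (isDeg_fnForm g)]
        simp [sg])
      (fun f hf => ((hu.degree_single hf.hasDeg).cast (by simp) : HasDeg (0 : ℕ) (u [f])).isDeg)
    refine ⟨X, sub_eq_zero.1 ?_⟩
    rw [sub_eq_add_neg]
    refine ((ofSec_isHom X).add hu.neg).eq_zero_of_arity_one
      ((ofSec_hasArity X).add hk.neg) (fun f hf => ?_) fun f hf => ?_
    · change innerForm X f + -u [f] = 0
      rw [hz f hf, hf.innerForm_eq_zero, neg_zero, add_zero]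
    · change innerForm X f + -u [f] = 0
      rw [hX f hf]
      exact add_neg_cancel _
  rw [toSec, dif_pos h]
  exact h.choose_spec

end FiniteRank

end SymbExamples

/-! ### Derived brackets. -/

section DerivedBracket

variable {E : Type*} [NormedAddCommGroup E] [NormedSpace ℝ E]
  {M : Type*} [TopologicalSpace M] [ChartedSpace E M]
  {F : Type*} [NormedAddCommGroup F] [NormedSpace ℝ F]
  {A : M → Type*} [TopologicalSpace (Bundle.TotalSpace F A)]
  [∀ x, AddCommGroup (A x)] [∀ x, Module ℝ (A x)] [∀ x, TopologicalSpace (A x)]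
  [FiberBundle F A] [VectorBundle ℝ F A]

theorem innerForm_comm (X Y : Sec E F A) (f : Form E F A) :
    innerForm X (innerForm Y f) = -innerForm Y (innerForm X f) := form_ext fun x => by
  have h := LinearMap.congr_fun (intProd_inner (X x + Y x)) (f.1 x)
  have h1 := LinearMap.congr_fun (intProd_inner (X x)) (f.1 x)
  have h2 := LinearMap.congr_fun (intProd_inner (Y x)) (f.1 x)
  simp only [Module.End.mul_apply, map_add, LinearMap.add_apply, LinearMap.zero_apply] at h h1 h2
  rw [h1, h2, zero_add, add_zero] at h
  exact eq_neg_of_add_eq_zero_right h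

theorem innerForm_fnForm_mul (X : Sec E F A) (g : Fn E M) (f : Form E F A) :
    innerForm X (fnForm g * f) = fnForm g * innerForm X f := by
  rw [innerForm_mul X (isDeg_fnForm g), (isDeg_fnForm g).innerForm_eq_zero]
  simp

theorem fnForm_add (g h : Fn E M) : (fnForm (g + h) : Form E F A) = fnForm g + fnForm h :=
  form_ext fun _ => map_add _ _ _

theorem fnForm_smul (c : ℝ) (g : Fn E M) : (fnForm (c • g) : Form E F A) = c • fnForm g :=
  form_ext fun x => map_smul (Algebra.linearMap ℝ (Ext (A x))) c (g x)

theorem formFn_add (f g : Form E F A) : formFn (f + g) = formFn f + formFn g :=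
  ContMDiffMap.ext fun x => map_add
    (ExteriorAlgebra.algebraMapInv : ExteriorAlgebra ℝ (Module.Dual ℝ (A x)) →ₐ[ℝ] ℝ) (f.1 x)
        (g.1 x)

theorem formFn_smul (c : ℝ) (f : Form E F A) : formFn (c • f) = c • formFn f :=
  ContMDiffMap.ext fun x => map_smul
    (ExteriorAlgebra.algebraMapInv : ExteriorAlgebra ℝ (Module.Dual ℝ (A x)) →ₐ[ℝ] ℝ) c (f.1 x)

theorem formFn_fnForm_mul (g : Fn E M) (f : Form E F A) :
    formFn (fnForm g * f) = g * formFn f := ContMDiffMap.ext fun x => by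
  refine (map_mul (ExteriorAlgebra.algebraMapInv (R := ℝ) (M := Module.Dual ℝ (A x)))
    (algebraMap ℝ _ (g x)) (f.1 x)).trans ?_
  rw [ExteriorAlgebra.algebraMap_leftInverse]
  rfl

theorem symb_ext_arity_one {u v : Symb E F A} (hu : HasArity 1 u) (hv : HasArity 1 v)
    (h : ∀ f, u [f] = v [f]) : u = v := funext fun L => by
  match L with
  | [] => rw [hu _ (by simp), hv _ (by simp)]
  | [f] => exact h f
  | _ :: _ :: _ => rw [hu _ (by simp; omega), hv _ (by simp; omega)]

theorem HasArity.eq_ofForm {u : Symb E F A} (hu : HasArity 0 u) : u = ofForm (u []) :=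
  funext fun L => by
    cases L with
    | nil => rfl
    | cons f L => exact hu _ (by simp; omega)

theorem ofForm_neg (f : Form E F A) : ofForm (-f) = -ofForm f := funext fun L => by
  cases L with
  | nil => rfl
  | cons f L => exact neg_zero.symm

theorem ofSec_add (X Y : Sec E F A) : ofSec (X + Y) = ofSec X + ofSec Y :=
  symb_ext_arity_one (ofSec_hasArity _) ((ofSec_hasArity _).add (ofSec_hasArity _)) fun f =>
    form_ext fun x => by
      change intProd (X x + Y x) (f.1 x) = intProd (X x) (f.1 x) + intProd (Y x) (f.1 x)
      rw [map_add, LinearMap.add_apply]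

theorem HasArity.smul {k : ℤ} (c : ℝ) {u : Symb E F A} (hu : HasArity k u) :
    HasArity k (c • u) := fun L hL => by rw [symb_smul_apply, hu L hL, smul_zero]

theorem ofSec_smul (c : ℝ) (X : Sec E F A) : ofSec (c • X) = c • ofSec X :=
  symb_ext_arity_one (ofSec_hasArity _) ((ofSec_hasArity _).smul c) fun f =>
    form_ext fun x => by
      change intProd (c • X x) (f.1 x) = c • intProd (X x) (f.1 x)
      rw [map_smul, LinearMap.smul_apply]

theorem ofSec_neg (X : Sec E F A) : ofSec (-X) = -ofSec X := by
  rw [← neg_one_smul ℝ X, ofSec_smul, neg_one_smul]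

theorem ofSec_sub (X Y : Sec E F A) : ofSec (X - Y) = ofSec X - ofSec Y := by
  rw [sub_eq_add_neg, ofSec_add, ofSec_neg, sub_eq_add_neg]

theorem ofSec_fnSmul_apply (g : Fn E M) (X : Sec E F A) (f : Form E F A) :
    ofSec (fnSmul g X) [f] = fnForm g * ofSec X [f] := innerForm_fnSmul g X f

section FiniteRank

variable [FiniteDimensional ℝ F]

theorem bracket_jacobi_even {d₁ d₂ d₃ : ℤ} {u v w : Symb E F A} (hu : IsHom d₁ u)
    (hv : IsHom d₂ v) (hw : IsHom d₃ w) (h : Even (d₁ * d₂)) :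
    bracket u (bracket v w) = bracket (bracket u v) w + bracket v (bracket u w) := by
  rw [bracket_jacobi hu hv hw, sg_of_even h, one_smul]

theorem bracket_jacobi_odd {d₁ d₂ d₃ : ℤ} {u v w : Symb E F A} (hu : IsHom d₁ u)
    (hv : IsHom d₂ v) (hw : IsHom d₃ w) (h : ¬Even (d₁ * d₂)) :
    bracket u (bracket v w) = bracket (bracket u v) w - bracket v (bracket u w) := by
  rw [bracket_jacobi hu hv hw, sg_of_not_even h, neg_one_smul, sub_eq_add_neg]

theorem bracket_antisymm_even {d d' : ℤ} {u v : Symb E F A} (hu : IsHom d u) (hv : IsHom d' v)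
    (h : Even (d * d')) : bracket u v = -bracket v u := by
  rw [bracket_antisymm hu hv, sg_of_even h, one_smul]

theorem bracket_symm_odd {d d' : ℤ} {u v : Symb E F A} (hu : IsHom d u) (hv : IsHom d' v)
    (h : ¬Even (d * d')) : bracket u v = bracket v u := by
  rw [bracket_antisymm hu hv, sg_of_not_even h, neg_one_smul, neg_neg]

/-- The bracket of derivations is their graded commutator. -/
theorem bracket_single_of_arity_one {d d' : ℤ} {u v : Symb E F A} (hu : IsHom d u)
    (hv : IsHom d' v) (ku : HasArity 1 u) (kv : HasArity 1 v) (f : Form E F A) :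
    bracket u v [f] = u [v [f]] - sg (d * d') • v [u [f]] := by
  induction f using form_induction with
  | hadd a b ha hb =>
    have h := (hu.bracket hv).single_add a b
    rw [h, ha, hb, hu.single_add, hv.single_add, hu.single_add, hv.single_add, smul_add]
    abel
  | hh n a ha =>
    rw [bracket_single hu hv ha.hasDeg, kv [a, u []] (by simp), ku [a, v []] (by simp)]
    by_cases h1 : Even d <;> by_cases h2 : Even d' <;> by_cases h3 : Even (n : ℤ) <;>
      simp [sg, Int.even_add, Int.even_mul, h1, h2, h3, sub_eq_add_neg]

theorem bracket_ofSec_ofForm (X : Sec E F A) {m : ℤ} {f : Form E F A} (hf : HasDeg m f) :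
    bracket (ofSec X) (ofForm f) = ofForm (innerForm X f) := by
  rw [bracket_ofForm (ofSec_isHom X) hf]
  exact HasArity.eq_ofForm ((ofSec_hasArity X).ins f)

variable [FiniteDimensional ℝ E] [IsManifold 𝓘(ℝ, E) ∞ M] [T2Space M]
  [ContMDiffVectorBundle ∞ F A 𝓘(ℝ, E)]

theorem bracket_ofSec_ofSec (X Y : Sec E F A) : bracket (ofSec X) (ofSec Y) = 0 :=
  ((ofSec_isHom X).bracket (ofSec_isHom Y)).eq_zero_of_neg (k := 1)
    ((ofSec_hasArity X).bracket (ofSec_hasArity Y) (ofSec_isHom X).toIsMulti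
      (ofSec_isHom Y).toIsMulti) (by norm_num)

theorem bracket_ofSec_ofBivector (X : Sec E F A) (π : Bivector E F A) :
    bracket (ofSec X) (ofBivector π) = 0 :=
  ((ofSec_isHom X).bracket (ofBivector_isHom π)).eq_zero_of_neg (k := 2)
    ((ofSec_hasArity X).bracket (ofBivector_hasArity π) (ofSec_isHom X).toIsMulti
      (ofBivector_isHom π).toIsMulti) (by norm_num)

/-! ### Elements of bidegree `(1, 2)` and Lie algebroid brackets. -/

section Structure

variable {ν : Symb E F A}

theorem isHom_bracket_ofSec (hν : IsHom 1 ν) (X : Sec E F A) : IsHom 0 (bracket (ofSec X) ν) :=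
  (ofSec_isHom X).bracket hν

theorem hasArity_bracket_ofSec (hν : IsHom 1 ν) (kν : HasArity 1 ν) (X : Sec E F A) :
    HasArity 1 (bracket (ofSec X) ν) :=
  (ofSec_hasArity X).bracket kν (ofSec_isHom X).toIsMulti hν.toIsMulti

theorem ofSec_lieBr (hν : IsHom 1 ν) (kν : HasArity 1 ν) (X Y : Sec E F A) :
    ofSec (lieBr ν X Y) = bracket (bracket (ofSec X) ν) (ofSec Y) :=
  ((isHom_bracket_ofSec hν X).bracket (ofSec_isHom Y)).ofSec_toSec
    ((hasArity_bracket_ofSec hν kν X).bracket (ofSec_hasArity Y)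
      (isHom_bracket_ofSec hν X).toIsMulti (ofSec_isHom Y).toIsMulti)

theorem bracket_ofSec_fnForm (hν : IsHom 1 ν) (kν : HasArity 1 ν) (X : Sec E F A) (g : Fn E M) :
    bracket (ofSec X) ν [fnForm g] = innerForm X (ν [fnForm g]) := by
  rw [bracket_single_of_arity_one (ofSec_isHom X) hν (ofSec_hasArity X) kν]
  change innerForm X _ - _ • ν [innerForm X (fnForm g)] = _
  rw [(isDeg_fnForm g).innerForm_eq_zero, hν.single_zero, smul_zero, sub_zero]

theorem fnForm_anchor (hν : IsHom 1 ν) (X : Sec E F A) (g : Fn E M) :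
    (fnForm (anchor ν X g) : Form E F A) = bracket (ofSec X) ν [fnForm g] := by
  have h := isHom_bracket_ofSec hν X
  rw [anchor, bracket_ofForm h (isDeg_fnForm g).hasDeg]
  exact (((h.degree_single (isDeg_fnForm g).hasDeg).cast (by simp) :
    HasDeg (0 : ℕ) (bracket (ofSec X) ν [fnForm g])).isDeg).fnForm_formFn

theorem ofForm_anchor (hν : IsHom 1 ν) (kν : HasArity 1 ν) (X : Sec E F A) (g : Fn E M) :
    ofForm (fnForm (anchor ν X g)) = bracket (bracket (ofSec X) ν) (ofForm (fnForm g)) := by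
  rw [fnForm_anchor hν, bracket_ofForm (isHom_bracket_ofSec hν X) (isDeg_fnForm g).hasDeg]
  exact (HasArity.eq_ofForm ((hasArity_bracket_ofSec hν kν X).ins _)).symm

theorem anchor_eq (hν : IsHom 1 ν) (kν : HasArity 1 ν) (X : Sec E F A) (g : Fn E M) :
    anchor ν X g = formFn (innerForm X (ν [fnForm g])) := by
  rw [← bracket_ofSec_fnForm hν kν, ← fnForm_anchor hν, formFn_fnForm]

theorem bracket_ofSec_bracket_self (hν : IsHom 1 ν) (X : Sec E F A) :
    bracket (ofSec X) (bracket ν ν) = (2 : ℝ) • bracket (bracket (ofSec X) ν) ν := by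
  rw [bracket_jacobi_odd (ofSec_isHom X) hν hν (by decide),
    bracket_antisymm_even hν (isHom_bracket_ofSec hν X) (by decide), two_smul, sub_neg_eq_add]

/-- The Jacobiator of the derived bracket. -/
theorem ofSec_jacobiator (hν : IsHom 1 ν) (kν : HasArity 1 ν) (X Y Z : Sec E F A) :
    (2 : ℝ) • ofSec (lieBr ν X (lieBr ν Y Z) - lieBr ν (lieBr ν X Y) Z - lieBr ν Y (lieBr ν X Z)) =
      bracket (bracket (ofSec Y) (bracket (ofSec X) (bracket ν ν))) (ofSec Z) := by
  have hX := isHom_bracket_ofSec hν X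
  have hY := isHom_bracket_ofSec hν Y
  simp only [ofSec_sub, ofSec_lieBr hν kν]
  rw [bracket_ofSec_bracket_self hν, bracket_smul_right _ (ofSec_isHom Y).toIsMulti,
    bracket_smul_left _ _ (ofSec_isHom Z).toIsMulti,
    bracket_jacobi_even hX hY (ofSec_isHom Z) (by decide),
    bracket_jacobi_even hX (ofSec_isHom Y) hν (by decide),
    bracket_add_left _ _ (ofSec_isHom Z).toIsMulti]
  congr 1
  abel

/-- Since `{X, Y} = 0`, the Jacobi identity moves `X` across: `{{X, ν}, Y} = {X, {ν, Y}}`. No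
condition on `{ν, ν}` enters. -/
theorem lieBr_skew (hν : IsHom 1 ν) (kν : HasArity 1 ν) (X Y : Sec E F A) :
    lieBr ν X Y = -lieBr ν Y X := by
  apply ofSec_injective
  rw [ofSec_neg, ofSec_lieBr hν kν, ofSec_lieBr hν kν]
  have h := bracket_jacobi_odd (ofSec_isHom X) hν (ofSec_isHom Y) (by decide)
  rw [bracket_ofSec_ofSec, bracket_zero_right hν.toIsMulti, sub_zero,
    bracket_symm_odd hν (ofSec_isHom Y) (by decide)] at h
  rw [← h, bracket_antisymm_even (ofSec_isHom X) (isHom_bracket_ofSec hν Y) (by decide)]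

/-- Both `S` and `Z` act as derivations and their bracket is a commutator, so `{S, g Z} = S(g) Z + g
{S, Z}`. -/
theorem bracket_ofSec_fnSmul {S : Symb E F A} (hS : IsHom 0 S) (kS : HasArity 1 S) (g : Fn E M)
    (Z : Sec E F A) (f : Form E F A) :
    bracket S (ofSec (fnSmul g Z)) [f] =
      S [fnForm g] * innerForm Z f + fnForm g * bracket S (ofSec Z) [f] := by
  rw [bracket_single_of_arity_one hS (ofSec_isHom _) kS (ofSec_hasArity _),
    bracket_single_of_arity_one hS (ofSec_isHom _) kS (ofSec_hasArity _), ofSec_fnSmul_apply,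
    ofSec_fnSmul_apply, hS.leibniz_single (isDeg_fnForm g).hasDeg, sg_of_even (by simp),
    sg_of_even (by simp)]
  simp only [one_smul, mul_sub]
  change _ * ofSec Z [f] + _ - _ = _ * ofSec Z [f] + _
  abel

theorem lieBr_leibniz (hν : IsHom 1 ν) (kν : HasArity 1 ν) (X : Sec E F A) (g : Fn E M)
    (Y : Sec E F A) :
    lieBr ν X (fnSmul g Y) = fnSmul g (lieBr ν X Y) + fnSmul (anchor ν X g) Y := by
  refine sec_ext fun f _ => ?_
  change ofSec (lieBr ν X (fnSmul g Y)) [f] =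
    ofSec (fnSmul g (lieBr ν X Y) + fnSmul (anchor ν X g) Y) [f]
  rw [ofSec_add, symb_add_apply, ofSec_fnSmul_apply, ofSec_fnSmul_apply, ofSec_lieBr hν kν,
    ofSec_lieBr hν kν, bracket_ofSec_fnSmul (isHom_bracket_ofSec hν X)
      (hasArity_bracket_ofSec hν kν X), fnForm_anchor hν, add_comm]
  rfl

/-- Only the Jacobi identity uses `{ν, ν} = 0`; the other axioms hold for every `ν` of this degree
and arity. -/
theorem isLieAlgebroidBracket_of_bracket_self (hν : IsHom 1 ν) (kν : HasArity 1 ν)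
    (h : bracket ν ν = 0) :
    IsLieAlgebroidBracket (lieBr ν) (anchor ν) where
  add_right X Y Z := ofSec_injective (by
    rw [ofSec_add, ofSec_lieBr hν kν, ofSec_lieBr hν kν, ofSec_lieBr hν kν, ofSec_add,
      bracket_add_right (isHom_bracket_ofSec hν X).toIsMulti])
  smul_right c X Y := ofSec_injective (by
    rw [ofSec_smul, ofSec_lieBr hν kν, ofSec_lieBr hν kν, ofSec_smul,
      bracket_smul_right _ (isHom_bracket_ofSec hν X).toIsMulti])
  skew := lieBr_skew hν kν
  jacobi X Y Z := by
    have h1 := ofSec_jacobiator hν kν X Y Z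
    rw [h, bracket_zero_right (ofSec_isHom X).toIsMulti,
      bracket_zero_right (ofSec_isHom Y).toIsMulti, bracket_zero_left (ofSec_isHom Z).toIsMulti,
      ← ofSec_smul] at h1
    have h2 : ofSec (0 : Sec E F A) = 0 := by
      have := ofSec_smul 0 (0 : Sec E F A)
      rwa [zero_smul, zero_smul] at this
    have h3 := (smul_eq_zero.1 (ofSec_injective (h1.trans h2.symm))).resolve_left two_ne_zero
    rw [sub_sub, sub_eq_zero] at h3
    exact h3
  anchor_map_add X g h := by
    simp only [anchor_eq hν kν, fnForm_add, hν.single_add, innerForm_add, formFn_add]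
  anchor_map_smul X c g := by
    simp only [anchor_eq hν kν, fnForm_smul, hν.single_smul, innerForm_smul, formFn_smul]
  anchor_map_mul X g h := by
    simp only [anchor_eq hν kν, ← fnForm_mul_fnForm]
    rw [hν.leibniz_single (isDeg_fnForm g).hasDeg, sg_of_even (by simp), one_smul,
      ← fnForm_mul_comm, innerForm_add, innerForm_fnForm_mul, innerForm_fnForm_mul, formFn_add,
      formFn_fnForm_mul, formFn_fnForm_mul]
    ring
  anchor_add X Y g := by
    simp only [anchor_eq hν kν, ← formFn_add]
    congr 1
    exact congrFun (ofSec_add X Y) [ν [fnForm g]]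
  anchor_fnSmul h X g := by
    simp only [anchor_eq hν kν, innerForm_fnSmul, formFn_fnForm_mul]
  leibniz := lieBr_leibniz hν kν

/-- The Jacobiator only shows that `S = {Y, {X, T}}`, with `T = {ν, ν}`, brackets to zero with every
section. Recovering `T = 0` means undoing the contractions on functions and on `1`-forms. -/
theorem bracket_self_of_jacobi (hν : IsHom 1 ν) (kν : HasArity 1 ν)
    (h : ∀ X Y Z, lieBr ν X (lieBr ν Y Z) =
      lieBr ν (lieBr ν X Y) Z + lieBr ν Y (lieBr ν X Z)) : bracket ν ν = 0 := by
  have hT := hν.bracket hν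
  have kT : HasArity 1 (bracket ν ν) := kν.bracket kν hν.toIsMulti hν.toIsMulti
  generalize hTdef : bracket ν ν = T at hT kT
  have hW := fun X : Sec E F A => (ofSec_isHom X).bracket hT
  have kW : ∀ X : Sec E F A, HasArity 1 (bracket (ofSec X) T) := fun X =>
    (ofSec_hasArity X).bracket kT (ofSec_isHom X).toIsMulti hT.toIsMulti
  have hS : ∀ X Y : Sec E F A, IsHom 0 (bracket (ofSec Y) (bracket (ofSec X) T)) := fun X Y =>
    (ofSec_isHom Y).bracket (hW X)
  have kS : ∀ X Y : Sec E F A, HasArity 1 (bracket (ofSec Y) (bracket (ofSec X) T)) := fun X Y =>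
    (ofSec_hasArity Y).bracket (kW X) (ofSec_isHom Y).toIsMulti (hW X).toIsMulti
  have hSZ : ∀ X Y Z : Sec E F A,
      bracket (bracket (ofSec Y) (bracket (ofSec X) T)) (ofSec Z) = 0 := by
    intro X Y Z
    have h1 := ofSec_jacobiator hν kν X Y Z
    rw [hTdef, h, sub_sub, sub_self, ← ofSec_smul, smul_zero] at h1
    rw [← h1]
    have := ofSec_smul 0 (0 : Sec E F A)
    rwa [zero_smul, zero_smul] at this
  have hW1 : ∀ (X : Sec E F A) f, T [innerForm X f] = 0 →
      bracket (ofSec X) T [f] = innerForm X (T [f]) := by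
    intro X f hf
    rw [bracket_single_of_arity_one (ofSec_isHom X) hT (ofSec_hasArity X) kT]
    change innerForm X (T [f]) - _ • T [innerForm X f] = _
    rw [hf, smul_zero, sub_zero]
  have hS1 : ∀ (X Y : Sec E F A) f, T [innerForm X f] = 0 → T [innerForm Y f] = 0 →
      T [innerForm X (innerForm Y f)] = 0 →
      bracket (ofSec Y) (bracket (ofSec X) T) [f] = innerForm Y (innerForm X (T [f])) := by
    intro X Y f h1 h2 h3
    rw [bracket_single_of_arity_one (ofSec_isHom Y) (hW X) (ofSec_hasArity Y) (kW X)]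
    change innerForm Y (bracket (ofSec X) T [f]) - _ • bracket (ofSec X) T [innerForm Y f] = _
    rw [hW1 X f h1, hW1 X _ h3, h2, (isDeg_zero 0).innerForm_eq_zero, smul_zero, sub_zero]
  have T0 : ∀ f, IsDeg 0 f → T [f] = 0 := by
    intro f hf
    obtain ⟨g, rfl⟩ : ∃ g, fnForm g = f := ⟨_, hf.fnForm_formFn⟩
    have hd : IsDeg 2 (T [fnForm g]) := ((hT.degree_single hf.hasDeg).cast (by simp) :
      HasDeg (2 : ℕ) _).isDeg
    refine hd.eq_zero_of_innerForm fun X => (hd.innerForm X).eq_zero_of_innerForm fun Y => ?_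
    have e := hS1 X Y (fnForm g) (by rw [hf.innerForm_eq_zero, hT.single_zero])
      (by rw [hf.innerForm_eq_zero, hT.single_zero])
      (by rw [hf.innerForm_eq_zero, (isDeg_zero 0).innerForm_eq_zero, hT.single_zero])
    -- From `{S, g Y} = 0 = {S, Y}` follows `S(g) Y = 0`. Evaluated on the `1`-form `i_X T(g)`, this
    -- says that the function `S(g) = i_Y i_X T(g)` has square zero.
    have h1 := bracket_ofSec_fnSmul (hS X Y) (kS X Y) g Y (innerForm X (T [fnForm g]))
    rw [hSZ, hSZ, e] at h1
    change 0 = _ + fnForm g * 0 at h1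
    rw [mul_zero, add_zero] at h1
    rw [← ((hd.innerForm X).innerForm Y).fnForm_formFn, fnForm_mul_fnForm] at h1
    have h2 := congrArg formFn h1
    rw [formFn_fnForm] at h2
    rw [← ((hd.innerForm X).innerForm Y).fnForm_formFn]
    refine form_ext fun x => ?_
    have h3 : (0 : ℝ) = formFn (innerForm Y (innerForm X (T [fnForm g]))) x *
        formFn (innerForm Y (innerForm X (T [fnForm g]))) x := by
      refine Eq.trans ?_ (DFunLike.congr_fun h2 x)
      exact (map_zero (ExteriorAlgebra.algebraMapInv :
        ExteriorAlgebra ℝ (Module.Dual ℝ (A x)) →ₐ[ℝ] ℝ)).symm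
    change algebraMap ℝ (Ext (A x)) _ = 0
    rw [mul_self_eq_zero.1 h3.symm, map_zero]
  refine hT.eq_zero_of_arity_one kT T0 fun f hf => ?_
  have hd : IsDeg 3 (T [f]) := ((hT.degree_single hf.hasDeg).cast (by simp) :
    HasDeg (3 : ℕ) _).isDeg
  refine hd.eq_zero_of_innerForm fun X => (hd.innerForm X).eq_zero_of_innerForm fun Y =>
    ((hd.innerForm X).innerForm Y).eq_zero_of_innerForm fun Z => ?_
  have hz : ∀ X Y : Sec E F A, T [innerForm X (innerForm Y f)] = 0 := fun X Y => by
    rw [(hf.innerForm Y).innerForm_eq_zero, hT.single_zero]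
  have e := hS1 X Y f (T0 _ (hf.innerForm X)) (T0 _ (hf.innerForm Y)) (hz X Y)
  have e' := hS1 X Y (innerForm Z f) (hz X Z) (hz Y Z)
    (by rw [(hf.innerForm Z).innerForm_eq_zero, (isDeg_zero 0).innerForm_eq_zero, hT.single_zero])
  -- The commutator is `S(i_Z f) - i_Z S(f)`. Its first term vanishes since `T` kills functions,
  -- which leaves `i_Z i_Y i_X T(f) = 0`.
  have h1 := congrFun (hSZ X Y Z) [f]
  rw [bracket_single_of_arity_one (hS X Y) (ofSec_isHom Z) (kS X Y) (ofSec_hasArity Z)] at h1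
  change bracket (ofSec Y) (bracket (ofSec X) T) [innerForm Z f] - _ • innerForm Z _ = 0 at h1
  rw [e, e', T0 _ (hf.innerForm Z), (isDeg_zero 0).innerForm_eq_zero,
    (isDeg_zero 0).innerForm_eq_zero, zero_sub, sg_of_even (by simp), one_smul, neg_eq_zero] at h1
  exact h1

theorem isLieAlgebroidStructure_iff (hν : IsHom 1 ν) (kν : HasArity 1 ν) :
    IsLieAlgebroidStructure ν ↔ IsLieAlgebroidBracket (lieBr ν) (anchor ν) :=
  ⟨fun h => isLieAlgebroidBracket_of_bracket_self hν kν h.2,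
    fun h => ⟨hν.isBidegree kν (by norm_num), bracket_self_of_jacobi hν kν h.jacobi⟩⟩

end Structure

end FiniteRank

end DerivedBracket

/-! ### Degrees and arities of `γ_π` and `μ̃`. -/

section Complementary

variable {E : Type*} [NormedAddCommGroup E] [NormedSpace ℝ E]
  {M : Type*} [TopologicalSpace M] [ChartedSpace E M]
  {F : Type*} [NormedAddCommGroup F] [NormedSpace ℝ F]
  {A : M → Type*} [TopologicalSpace (Bundle.TotalSpace F A)]
  [∀ x, AddCommGroup (A x)] [∀ x, Module ℝ (A x)] [∀ x, TopologicalSpace (A x)]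
  [FiberBundle F A] [VectorBundle ℝ F A] [FiniteDimensional ℝ E] [FiniteDimensional ℝ F]
  [IsManifold 𝓘(ℝ, E) ∞ M] [T2Space M] [ContMDiffVectorBundle ∞ F A 𝓘(ℝ, E)]
  {μ : Symb E F A}

theorem TwoForm.isHom (om : TwoForm E F A) : IsHom 2 (ofForm om.1) := ofForm_isHom om.2.hasDeg

theorem isHom_gammaOf (hμ : IsHom 1 μ) (π : Bivector E F A) : IsHom (-1) (gammaOf μ π) :=
  (ofBivector_isHom π).bracket hμ

theorem hasArity_gammaOf (hμ : IsHom 1 μ) (kμ : HasArity 1 μ) (π : Bivector E F A) :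
    HasArity 2 (gammaOf μ π) :=
  (ofBivector_hasArity π).bracket kμ (ofBivector_isHom π).toIsMulti hμ.toIsMulti

theorem isHom_muTilde (hμ : IsHom 1 μ) (π : Bivector E F A) (om : TwoForm E F A) :
    IsHom 1 (muTilde μ π om) :=
  (isHom_gammaOf hμ π).bracket om.isHom

theorem hasArity_muTilde (hμ : IsHom 1 μ) (kμ : HasArity 1 μ) (π : Bivector E F A)
    (om : TwoForm E F A) : HasArity 1 (muTilde μ π om) :=
  (hasArity_gammaOf hμ kμ π).bracket (ofForm_hasArity om.1) (isHom_gammaOf hμ π).toIsMulti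
    om.isHom.toIsMulti

theorem bracket_form_hasArity (hμ : IsHom 1 μ) (kμ : HasArity 1 μ) (om : TwoForm E F A) :
    bracket μ (ofForm om.1) = ofForm (diff μ om.1) :=
  HasArity.eq_ofForm (kμ.bracket (ofForm_hasArity om.1) hμ.toIsMulti om.isHom.toIsMulti)

theorem isDeg_diff (hμ : IsHom 1 μ) (om : TwoForm E F A) : IsDeg 3 (diff μ om.1) :=
  ((hμ.bracket om.isHom).degree_nil : HasDeg (3 : ℕ) _).isDeg

theorem bracket_ofBivector_ofForm (π : Bivector E F A) {α : Form E F A} (hα : IsDeg 1 α) :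
    bracket (ofBivector π) (ofForm α) = -ofSec (π.sharp α) := by
  rw [bracket_ofForm (ofBivector_isHom π) hα.hasDeg, ins_ofBivector π hα]

theorem Bivector.sharp_neg (π : Bivector E F A) {α : Form E F A} (hα : IsDeg 1 α) :
    π.sharp (-α) = -π.sharp α := by
  have hα' : IsDeg 1 (-α) := by rw [← neg_one_smul ℝ]; exact hα.smul _
  apply ofSec_injective
  rw [ofSec_neg, ← bracket_ofBivector_ofForm π hα, ← neg_inj,
    ← bracket_ofBivector_ofForm π hα', ofForm_neg,
    bracket_neg_right (ofBivector_isHom π).toIsMulti]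

/-! ### The structure `μ̃` of a bivector and a `2`-form. -/

section Recursion

variable (π : Bivector E F A) (om : TwoForm E F A)

/-- `{π, om}`, a function linear in the momenta with `{X, {π, om}} = N X`. -/
def nSymb : Symb E F A := bracket (ofBivector π) (ofForm om.1)

theorem isHom_nSymb : IsHom 0 (nSymb π om) := (ofBivector_isHom π).bracket om.isHom

/-- Since `{X, π} = 0`, the bracket is `{π, i_X om} = -π^♯(i_X om)`, and the sign is absorbed by
`om^♭ X = -i_X om`. -/
theorem bracket_ofSec_nSymb (X : Sec E F A) :
    bracket (ofSec X) (nSymb π om) = ofSec (nTensor π om X) := by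
  have h : IsDeg 1 (innerForm X om.1) := om.2.innerForm X
  rw [nSymb, bracket_jacobi_even (ofSec_isHom X) (ofBivector_isHom π) om.isHom (by decide),
    bracket_ofSec_ofBivector, bracket_zero_left om.isHom.toIsMulti, zero_add,
    bracket_ofSec_ofForm X om.2.hasDeg, bracket_ofBivector_ofForm π h, nTensor, TwoForm.flat,
    π.sharp_neg h, ofSec_neg]

theorem bracket_nSymb_ofSec (X : Sec E F A) :
    bracket (nSymb π om) (ofSec X) = -ofSec (nTensor π om X) := by
  rw [bracket_antisymm_even (isHom_nSymb π om) (ofSec_isHom X) (by decide), bracket_ofSec_nSymb]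

/-- Inserting a function in `π` would give bidegree `(1, -1)`, so it gives zero. Thus neither `{π,
om}` nor `{π, i_X d_μ om}` contributes to the anchor. -/
theorem ins_fnForm_bracket_ofBivector {m : ℤ} {β : Form E F A} (hβ : HasDeg m β) (g : Fn E M) :
    ins (fnForm g) (bracket (ofBivector π) (ofForm β)) = 0 := by
  have h0 := (isDeg_fnForm (F := F) (A := A) g).hasDeg
  have h1 : ins (fnForm g) (ofForm β) = 0 := rfl
  have h2 : ins (fnForm g) (ofBivector π) = 0 :=
    ((ofBivector_isHom π).ins h0).eq_zero_of_neg (k := 1) ((ofBivector_hasArity π).ins _)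
      (by norm_num)
  rw [bracket_ins (ofBivector_isHom π).toIsMulti (ofForm_isHom hβ) h0, h1, h2,
    bracket_zero_left (ofForm_isHom hβ).toIsMulti,
    bracket_zero_right (ofBivector_isHom π).toIsMulti, smul_zero, add_zero]

/-- The Jacobi identity for `{π, {μ, om}}` separates the failure of `om` to be closed from the
deformation of `μ` by `N`. -/
theorem muTilde_eq (hμ : IsHom 1 μ) (kμ : HasArity 1 μ) :
    muTilde μ π om =
      bracket (ofBivector π) (ofForm (diff μ om.1)) + bracket (nSymb π om) μ := by
  have h := bracket_jacobi_even (ofBivector_isHom π) hμ om.isHom (by decide)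
  rw [bracket_antisymm_even hμ ((ofBivector_isHom π).bracket om.isHom) (by decide),
    bracket_form_hasArity hμ kμ om] at h
  rw [h, add_assoc, nSymb, neg_add_cancel, add_zero]
  rfl

theorem bracket_ofSec_muTilde (hμ : IsHom 1 μ) (kμ : HasArity 1 μ) (X : Sec E F A) :
    bracket (ofSec X) (muTilde μ π om) =
      bracket (ofBivector π) (ofForm (innerForm X (diff μ om.1))) +
        (bracket (ofSec (nTensor π om X)) μ + bracket (nSymb π om) (bracket (ofSec X) μ)) := by
  have hd := (isDeg_diff hμ om).hasDeg
  rw [muTilde_eq π om hμ kμ, bracket_add_right (ofSec_isHom X).toIsMulti,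
    bracket_jacobi_even (ofSec_isHom X) (ofBivector_isHom π) (ofForm_isHom hd) (by decide),
    bracket_jacobi_even (ofSec_isHom X) (isHom_nSymb π om) hμ (by decide),
    bracket_ofSec_ofBivector, bracket_zero_left (ofForm_isHom hd).toIsMulti, zero_add,
    bracket_ofSec_ofForm X hd, bracket_ofSec_nSymb]

/-- The three terms of `{X, μ̃}`, bracketed with `Y`, give the `d_μ om` term, `[N X, Y]_μ`, and `[X,
N Y]_μ - N[X, Y]_μ`. -/
theorem derivedBr_muTilde_ofSec (hμ : IsHom 1 μ) (kμ : HasArity 1 μ) (X Y : Sec E F A) :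
    derivedBr (muTilde μ π om) (ofSec X) (ofSec Y) = ofSec (complBr μ π om X Y) := by
  have hd := isDeg_diff hμ om
  have hY := ofSec_isHom Y
  have hX := isHom_bracket_ofSec hμ X
  have hβ : IsDeg 2 (innerForm X (diff μ om.1)) := hd.innerForm X
  have e1 : bracket (bracket (ofBivector π) (ofForm (innerForm X (diff μ om.1)))) (ofSec Y) =
      -ofSec (π.sharp (innerForm X (innerForm Y (diff μ om.1)))) := by
    have h := bracket_jacobi_even hY (ofBivector_isHom π) (ofForm_isHom hβ.hasDeg) (by decide)
    rw [bracket_ofSec_ofBivector, bracket_zero_left (ofForm_isHom hβ.hasDeg).toIsMulti, zero_add,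
      bracket_ofSec_ofForm Y hβ.hasDeg, innerForm_comm Y X, ofForm_neg,
      bracket_neg_right (ofBivector_isHom π).toIsMulti,
      bracket_ofBivector_ofForm π ((hd.innerForm Y).innerForm X), neg_neg,
      bracket_antisymm_even hY ((ofBivector_isHom π).bracket (ofForm_isHom hβ.hasDeg))
        (by decide)] at h
    rw [← h, neg_neg]
  -- Bracketing with `{π, om}` on the left is a derivation acting on sections as `-N`, whence the
  -- two signs.
  have e2 : bracket (bracket (nSymb π om) (bracket (ofSec X) μ)) (ofSec Y) =
      ofSec (lieBr μ X (nTensor π om Y)) - ofSec (nTensor π om (lieBr μ X Y)) := by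
    have h := bracket_jacobi_even (isHom_nSymb π om) hX hY (by decide)
    rw [bracket_nSymb_ofSec, bracket_neg_right hX.toIsMulti, ← ofSec_lieBr hμ kμ,
      ← ofSec_lieBr hμ kμ, bracket_nSymb_ofSec] at h
    rw [← sub_eq_iff_eq_add] at h
    rw [← h]
    abel
  rw [derivedBr, bracket_ofSec_muTilde π om hμ kμ, bracket_add_left _ _ hY.toIsMulti,
    bracket_add_left _ _ hY.toIsMulti, e1, e2, ← ofSec_lieBr hμ kμ, complBr, deformedBr,
    ofSec_sub, ofSec_sub, ofSec_add]
  abel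

theorem derivedBr_muTilde_fnForm (hμ : IsHom 1 μ) (kμ : HasArity 1 μ) (X : Sec E F A)
    (g : Fn E M) : derivedBr (muTilde μ π om) (ofSec X) (ofForm (fnForm g)) =
      ofForm (fnForm (anchor μ (nTensor π om X) g)) := by
  have h0 := (isDeg_fnForm (F := F) (A := A) g).hasDeg
  have hg := ofForm_isHom h0
  have hX := isHom_bracket_ofSec hμ X
  have hn := isHom_nSymb π om
  have e1 : bracket (bracket (ofBivector π) (ofForm (innerForm X (diff μ om.1))))
      (ofForm (fnForm g)) = 0 := by
    have hβ := ((isDeg_diff hμ om).innerForm X).hasDeg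
    rw [bracket_ofForm ((ofBivector_isHom π).bracket (ofForm_isHom hβ)) h0,
      ins_fnForm_bracket_ofBivector π hβ]
  -- Both `g` and its image under `{X, μ}` are functions, and `{π, om}` kills functions, so the
  -- commutator does too.
  have e2 : bracket (bracket (nSymb π om) (bracket (ofSec X) μ)) (ofForm (fnForm g)) = 0 := by
    have hz : ∀ g : Fn E M, bracket (nSymb π om) (ofForm (fnForm g)) = 0 := fun g => by
      rw [bracket_ofForm hn (isDeg_fnForm g).hasDeg]
      exact ins_fnForm_bracket_ofBivector π om.2.hasDeg g
    have h := bracket_jacobi_even hn hX hg (by decide)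
    rw [hz, bracket_zero_right hX.toIsMulti, add_zero, ← ofForm_anchor hμ kμ, hz] at h
    exact h.symm
  rw [derivedBr, bracket_ofSec_muTilde π om hμ kμ, bracket_add_left _ _ hg.toIsMulti,
    bracket_add_left _ _ hg.toIsMulti, e1, e2, zero_add, add_zero, ← ofForm_anchor hμ kμ]

theorem isLieAlgebroidStructure_muTilde_iff (hμ : IsHom 1 μ) (kμ : HasArity 1 μ) :
    IsLieAlgebroidStructure (muTilde μ π om) ↔
      IsLieAlgebroidBracket (complBr μ π om) (fun X => anchor μ (nTensor π om X)) := by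
  have hν := isHom_muTilde hμ π om
  have kν := hasArity_muTilde hμ kμ π om
  have h1 : lieBr (muTilde μ π om) = complBr μ π om := funext fun X => funext fun Y => by
    apply ofSec_injective
    rw [ofSec_lieBr hν kν]
    exact derivedBr_muTilde_ofSec π om hμ kμ X Y
  have h2 : anchor (muTilde μ π om) = fun X => anchor μ (nTensor π om X) :=
    funext fun X => funext fun g => by
      have h := congrFun ((ofForm_anchor hν kν X g).trans
        (derivedBr_muTilde_fnForm π om hμ kμ X g)) []
      rw [← formFn_fnForm (F := F) (A := A) (anchor (muTilde μ π om) X g),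
        ← formFn_fnForm (F := F) (A := A) (anchor μ (nTensor π om X) g)]
      exact congrArg formFn h
  rw [isLieAlgebroidStructure_iff hν kν, h1, h2]

/-- As `γ_π` is odd, `{γ_π, {γ_π, om}}` equals its own negative when `{γ_π, γ_π} = 0`, so `{γ_π, μ̃}
= 0`. Expanding `{μ̃, {om, γ_π}}`, where `{om, γ_π} = -μ̃`, then gives the claim. -/
theorem bracket_derivedBr_gammaOf (hμ : IsHom 1 μ)
    (hγγ : bracket (gammaOf μ π) (gammaOf μ π) = 0) :
    bracket (derivedBr (gammaOf μ π) (ofForm om.1) (ofForm om.1)) (gammaOf μ π) =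
      bracket (muTilde μ π om) (muTilde μ π om) := by
  have hγ := isHom_gammaOf hμ π
  have hν := isHom_muTilde hμ π om
  have e1 : bracket (ofForm om.1) (gammaOf μ π) = -muTilde μ π om :=
    bracket_antisymm_even om.isHom hγ (by decide)
  have e2 : bracket (gammaOf μ π) (muTilde μ π om) = 0 := by
    have h := bracket_jacobi_odd hγ hγ om.isHom (by decide)
    rw [hγγ, bracket_zero_left om.isHom.toIsMulti, zero_sub] at h
    rw [eq_neg_iff_add_eq_zero, ← two_smul ℝ, smul_eq_zero] at h
    exact h.resolve_left two_ne_zero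
  have e3 : bracket (muTilde μ π om) (gammaOf μ π) = 0 := by
    rw [bracket_symm_odd hν hγ (by decide), e2]
  have h := bracket_jacobi_even hν om.isHom hγ (by decide)
  rw [e3, bracket_zero_right om.isHom.toIsMulti, add_zero, e1, bracket_neg_right hν.toIsMulti] at h
  rw [derivedBr, e1, bracket_neg_left _ om.isHom.toIsMulti, bracket_neg_left _ hγ.toIsMulti, ← h,
    neg_neg]

/-- The identity `{π, {μ, μ}} = 2 {γ_π, μ}` gives `{γ_π, μ} = 0`. Then `{γ_π, {π, μ}} = {{γ_π, π},
μ}`, and `{γ_π, π}` is `[π, π]_μ`. -/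
theorem bracket_gammaOf_self (hμ : IsHom 1 μ) (hμμ : bracket μ μ = 0) (hπ : IsPoisson μ π) :
    bracket (gammaOf μ π) (gammaOf μ π) = 0 := by
  have hP := ofBivector_isHom π
  have hγ := isHom_gammaOf hμ π
  have e : bracket (gammaOf μ π) μ = 0 := by
    have h := bracket_jacobi_even hP hμ hμ (by decide)
    rw [hμμ, bracket_zero_right hP.toIsMulti, bracket_symm_odd hμ (hP.bracket hμ) (by decide),
      ← two_smul ℝ, eq_comm, smul_eq_zero] at h
    exact h.resolve_left two_ne_zero
  have h := bracket_jacobi_even hγ hP hμ (by decide)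
  rw [e, bracket_zero_right hP.toIsMulti, add_zero] at h
  refine h.trans ?_
  rw [show bracket (gammaOf μ π) (ofBivector π) = 0 from hπ, bracket_zero_left hμ.toIsMulti]

theorem isLieAlgebroidStructure_muTilde_iff_bracket_eq_zero (hμ : IsHom 1 μ) (kμ : HasArity 1 μ)
    (hγγ : bracket (gammaOf μ π) (gammaOf μ π) = 0) :
    IsLieAlgebroidStructure (muTilde μ π om) ↔
      bracket (derivedBr (gammaOf μ π) (ofForm om.1) (ofForm om.1)) (gammaOf μ π) = 0 := by
  rw [bracket_derivedBr_gammaOf π om hμ hγγ]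
  exact ⟨fun h => h.2, fun h =>
    ⟨(isHom_muTilde hμ π om).isBidegree (hasArity_muTilde hμ kμ π om) (by norm_num), h⟩⟩

theorem isLieAlgebroidStructure_muTilde (hμ : IsHom 1 μ) (kμ : HasArity 1 μ)
    (hμμ : bracket μ μ = 0) (hπ : IsPoisson μ π) (hom : IsComplementary μ π om) :
    IsLieAlgebroidStructure (muTilde μ π om) := by
  rw [isLieAlgebroidStructure_muTilde_iff_bracket_eq_zero π om hμ kμ
    (bracket_gammaOf_self π hμ hμμ hπ), show derivedBr (gammaOf μ π) _ _ = 0 from hom]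
  exact bracket_zero_left (isHom_gammaOf hμ π).toIsMulti

end Recursion

end Complementary

end

end BigBracket

/-! ### The theorem. -/

theorem mainTheorem5
    {E : Type*} [NormedAddCommGroup E] [NormedSpace ℝ E] [FiniteDimensional ℝ E]
    {M : Type*} [TopologicalSpace M] [ChartedSpace E M] [IsManifold 𝓘(ℝ, E) ∞ M]
    [T2Space M] [SigmaCompactSpace M]
    {F : Type*} [NormedAddCommGroup F] [NormedSpace ℝ F] [FiniteDimensional ℝ F]
    {A : M → Type*} [TopologicalSpace (Bundle.TotalSpace F A)]
    [∀ x, AddCommGroup (A x)] [∀ x, Module ℝ (A x)] [∀ x, TopologicalSpace (A x)]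
    [FiberBundle F A] [VectorBundle ℝ F A] [ContMDiffVectorBundle ∞ F A 𝓘(ℝ, E)]
    (μ : Symb E F A) (hμ : IsLieAlgebroidStructure μ)
    (π : Bivector E F A) (om : TwoForm E F A) :
    -- the element `μ̃` has shifted bidegree `(0, 1)`
    IsBidegree 1 2 (muTilde μ π om) ∧
    -- its derived bracket and its anchor
    (∀ X Y : Sec E F A, derivedBr (muTilde μ π om) (ofSec X) (ofSec Y) =
      ofSec (complBr μ π om X Y)) ∧
    (∀ (X : Sec E F A) (g : Fn E M), derivedBr (muTilde μ π om) (ofSec X) (ofForm (fnForm g)) =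
      ofForm (fnForm (anchor μ (nTensor π om X) g))) ∧
    -- the equivalence
    (IsLieAlgebroidStructure (muTilde μ π om) ↔
      IsLieAlgebroidBracket (complBr μ π om) (fun X => anchor μ (nTensor π om X))) ∧
    -- the characterization when `{γ_π, γ_π} = 0`
    (bracket (gammaOf μ π) (gammaOf μ π) = 0 →
      (IsLieAlgebroidStructure (muTilde μ π om) ↔
        bracket (derivedBr (gammaOf μ π) (ofForm om.1) (ofForm om.1)) (gammaOf μ π) = 0)) ∧
    -- the case of a Poisson bivector and a complementary 2-form
    (IsPoisson μ π → IsComplementary μ π om →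
      IsLieAlgebroidStructure (muTilde μ π om) ∧
      IsLieAlgebroidBracket (complBr μ π om) (fun X => anchor μ (nTensor π om X))) := by
  -- Bidegree `(1, 2)` has degree `q - k = 1`.
  have h1 : IsHom 1 μ := hμ.1.isHom.cast (by norm_num)
  have k1 : HasArity 1 μ := hμ.1.hasArity
  refine ⟨(isHom_muTilde h1 π om).isBidegree (hasArity_muTilde h1 k1 π om) (by norm_num),
    derivedBr_muTilde_ofSec π om h1 k1, derivedBr_muTilde_fnForm π om h1 k1,
    isLieAlgebroidStructure_muTilde_iff π om h1 k1,
    isLieAlgebroidStructure_muTilde_iff_bracket_eq_zero π om h1 k1, fun hπ hom => ?_⟩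
  have h := isLieAlgebroidStructure_muTilde π om h1 k1 hμ.2 hπ hom
  exact ⟨h, (isLieAlgebroidStructure_muTilde_iff π om h1 k1).1 h⟩
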